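/- Let $n\in\mathbb N$, $n\ge 3$, write $\langle x\rangle=(1+|x|^2)^{1/2}$, and let $v\in L^\infty(\mathbb R^n)$ be real-valued with $|v(x)|\le C\langle x\rangle^{-4}$ for a.e. $x\in\mathbb R^n$, for some $C\in(0,\infty)$. Let $h=-\Delta+v$ in $L^2(\mathbb R^n)$ with $\operatorname{dom}(h)=W^{2,2}(\mathbb R^n)$. Put $v_1=|v|^{1/2}$ and $v_2=\operatorname{sgn}(v)|v|^{1/2}$ (with $\operatorname{sgn}(v(x))=1$ if $v(x)\ge 0$ and $-1$ otherwise), so that $v=v_1v_2$, and let $$\big((h_0+0)^{-1}f\big)(x)=\frac{1}{(n-2)\,\omega_{n-1}}\int_{\mathbb R^n}|x-y|^{2-n}f(y)\,d^ny,\qquad \omega_{n-1}=\frac{2\pi^{n/2}}{\Gamma(n/2)} .$$ Let $K=\overline{v_2(h_0+0)^{-1}v_1}$ be the closure in $L^2(\mathbb R^n)$ of the integral operator $v_2(h_0+0)^{-1}v_1$ on its natural domain. All derivatives below are in the sense of distributions. The point $0$ is called an eigenvalue of $h$ if $h\psi=0$ has a distributional solution $0\ne\psi\in W^{2,2}(\mathbb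 R^n)$ (such a $\psi$ is an eigenfunction). It is called a resonance of $h$ if there is $0\neq\phi\in\ker(I+K)$ such that $\psi=-(h_0+0)^{-1}v_1\phi$ is a distributional solution of $h\psi=0$ with $\psi\notin L^2(\mathbb R^n)$ (such a $\psi$ is a resonance function). It is called regular for $h$ if it is neither an eigenvalue nor a resonance of $h$. Then: **(i)** If $n\in\{3,4\}$, exactly one of the following four cases holds: (I) $0$ is regular for $h$; (II) $0$ is a resonance but not an eigenvalue of $h$; (III) $0$ is an eigenvalue but not a resonance of $h$; (IV) $0$ is both a resonance and an eigenvalue of $h$. In Case (II) the resonance is simple, that is, the resonance function is unique up to constant multiples. Every resonance function $\psi$ (in Cases (II) and (IV)) satisfies $$\psi\in L^q(\mathbb R^3),\ q\in(3,\infty],\ \text{ if } n=3;\qquad \psi\in L^q(\mathbb R^4),\ q\in(2,\infty],\ \text{ if } n=4;$$ $$\nabla\psi\in[L^2(\mathbb R^n)]^n,\qquad \Delta\psi\in L^q(\mathbb R^n),\ q\in[2,\infty],\qquad \psi\notin L^2(\mathbb R^n).$$ Every eigenfunction $\psi$ (in Cases (III) and (IV)) satisfies $$\psi,\ \Delta\psi\in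 L^q(\mathbb R^n),\ q\in[2,\infty],\qquad \nabla\psi\in[L^2(\mathbb R^n)]^n .$$ **(ii)** If $n\ge5$, exactly one of the following two cases holds: (I) $0$ is regular for $h$; (II) $0$ is an eigenvalue of $h$. In Case (II) every eigenfunction $\psi$ satisfies $$\psi,\ \Delta\psi\in L^q(\mathbb R^n),\quad q\in\begin{cases}\big(\tfrac{n}{n-2},\infty\big], & 5\le n\le 7,\\[1mm] \big(\tfrac{2n}{n+4},\tfrac{2n}{n-4}\big), & n\ge 8,\end{cases}$$ $$\nabla\psi\in[L^q(\mathbb R^n)]^n,\quad q\in\begin{cases}(5/3,\infty), & n=5,\\ (3/2,\infty), & n=6,\\ (7/5,14), & n=7,\\ \big(\tfrac{2n}{n+4},\tfrac{2n}{n-6}\big), & n\ge 8.\end{cases}$$ In particular, there are no zero-energy resonances of $h$ in dimensions $n\ge5$. **(iii)** For every $n\ge 3$, $0$ is regular for $h$ if and only if $\ker(I+K)=\{0\}$. -/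

import Mathlib

open MeasureTheory
open scoped ENNReal

namespace ThresholdResonance

noncomputable section

/-- The space `ℝⁿ` with its Euclidean norm. -/
abbrev Rn (n : ℕ) : Type := EuclideanSpace ℝ (Fin n)

/-- Complex-valued `L²(ℝⁿ)`. -/
abbrev L2 (n : ℕ) : Type := Lp ℂ 2 (volume : Measure (Rn n))

/-- Real-valued smooth compactly supported functions on `ℝⁿ` (here `⊤ : ℕ∞`). Testing against these
is the same as testing against complex-valued ones. -/
abbrev TestFn (n : ℕ) : Type := TestFunction (⊤ : TopologicalSpace.Opens (Rn n)) ℝ ⊤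

/-- The bracket `⟨x⟩ = (1 + |x|²)^{1/2}`. -/
def bracket {n : ℕ} (x : Rn n) : ℝ := Real.sqrt (1 + ‖x‖ ^ 2)

/-! ### Weak derivatives, Sobolev space, distributional solutions -/

/-- The locally integrable function `g` is the distributional partial derivative `∂ⱼ f`. -/
def HasWeakPartial {n : ℕ} (f g : Rn n → ℂ) (j : Fin n) : Prop :=
  LocallyIntegrable f volume ∧ LocallyIntegrable g volume ∧
    ∀ η : TestFn n,
      ∫ x, (fderiv ℝ (η : Rn n → ℝ) x (EuclideanSpace.single j 1)) • f x = - ∫ x, η x • g x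

/-- The locally integrable function `g` is the distributional Laplacian `Δ f`. -/
def HasWeakLaplacian {n : ℕ} (f g : Rn n → ℂ) : Prop :=
  LocallyIntegrable f volume ∧ LocallyIntegrable g volume ∧
    ∀ η : TestFn n,
      ∫ x, (Laplacian.laplacian (η : Rn n → ℝ) x) • f x = ∫ x, η x • g x

/-- `∇ f ∈ [L^q(ℝⁿ)]ⁿ`, with the gradient in the sense of distributions. -/
def GradientMemLp {n : ℕ} (f : Rn n → ℂ) (q : ℝ≥0∞) : Prop :=
  ∃ g : Fin n → Rn n → ℂ, ∀ j, HasWeakPartial f (g j) j ∧ MemLp (g j) q volume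

/-- `Δ f ∈ L^q(ℝⁿ)`, with the Laplacian in the sense of distributions. -/
def LaplacianMemLp {n : ℕ} (f : Rn n → ℂ) (q : ℝ≥0∞) : Prop :=
  ∃ g : Rn n → ℂ, HasWeakLaplacian f g ∧ MemLp g q volume

/-- `f ∈ W^{2,2}(ℝⁿ)`: `f` and its distributional derivatives of order one and two are in `L²`. -/
def MemW22 {n : ℕ} (f : Rn n → ℂ) : Prop :=
  MemLp f 2 volume ∧
    ∃ g : Fin n → Rn n → ℂ, ∃ k : Fin n → Fin n → Rn n → ℂ,
      (∀ i, HasWeakPartial f (g i) i ∧ MemLp (g i) 2 volume) ∧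
      ∀ i j, HasWeakPartial (g i) (k i j) j ∧ MemLp (k i j) 2 volume

/-- `ψ ∈ L¹_loc` solves `h ψ = -Δψ + vψ = 0` in the sense of distributions. -/
def IsDistributionalSolution {n : ℕ} (v : Rn n → ℝ) (ψ : Rn n → ℂ) : Prop :=
  LocallyIntegrable ψ volume ∧
    ∀ η : TestFn n,
      ∫ x, (-(Laplacian.laplacian (η : Rn n → ℝ) x) + v x * η x) • ψ x = 0

/-! ### The factorization of the potential and the Birman-Schwinger operator at zero energy -/

/-- `v₁ = |v|^{1/2}`. -/
def v₁ {n : ℕ} (v : Rn n → ℝ) (x : Rn n) : ℝ := Real.sqrt |v x|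

/-- `v₂ = sgn(v) |v|^{1/2}`, where `sgn(v(x)) = 1` if `v(x) ≥ 0` and `-1` otherwise. -/
def v₂ {n : ℕ} (v : Rn n → ℝ) (x : Rn n) : ℝ :=
  (if 0 ≤ v x then 1 else -1) * Real.sqrt |v x|

/-- The area `ω_{n-1} = 2 π^{n/2} / Γ(n/2)` of the unit sphere in `ℝⁿ`. -/
def sphereArea (n : ℕ) : ℝ := 2 * Real.pi ^ ((n : ℝ) / 2) / Real.Gamma ((n : ℝ) / 2)

/-- The zero-energy Green's function `g₀(0; x, y) = [(n-2) ω_{n-1}]⁻¹ |x - y|^{2-n}` of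
`h₀ = -Δ`, for `n ≥ 3` (the value on the diagonal is irrelevant). -/
def g₀ {n : ℕ} (x y : Rn n) : ℝ :=
  (((n : ℝ) - 2) * sphereArea n)⁻¹ * ‖x - y‖ ^ (2 - (n : ℝ))

/-- `((h₀ + 0)⁻¹ f)(x) = ∫ g₀(0; x, y) f(y) dⁿy`. -/
def freeResolventZero {n : ℕ} (f : Rn n → ℂ) (x : Rn n) : ℂ := ∫ y, g₀ x y • f y

/-- The natural domain of `v₂ (h₀ + 0)⁻¹ v₁` in `L²(ℝⁿ)`: those `φ ∈ L²` for which the integral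
`((h₀ + 0)⁻¹ v₁ φ)(x)` converges absolutely for a.e. `x` and `v₂ (h₀ + 0)⁻¹ v₁ φ ∈ L²`. -/
def bsDomain {n : ℕ} (v : Rn n → ℝ) : Submodule ℂ (L2 n) where
  carrier := {φ | (∀ᵐ x : Rn n, Integrable (fun y : Rn n => g₀ x y • (v₁ v y • φ y))) ∧
    MemLp (fun x : Rn n => v₂ v x • freeResolventZero (fun y => v₁ v y • φ y) x) 2 volume}
  zero_mem' := by
    have h0 : ∀ᵐ y : Rn n, (0 : L2 n) y = 0 := Lp.coeFn_zero ℂ 2 volume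
    have hi (x : Rn n) :
        (fun y : Rn n => g₀ x y • (v₁ v y • (0 : L2 n) y)) =ᵐ[volume] fun _ => (0 : ℂ) := by
      filter_upwards [h0] with y hy
      rw [hy, smul_zero, smul_zero]
    refine ⟨Filter.Eventually.of_forall fun x => ?_, ?_⟩
    · exact (integrable_congr (hi x)).2 (integrable_zero _ _ _)
    · have : (fun x : Rn n => v₂ v x • freeResolventZero (fun y => v₁ v y • (0 : L2 n) y) x)
          = fun _ => (0 : ℂ) := by
        funext x
        simp only [freeResolventZero]
        rw [integral_congr_ae (hi x)]
        simp
      rw [this]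
      exact MemLp.zero
  add_mem' := by
    rintro φ χ ⟨h1, h2⟩ ⟨h3, h4⟩
    have ha : ∀ᵐ y : Rn n, (φ + χ : L2 n) y = φ y + χ y := Lp.coeFn_add φ χ
    have hi (x : Rn n) : (fun y : Rn n => g₀ x y • (v₁ v y • (φ + χ : L2 n) y)) =ᵐ[volume]
        fun y => g₀ x y • (v₁ v y • φ y) + g₀ x y • (v₁ v y • χ y) := by
      filter_upwards [ha] with y hy
      rw [hy, smul_add, smul_add]
    refine ⟨?_, (memLp_congr_ae ?_).2 (h2.add h4)⟩
    · filter_upwards [h1, h3] with x hx hx'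
      exact (integrable_congr (hi x)).2 (hx.add hx')
    · filter_upwards [h1, h3] with x hx hx'
      simp only [freeResolventZero, Pi.add_apply]
      rw [integral_congr_ae (hi x), integral_add hx hx', smul_add]
  smul_mem' := by
    rintro c φ ⟨h1, h2⟩
    have ha : ∀ᵐ y : Rn n, (c • φ : L2 n) y = c * φ y := Lp.coeFn_smul c φ
    have hi (x : Rn n) : (fun y : Rn n => g₀ x y • (v₁ v y • (c • φ : L2 n) y)) =ᵐ[volume]
        fun y => c * (g₀ x y • (v₁ v y • φ y)) := by
      filter_upwards [ha] with y hy
      simp only [hy, Complex.real_smul]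
      ring
    refine ⟨?_, (memLp_congr_ae ?_).2 (h2.const_mul c)⟩
    · filter_upwards [h1] with x hx
      exact (integrable_congr (hi x)).2 (hx.const_mul c)
    · refine Filter.Eventually.of_forall fun x => ?_
      simp only [freeResolventZero]
      rw [integral_congr_ae (hi x), integral_const_mul]
      simp only [Complex.real_smul]
      ring

/-- The operator `v₂ (h₀ + 0)⁻¹ v₁` in `L²(ℝⁿ)` on its natural domain. -/
def bsOperator {n : ℕ} (v : Rn n → ℝ) : L2 n →ₗ.[ℂ] L2 n where
  domain := bsDomain v
  toFun :=
    { toFun := fun φ => φ.2.2.toLp _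
      map_add' := by
        rintro ⟨φ, h1, h2⟩ ⟨χ, h3, h4⟩
        have ha : ∀ᵐ y : Rn n, (φ + χ : L2 n) y = φ y + χ y := Lp.coeFn_add φ χ
        rw [← MemLp.toLp_add]
        apply MemLp.toLp_congr
        filter_upwards [h1, h3] with x hx hx'
        have hi : (fun y : Rn n => v₁ v y • (φ + χ : L2 n) y) =ᵐ[volume]
            fun y => v₁ v y • φ y + v₁ v y • χ y := by
          filter_upwards [ha] with y hy
          rw [hy, smul_add]
        have hi' : (fun y : Rn n => g₀ x y • (v₁ v y • (φ + χ : L2 n) y)) =ᵐ[volume]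
            fun y => g₀ x y • (v₁ v y • φ y) + g₀ x y • (v₁ v y • χ y) := by
          filter_upwards [hi] with y hy
          rw [hy, smul_add]
        simp only [freeResolventZero, Pi.add_apply, Submodule.coe_add]
        rw [integral_congr_ae hi', integral_add hx hx', smul_add]
      map_smul' := by
        rintro c ⟨φ, h1, h2⟩
        have ha : ∀ᵐ y : Rn n, (c • φ : L2 n) y = c * φ y := Lp.coeFn_smul c φ
        simp only [RingHom.id_apply]
        rw [← MemLp.toLp_const_smul]
        apply MemLp.toLp_congr
        refine Filter.Eventually.of_forall fun x => ?_
        have hi' : (fun y : Rn n => g₀ x y • (v₁ v y • (c • φ : L2 n) y)) =ᵐ[volume]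
            fun y => c * (g₀ x y • (v₁ v y • φ y)) := by
          filter_upwards [ha] with y hy
          simp only [hy, Complex.real_smul]
          ring
        simp only [freeResolventZero, Pi.smul_apply, Submodule.coe_smul]
        rw [integral_congr_ae hi', integral_const_mul]
        simp only [Complex.real_smul, smul_eq_mul]
        ring }

/-- The kernel of `I + T` for a linear operator `T` defined on a subspace: all `φ` in the domain
of `T` with `φ + T φ = 0`. -/
def kerIdAdd {n : ℕ} (T : L2 n →ₗ.[ℂ] L2 n) : Submodule ℂ (L2 n) :=
  (LinearMap.ker (T.domain.subtype + T.toFun)).map T.domain.subtype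

/-- `ker(I + closure(v₂ (h₀ + 0)⁻¹ v₁))`. -/
def bsKernel {n : ℕ} (v : Rn n → ℝ) : Submodule ℂ (L2 n) := kerIdAdd (bsOperator v).closure

/-! ### Threshold behaviour -/

/-- `ψ` is a zero-energy eigenfunction of `h = -Δ + v`: a nonzero distributional solution of
`h ψ = 0` in `dom(h) = W^{2,2}(ℝⁿ)`. -/
def IsEigenfunction {n : ℕ} (v : Rn n → ℝ) (ψ : Rn n → ℂ) : Prop :=
  MemW22 ψ ∧ ¬ (ψ =ᵐ[volume] 0) ∧ IsDistributionalSolution v ψ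

/-- `ψ` is a zero-energy resonance function of `h`: `ψ = -(h₀ + 0)⁻¹ v₁ φ` a.e. for some nonzero
`φ` in the Birman-Schwinger kernel, `h ψ = 0` in the sense of distributions, and `ψ ∉ L²`. -/
def IsResonanceFunction {n : ℕ} (v : Rn n → ℝ) (ψ : Rn n → ℂ) : Prop :=
  (∃ φ : L2 n, φ ∈ bsKernel v ∧ φ ≠ 0 ∧
    ψ =ᵐ[volume] fun x => -freeResolventZero (fun y => v₁ v y • φ y) x) ∧
  IsDistributionalSolution v ψ ∧ ¬ MemLp ψ 2 volume

/-- `0` is a zero-energy eigenvalue of `h`. -/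
def IsZeroEigenvalue {n : ℕ} (v : Rn n → ℝ) : Prop := ∃ ψ, IsEigenfunction v ψ

/-- `0` is a zero-energy resonance of `h`. -/
def IsZeroResonance {n : ℕ} (v : Rn n → ℝ) : Prop := ∃ ψ, IsResonanceFunction v ψ

/-- `0` is a regular point for `h`. -/
def IsRegularPoint {n : ℕ} (v : Rn n → ℝ) : Prop := ¬ IsZeroEigenvalue v ∧ ¬ IsZeroResonance v

/-- The four cases: (I) regular, (II) resonance, (III) eigenvalue, (IV) both. -/
inductive ThresholdCase
  | I
  | II
  | III
  | IV

/-- The meaning of each of the four cases for the potential `v`. -/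
def ThresholdCase.Holds {n : ℕ} (v : Rn n → ℝ) : ThresholdCase → Prop
  | .I => IsRegularPoint v
  | .II => IsZeroResonance v ∧ ¬ IsZeroEigenvalue v
  | .III => IsZeroEigenvalue v ∧ ¬ IsZeroResonance v
  | .IV => IsZeroResonance v ∧ IsZeroEigenvalue v

end

end ThresholdResonance

open ThresholdResonance

/-!
Every zero-energy state has the form `ψ = -(h₀ + 0)⁻¹ (vψ)`, with the source `vψ` of size
`⟨x⟩^{-n-2}`. The Newtonian potential of such a source is `O(⟨x⟩^{2-n})`, its gradient is
`O(⟨x⟩^{1-n})` and its Laplacian is `O(⟨x⟩^{-n-2})`, and all integrability statements can be read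
off from these three rates. For `n ≥ 5` the first rate is square integrable, so that there are no
resonances.

Three facts put states into this form.

* An eigenfunction `ψ` is the Newtonian potential of its own source
  (`IsDistributionalSolution.eq_neg_freeResolventZero`): test the equation with the Newtonian
  potential of a test function, cut off at infinity. Consequently `φ = v₂ψ` lies in the
  Birman-Schwinger kernel.
* The operator `v₂ (h₀ + 0)⁻¹ v₁` on its natural domain is already closed (`isClosed_bsOperator`),
  because the relation `χ = v₂ (h₀ + 0)⁻¹ v₁ φ` amounts to continuous linear equations in
  `(φ, χ)`, one for each test function. Hence `ker(I + K)` consists of the `L²` solutions of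
  `φ = -v₂ (h₀ + 0)⁻¹ v₁ φ` (`mem_bsKernel_iff`).
* Such a `φ` is `O(⟨x⟩^{-n})` (`exists_norm_le_jap_of_mem_bsKernel`). No bootstrap is needed: after
  removal of a part with range in `O(⟨x⟩^{-n})`, the positive kernel `⟨x⟩⁻² |x - y|^{2-n} ⟨y⟩⁻²` is
  a contraction both on functions of size `⟨x⟩^{-n}` and in a weighted `L¹` space containing `L²`,
  and a comparison principle (`ae_le_of_le_lintegral_kernel`) gives the bound.

Conversely every `φ` in the kernel yields a distributional solution `ψ = -(h₀ + 0)⁻¹ v₁ φ`, which is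
an eigenfunction or a resonance function according to whether it is square integrable; its second
derivatives are in `L²` by the identity `∑ᵢⱼ ‖∂ᵢ∂ⱼ u‖² = ‖Δu‖²`, applied by duality
(`exists_hasWeakPartial_gradPotential`). This is the characterization of regular points.

If the source has mean zero then the potential gains one power of decay and becomes square
integrable (`exists_norm_freeResolventZero_le_of_integral_eq_zero`). So the mean `∫ v₁φ` does not
vanish on resonance functions, and when there are no eigenfunctions it is injective on the kernel:
the resonance is simple.
-/

namespace ThresholdResonance

open Filter Topology

/-! ### The kernels `|z|^{-m}` and the weights `⟨x⟩^{-k}` -/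

/-- The singular kernel `z ↦ |z|^{-m}`, with the junk value `0` at the origin when `m ≠ 0`. -/
noncomputable def riesz {n : ℕ} (m : ℕ) (z : Rn n) : ℝ := (‖z‖ ^ m)⁻¹

/-- The weight `x ↦ ⟨x⟩^{-k}`. -/
noncomputable def jap {n : ℕ} (k : ℕ) (x : Rn n) : ℝ := (bracket x ^ k)⁻¹

section Weights

variable {n : ℕ}

lemma one_le_bracket (x : Rn n) : 1 ≤ bracket x :=
  Real.one_le_sqrt.2 (by nlinarith [sq_nonneg ‖x‖])

lemma bracket_pos (x : Rn n) : 0 < bracket x := one_pos.trans_le (one_le_bracket x)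

lemma norm_le_bracket (x : Rn n) : ‖x‖ ≤ bracket x :=
  Real.le_sqrt_of_sq_le (by linarith)

lemma bracket_le_one_add_norm (x : Rn n) : bracket x ≤ 1 + ‖x‖ := by
  rw [bracket, Real.sqrt_le_left (by positivity)]
  nlinarith [norm_nonneg x]

lemma bracket_le_add_norm_sub (x y : Rn n) : bracket x ≤ bracket y + ‖x - y‖ := by
  have hy := norm_le_bracket y
  have hy2 : bracket y ^ 2 = 1 + ‖y‖ ^ 2 := Real.sq_sqrt (by positivity)
  have h : ‖x‖ ≤ ‖y‖ + ‖x - y‖ := by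
    simpa using norm_add_le y (x - y)
  have h0 := bracket_pos y
  have h1 : (0 : ℝ) ≤ ‖x - y‖ := norm_nonneg _
  rw [bracket, Real.sqrt_le_left (by positivity)]
  have h2 : ‖x‖ ^ 2 ≤ (‖y‖ + ‖x - y‖) ^ 2 := pow_le_pow_left₀ (norm_nonneg _) h 2
  nlinarith

@[fun_prop]
lemma continuous_bracket : Continuous (bracket : Rn n → ℝ) := by
  unfold bracket; fun_prop

lemma jap_pos (k : ℕ) (x : Rn n) : 0 < jap k x := inv_pos.2 (pow_pos (bracket_pos x) k)

lemma jap_nonneg (k : ℕ) (x : Rn n) : 0 ≤ jap k x := (jap_pos k x).le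

lemma jap_add (j k : ℕ) (x : Rn n) : jap (j + k) x = jap j x * jap k x := by
  simp [jap, pow_add, mul_comm]

lemma jap_anti {j k : ℕ} (h : j ≤ k) (x : Rn n) : jap k x ≤ jap j x :=
  inv_anti₀ (pow_pos (bracket_pos x) _) (pow_le_pow_right₀ (one_le_bracket x) h)

lemma jap_le_one (k : ℕ) (x : Rn n) : jap k x ≤ 1 := by
  simpa [jap] using jap_anti (Nat.zero_le k) x

@[fun_prop]
lemma continuous_jap (k : ℕ) : Continuous (jap k : Rn n → ℝ) := by
  unfold jap
  exact (continuous_bracket.pow k).inv₀ fun x => (pow_pos (bracket_pos x) k).ne'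

lemma riesz_nonneg (m : ℕ) (z : Rn n) : 0 ≤ riesz m z := by unfold riesz; positivity

lemma riesz_neg (m : ℕ) (z : Rn n) : riesz m (-z) = riesz m z := by simp [riesz]

lemma riesz_sub_comm (m : ℕ) (x y : Rn n) : riesz m (x - y) = riesz m (y - x) := by
  rw [← riesz_neg, neg_sub]

@[fun_prop]
lemma measurable_riesz (m : ℕ) : Measurable (riesz m : Rn n → ℝ) := by
  unfold riesz; fun_prop

lemma norm_mul_jap_succ_le (k : ℕ) (x : Rn n) : ‖x‖ * jap (k + 1) x ≤ jap k x := by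
  rw [jap_add, mul_comm, mul_assoc]
  refine mul_le_of_le_one_right (jap_nonneg k x) ?_
  rw [jap, pow_one, inv_mul_le_iff₀ (bracket_pos x), mul_one]
  exact norm_le_bracket x

lemma jap_eq_rpow (k : ℕ) (x : Rn n) : jap k x = (1 + ‖x‖ ^ 2) ^ (-(k : ℝ) / 2) := by
  have h0 : (0 : ℝ) ≤ 1 + ‖x‖ ^ 2 := by positivity
  rw [jap, bracket, Real.sqrt_eq_rpow, ← Real.rpow_mul_natCast h0, ← Real.rpow_neg h0]
  congr 1; ring

lemma integrable_jap {k : ℕ} (hk : n < k) : Integrable (jap k : Rn n → ℝ) := by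
  have h := integrable_rpow_neg_one_add_norm_sq (E := Rn n) (μ := volume) (r := (k : ℝ))
    (by simpa using hk)
  exact h.congr (Filter.Eventually.of_forall fun x => (jap_eq_rpow k x).symm)

lemma memLp_jap {k : ℕ} {q : ℝ≥0∞} (hq : (n : ℝ≥0∞) < k * q) (hq0 : 1 ≤ q) :
    MemLp (jap k : Rn n → ℝ) q := by
  rcases eq_or_ne q ⊤ with rfl | hqt
  · refine memLp_top_of_bound (continuous_jap k).aestronglyMeasurable 1
      (Filter.Eventually.of_forall fun x => ?_)
    rw [Real.norm_of_nonneg (jap_nonneg k x)]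
    exact jap_le_one k x
  have hq0' : q ≠ 0 := (one_pos.trans_le hq0).ne'
  rw [← integrable_norm_rpow_iff (continuous_jap k).aestronglyMeasurable hq0' hqt]
  have hlt : (n : ℝ) < k * q.toReal := by
    have := (ENNReal.toReal_lt_toReal (by simp)
      (ENNReal.mul_ne_top (by simp) hqt)).2 hq
    simpa using this
  have h := integrable_rpow_neg_one_add_norm_sq (E := Rn n) (μ := volume) (r := k * q.toReal)
    (by simpa using hlt)
  refine h.congr (Filter.Eventually.of_forall fun x => ?_)
  have h0 : (0 : ℝ) ≤ 1 + ‖x‖ ^ 2 := by positivity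
  simp only [Real.norm_of_nonneg (jap_nonneg k x)]
  rw [jap_eq_rpow, ← Real.rpow_mul h0]
  congr 1; ring

lemma locallyIntegrable_riesz {m : ℕ} (hm : m < n) : LocallyIntegrable (riesz m : Rn n → ℝ) := by
  refine locallyIntegrable_of_norm_le_rpow (C := 1) (α := m) (by simp; omega) (by simpa using hm)
    (Filter.Eventually.of_forall fun x => ?_) (measurable_riesz m).aestronglyMeasurable
  rw [Real.norm_of_nonneg (riesz_nonneg m x), one_mul, Real.rpow_neg (norm_nonneg x),
    Real.rpow_natCast, riesz]

lemma lintegral_riesz_ball_zero {m : ℕ} (hm : m < n) {r : ℝ} (hr : 0 < r) :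
    ∫⁻ z in Metric.ball (0 : Rn n) r, ENNReal.ofReal (riesz m z) =
      ENNReal.ofReal (r ^ (n - m) * ∫ z in Metric.ball (0 : Rn n) 1, riesz m z) := by
  have hi (s : ℝ) : IntegrableOn (riesz m) (Metric.ball (0 : Rn n) s) :=
    ((locallyIntegrable_riesz hm).integrableOn_isCompact
      (isCompact_closedBall 0 s)).mono_set Metric.ball_subset_closedBall
  rw [← ofReal_integral_eq_lintegral_ofReal (hi r)
    (Filter.Eventually.of_forall fun z => riesz_nonneg m z)]
  congr 1
  have h := Measure.setIntegral_comp_smul_of_pos (volume : Measure (Rn n)) (riesz m)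
    (Metric.ball (0 : Rn n) 1) hr
  have hball := smul_unitBall (E := Rn n) hr.ne'
  rw [Real.norm_of_nonneg hr.le] at hball
  rw [hball] at h
  have hs (z : Rn n) : riesz m (r • z) = (r ^ m)⁻¹ * riesz m z := by
    simp [riesz, norm_smul, mul_pow, abs_of_pos hr]
    ring
  simp only [hs, smul_eq_mul] at h
  rw [integral_const_mul] at h
  have hfr : Module.finrank ℝ (Rn n) = n := by simp
  rw [hfr] at h
  have : r ^ n = r ^ (n - m) * r ^ m := by rw [← pow_add]; congr 1; omega
  rw [this] at h
  have hr' := (pow_pos hr m).ne'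
  have hr'' := (pow_pos hr (n - m)).ne'
  field_simp at h
  linarith

/-- The mass of `|z|^{-m}` on the unit ball. -/
noncomputable def rieszMass (n m : ℕ) : ℝ := ∫ z in Metric.ball (0 : Rn n) 1, riesz m z

lemma rieszMass_nonneg (n m : ℕ) : 0 ≤ rieszMass n m :=
  setIntegral_nonneg measurableSet_ball fun z _ => riesz_nonneg m z

lemma lintegral_riesz_ball {m : ℕ} (hm : m < n) {r : ℝ} (hr : 0 < r) (x : Rn n) :
    ∫⁻ y, (Metric.ball x r).indicator (fun y => ENNReal.ofReal (riesz m (x - y))) y =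
      ENNReal.ofReal (r ^ (n - m) * rieszMass n m) := by
  rw [rieszMass, ← lintegral_riesz_ball_zero hm hr, ← lintegral_indicator measurableSet_ball,
    ← lintegral_sub_left_eq_self _ x]
  refine lintegral_congr fun y => ?_
  simp [Set.indicator, dist_eq_norm]

lemma jap_le_of_near (k : ℕ) {x y : Rn n} (h : ‖x - y‖ < bracket x / 2) :
    jap k y ≤ 2 ^ k * jap k x := by
  have h1 := bracket_le_add_norm_sub x y
  have h2 : bracket x / 2 ≤ bracket y := by linarith
  have hx := bracket_pos x
  calc jap k y ≤ ((bracket x / 2) ^ k)⁻¹ :=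
        inv_anti₀ (by positivity) (pow_le_pow_left₀ (by positivity) h2 k)
    _ = 2 ^ k * jap k x := by rw [jap, div_pow, inv_div, div_eq_mul_inv]

lemma riesz_le_of_far (m : ℕ) {x y : Rn n} (h : bracket x / 2 ≤ ‖x - y‖) :
    riesz m (x - y) ≤ 2 ^ m * jap m x := by
  have hx := bracket_pos x
  calc riesz m (x - y) ≤ ((bracket x / 2) ^ m)⁻¹ :=
        inv_anti₀ (by positivity) (pow_le_pow_left₀ (by positivity) h m)
    _ = 2 ^ m * jap m x := by rw [jap, div_pow, inv_div, div_eq_mul_inv]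

/-- The volume factor of the ball of radius `⟨x⟩/2` is paid for by the weight `⟨x⟩^{-n-1}`. -/
lemma jap_mul_pow_le {m : ℕ} (hm : m < n) (x : Rn n) :
    jap (n + 1) x * (bracket x / 2) ^ (n - m) ≤ jap m x := by
  have hx := bracket_pos x
  have h1 : jap (n + 1) x * bracket x ^ (n - m) ≤ jap m x := by
    have : n + 1 = (n - m) + (m + 1) := by omega
    rw [this, jap_add, jap, mul_right_comm, inv_mul_cancel₀ (pow_pos hx _).ne', one_mul]
    exact jap_anti (Nat.le_succ m) x
  have h2 : (bracket x / 2) ^ (n - m) ≤ bracket x ^ (n - m) :=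
    pow_le_pow_left₀ (by positivity) (by linarith) _
  exact (mul_le_mul_of_nonneg_left h2 (jap_nonneg _ x)).trans h1

lemma lintegral_jap {k : ℕ} (hk : n < k) :
    ∫⁻ y : Rn n, ENNReal.ofReal (jap k y) = ENNReal.ofReal (∫ y : Rn n, jap k y) :=
  (ofReal_integral_eq_lintegral_ofReal (integrable_jap hk)
    (Filter.Eventually.of_forall fun y => jap_nonneg k y)).symm

/-- Convolving `|z|^{-m}`, `m < n`, with `⟨y⟩^{-n-1}` keeps the decay `⟨x⟩^{-m}`: where
`|x - y| ≥ ⟨x⟩/2` the kernel is small, elsewhere `⟨y⟩` is comparable to `⟨x⟩`. -/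
lemma exists_lintegral_riesz_mul_jap_le {m : ℕ} (hm : m < n) :
    ∃ C : ℝ, 0 < C ∧ ∀ x : Rn n,
      ∫⁻ y, ENNReal.ofReal (riesz m (x - y)) * ENNReal.ofReal (jap (n + 1) y) ≤
        ENNReal.ofReal (C * jap m x) := by
  obtain ⟨M, hM⟩ : ∃ M, M = ∫ y : Rn n, jap (n + 1) y := ⟨_, rfl⟩
  have hM0 : 0 ≤ M := hM ▸ integral_nonneg fun y => jap_nonneg _ y
  have hR := rieszMass_nonneg n m
  refine ⟨2 ^ m * M + 2 ^ (n + 1) * rieszMass n m + 1, by positivity, fun x => ?_⟩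
  have hx := bracket_pos x
  have h5 := jap_nonneg m x
  have h6 := jap_nonneg (n + 1) x
  have hpt (y : Rn n) : ENNReal.ofReal (riesz m (x - y)) * ENNReal.ofReal (jap (n + 1) y) ≤
      ENNReal.ofReal (2 ^ m * jap m x) * ENNReal.ofReal (jap (n + 1) y) +
      ENNReal.ofReal (2 ^ (n + 1) * jap (n + 1) x) *
        (Metric.ball x (bracket x / 2)).indicator
          (fun y => ENNReal.ofReal (riesz m (x - y))) y := by
    by_cases h : ‖x - y‖ < bracket x / 2
    · rw [Set.indicator_of_mem (by simpa [dist_eq_norm, norm_sub_rev] using h)]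
      refine le_add_left ?_
      rw [mul_comm]
      exact mul_le_mul_left (ENNReal.ofReal_le_ofReal (jap_le_of_near _ h)) _
    · refine le_add_right ?_
      exact mul_le_mul_left (ENNReal.ofReal_le_ofReal (riesz_le_of_far m (not_lt.1 h))) _
  refine (lintegral_mono hpt).trans ?_
  rw [lintegral_add_left (by fun_prop), lintegral_const_mul _ (by fun_prop),
    lintegral_const_mul _ (Measurable.indicator (by fun_prop) measurableSet_ball),
    lintegral_riesz_ball hm (by positivity), lintegral_jap (Nat.lt_succ_self n), ← hM,
    ← ENNReal.ofReal_mul (by positivity), ← ENNReal.ofReal_mul (by positivity),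
    ← ENNReal.ofReal_add (by positivity) (by positivity)]
  refine ENNReal.ofReal_le_ofReal ?_
  have h4 := mul_le_mul_of_nonneg_left (jap_mul_pow_le hm x)
    (show (0 : ℝ) ≤ 2 ^ (n + 1) * rieszMass n m by positivity)
  calc _ = 2 ^ m * M * jap m x + 2 ^ (n + 1) * rieszMass n m *
        (jap (n + 1) x * (bracket x / 2) ^ (n - m)) := by ring
    _ ≤ 2 ^ m * M * jap m x + 2 ^ (n + 1) * rieszMass n m * jap m x := by gcongr
    _ ≤ _ := by linarith

end Weights

/-! ### Decay of subsolutions of the Birman-Schwinger equation -/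

/-- Comparison principle for subsolutions of a positive integral operator: if the operator halves
both the weight `p` (acting on functions) and the weight `q` (acting by duality), then a subsolution
of `Φ ≤ k Φ + B p` with `∫ q Φ < ∞` is dominated by `2 B p`. The excess `Φ - 2 B p` satisfies
`Ψ ≤ k Ψ`, and `k` is a strict contraction in `L¹(q)`. -/
lemma ae_le_of_le_lintegral_kernel {α : Type*} [MeasurableSpace α] {μ : Measure α} [SFinite μ]
    {k : α → α → ℝ≥0∞} (hk : Measurable (Function.uncurry k)) {Φ p q : α → ℝ≥0∞}
    (hΦ : Measurable Φ) (hp : Measurable p) (hq : Measurable q) (B : ℝ≥0∞)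
    (h : ∀ᵐ x ∂μ, Φ x ≤ (∫⁻ y, k x y * Φ y ∂μ) + B * p x)
    (hkp : ∀ x, ∫⁻ y, k x y * p y ∂μ ≤ 2⁻¹ * p x)
    (hkq : ∀ y, ∫⁻ x, q x * k x y ∂μ ≤ 2⁻¹ * q y)
    (hfin : ∫⁻ x, q x * Φ x ∂μ ≠ ⊤) (hq0 : ∀ x, q x ≠ 0) :
    ∀ᵐ x ∂μ, Φ x ≤ 2 * B * p x := by
  set Ψ : α → ℝ≥0∞ := fun x => Φ x - 2 * B * p x with hΨ
  have hΨm : Measurable Ψ := by fun_prop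
  have hk1 (x : α) : Measurable (k x) := hk.comp measurable_prodMk_left
  have hk2 (y : α) : Measurable fun x => k x y := hk.comp measurable_prodMk_right
  have hle (x : α) : Φ x ≤ Ψ x + 2 * B * p x := le_tsub_add
  have hΨle : ∀ᵐ x ∂μ, Ψ x ≤ ∫⁻ y, k x y * Ψ y ∂μ := by
    filter_upwards [h] with x hx
    rw [hΨ]
    refine tsub_le_iff_right.2 (hx.trans ?_)
    calc (∫⁻ y, k x y * Φ y ∂μ) + B * p x
        ≤ (∫⁻ y, (k x y * Ψ y + 2 * B * (k x y * p y)) ∂μ) + B * p x := by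
          gcongr with y
          refine (mul_le_mul_right (hle y) _).trans_eq ?_
          ring
      _ = (∫⁻ y, k x y * Ψ y ∂μ) + 2 * B * (∫⁻ y, k x y * p y ∂μ) + B * p x := by
          rw [lintegral_add_left (by fun_prop), lintegral_const_mul _ (by fun_prop)]
      _ ≤ (∫⁻ y, k x y * Ψ y ∂μ) + 2 * B * (2⁻¹ * p x) + B * p x := by
          gcongr
          exact hkp x
      _ = (∫⁻ y, k x y * Ψ y ∂μ) + 2 * B * p x := by
          have : 2 * B * (2⁻¹ * p x) = B * p x := by
            rw [mul_comm 2 B, mul_assoc, ← mul_assoc 2, ENNReal.mul_inv_cancel (by simp) (by simp),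
              one_mul]
          rw [this, add_assoc, ← two_mul, mul_assoc 2]
  have hΨfin : ∫⁻ x, q x * Ψ x ∂μ ≠ ⊤ :=
    ne_top_of_le_ne_top hfin (lintegral_mono fun x => mul_le_mul_right tsub_le_self _)
  have hcontr : ∫⁻ x, q x * Ψ x ∂μ ≤ 2⁻¹ * ∫⁻ x, q x * Ψ x ∂μ := by
    calc ∫⁻ x, q x * Ψ x ∂μ ≤ ∫⁻ x, q x * ∫⁻ y, k x y * Ψ y ∂μ ∂μ :=
          lintegral_mono_ae (hΨle.mono fun x hx => mul_le_mul_right hx _)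
      _ = ∫⁻ x, ∫⁻ y, q x * k x y * Ψ y ∂μ ∂μ := by
          refine lintegral_congr fun x => ?_
          rw [← lintegral_const_mul _ (by fun_prop)]
          simp only [mul_assoc]
      _ = ∫⁻ y, ∫⁻ x, q x * k x y * Ψ y ∂μ ∂μ := by
          refine lintegral_lintegral_swap (Measurable.aemeasurable ?_)
          exact ((hq.comp measurable_fst).mul hk).mul (hΨm.comp measurable_snd)
      _ = ∫⁻ y, (∫⁻ x, q x * k x y ∂μ) * Ψ y ∂μ := by
          refine lintegral_congr fun y => ?_
          rw [lintegral_mul_const _ (by fun_prop)]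
      _ ≤ ∫⁻ y, 2⁻¹ * (q y * Ψ y) ∂μ := by
          refine lintegral_mono fun y => ?_
          rw [← mul_assoc]
          exact mul_le_mul_left (hkq y) _
      _ = _ := lintegral_const_mul _ (by fun_prop)
  have hzero : ∫⁻ x, q x * Ψ x ∂μ = 0 := by
    by_contra h0
    have h2 : (2⁻¹ : ℝ≥0∞) * ∫⁻ x, q x * Ψ x ∂μ < ∫⁻ x, q x * Ψ x ∂μ := by
      rw [mul_comm, ← div_eq_mul_inv]
      exact ENNReal.half_lt_self h0 hΨfin
    exact absurd hcontr (not_le.2 h2)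
  rw [lintegral_eq_zero_iff (by fun_prop)] at hzero
  filter_upwards [hzero] with x hx
  have : Ψ x = 0 := (mul_eq_zero.1 hx).resolve_left (hq0 x)
  exact tsub_eq_zero_iff_le.1 this

section Decay

variable {n : ℕ}

/-- The part of `|x - y|^{-m}` within distance `t` of the diagonal maps `⟨y⟩^{-k}` to `O(t) ⟨x⟩^{-k}`. -/
lemma lintegral_near_riesz_mul_jap_le {m : ℕ} (hm : m < n) (k : ℕ) {t : ℝ} (ht : 0 < t)
    (ht2 : t ≤ 1 / 2) (x : Rn n) :
    ∫⁻ y, (if ‖x - y‖ < t then 1 else 0) *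
        (ENNReal.ofReal (riesz m (x - y)) * ENNReal.ofReal (jap k y)) ≤
      ENNReal.ofReal (2 ^ k * rieszMass n m * t * jap k x) := by
  have h1 := one_le_bracket x
  have hR := rieszMass_nonneg n m
  have hj := jap_nonneg k x
  have hpt (y : Rn n) : (if ‖x - y‖ < t then 1 else 0) *
        (ENNReal.ofReal (riesz m (x - y)) * ENNReal.ofReal (jap k y)) ≤
      ENNReal.ofReal (2 ^ k * jap k x) *
        (Metric.ball x t).indicator (fun y => ENNReal.ofReal (riesz m (x - y))) y := by
    by_cases h : ‖x - y‖ < t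
    · rw [if_pos h, one_mul, mul_comm,
        Set.indicator_of_mem (by simpa [dist_eq_norm, norm_sub_rev] using h)]
      exact mul_le_mul_left (ENNReal.ofReal_le_ofReal (jap_le_of_near k (by linarith))) _
    · rw [if_neg h, zero_mul]
      exact zero_le
  refine (lintegral_mono hpt).trans ?_
  rw [lintegral_const_mul _ (Measurable.indicator (by fun_prop) measurableSet_ball),
    lintegral_riesz_ball hm ht, ← ENNReal.ofReal_mul (by positivity)]
  refine ENNReal.ofReal_le_ofReal ?_
  have h3 : t ^ (n - m) ≤ t := pow_le_of_le_one ht.le (by linarith) (by omega)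
  calc 2 ^ k * jap k x * (t ^ (n - m) * rieszMass n m)
      = 2 ^ k * rieszMass n m * jap k x * t ^ (n - m) := by ring
    _ ≤ 2 ^ k * rieszMass n m * jap k x * t := by gcongr
    _ = _ := by ring

/-- Outside the ball of radius `1/t`, one extra power of decay is worth a factor `t`. -/
lemma out_mul_jap_succ_le (k : ℕ) {t : ℝ} (ht : 0 < t) (y : Rn n) :
    (if t⁻¹ < ‖y‖ then 1 else 0) * ENNReal.ofReal (jap (k + 1) y) ≤
      ENNReal.ofReal (t * jap k y) := by
  split_ifs with h
  · rw [one_mul]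
    refine ENNReal.ofReal_le_ofReal ?_
    have h1 := norm_mul_jap_succ_le k y
    have h2 := mul_le_mul_of_nonneg_right h.le (jap_nonneg (k + 1) y)
    rw [inv_mul_eq_div, div_le_iff₀ ht] at h2
    nlinarith
  · simp

/-- Splitting of the kernel `|x - y|^{-m} ⟨y⟩⁻²` into the parts near the diagonal and far out in `y`,
and a remainder dominated by a separable kernel `⟨x⟩^{-m} ⟨y⟩^{-j}`. -/
lemma riesz_mul_le_near_out_add (m : ℕ) {t : ℝ} (ht : 0 < t) (j : ℕ) (x y : Rn n) :
    ENNReal.ofReal (riesz m (x - y)) * ENNReal.ofReal (jap 2 y) ≤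
      ((if ‖x - y‖ < t then 1 else 0) + (if t⁻¹ < ‖y‖ then 1 else 0)) *
          (ENNReal.ofReal (riesz m (x - y)) * ENNReal.ofReal (jap 2 y)) +
        ENNReal.ofReal (((1 + t⁻¹) / t + 1) ^ m * (1 + t⁻¹) ^ j * jap m x) *
          ENNReal.ofReal (jap j y) := by
  by_cases h : ‖x - y‖ < t
  · simp only [if_pos h, add_mul, one_mul, add_assoc]
    exact le_self_add
  by_cases h' : t⁻¹ < ‖y‖
  · simp only [if_pos h', add_mul, one_mul, add_assoc]
    exact le_add_left le_self_add
  rw [if_neg h, if_neg h', add_zero, zero_mul, zero_add,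
    ← ENNReal.ofReal_mul (riesz_nonneg m _), ← ENNReal.ofReal_mul (by
      have := jap_nonneg m x; positivity)]
  refine ENNReal.ofReal_le_ofReal ?_
  rw [not_lt] at h h'
  have hb : bracket y ≤ 1 + t⁻¹ := (bracket_le_one_add_norm y).trans (by linarith)
  have hx := bracket_pos x
  have hti : 0 < t⁻¹ := inv_pos.2 ht
  have h1 : bracket x ≤ ((1 + t⁻¹) / t + 1) * ‖x - y‖ := by
    have h2 : 1 + t⁻¹ ≤ (1 + t⁻¹) / t * ‖x - y‖ := by
      rw [div_mul_eq_mul_div, le_div_iff₀ ht]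
      gcongr
    linarith [bracket_le_add_norm_sub x y]
  have h3 : riesz m (x - y) ≤ ((1 + t⁻¹) / t + 1) ^ m * jap m x := by
    have h4 : (0 : ℝ) < ‖x - y‖ := ht.trans_le h
    rw [riesz, jap, ← div_eq_mul_inv, le_div_iff₀ (by positivity), inv_mul_le_iff₀ (by positivity),
      ← mul_pow, mul_comm ‖x - y‖]
    gcongr
  have h5 : 1 ≤ (1 + t⁻¹) ^ j * jap j y := by
    rw [jap, ← div_eq_mul_inv, le_div_iff₀ (pow_pos (bracket_pos y) j), one_mul]
    exact pow_le_pow_left₀ (bracket_pos y).le hb j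
  calc riesz m (x - y) * jap 2 y ≤ riesz m (x - y) * 1 :=
        mul_le_mul_of_nonneg_left (jap_le_one 2 y) (riesz_nonneg _ _)
    _ ≤ (((1 + t⁻¹) / t + 1) ^ m * jap m x) * ((1 + t⁻¹) ^ j * jap j y) := by
        rw [mul_one]
        exact h3.trans (le_mul_of_one_le_right (by have := jap_nonneg m x; positivity) h5)
    _ = _ := by ring

/-- Decay of subsolutions of the zero-energy Birman-Schwinger equation. If
`Φ ≤ C ⟨x⟩⁻² (|·|^{2-n} * ⟨·⟩⁻² Φ)` and `∫ ⟨x⟩^{1-n} Φ < ∞`, then `Φ ≤ B ⟨x⟩^{-n}`. The kernel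
restricted to `|x - y| < t` or `|y| > 1/t` contracts both weights for small `t`, and the remaining
part maps into multiples of `⟨x⟩^{-n}`. -/
theorem exists_le_jap_of_le_lintegral_riesz (hn : 3 ≤ n) {Φ : Rn n → ℝ≥0∞} (hΦ : Measurable Φ)
    (hfin : ∫⁻ x, ENNReal.ofReal (jap (n - 1) x) * Φ x ≠ ⊤) {C : ℝ} (hC : 0 ≤ C)
    (h : ∀ᵐ x : Rn n, Φ x ≤ ENNReal.ofReal (C * jap 2 x) *
      ∫⁻ y, ENNReal.ofReal (riesz (n - 2) (x - y)) * ENNReal.ofReal (jap 2 y) * Φ y) :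
    ∃ B : ℝ, 0 ≤ B ∧ ∀ᵐ x : Rn n, Φ x ≤ ENNReal.ofReal (B * jap n x) := by
  obtain ⟨m, rfl⟩ : ∃ m, n = m + 2 := ⟨n - 2, by omega⟩
  have hmn : m < m + 2 := by omega
  simp only [show m + 2 - 1 = m + 1 by omega, show m + 2 - 2 = m by omega] at *
  obtain ⟨D, hD0, hD⟩ := exists_lintegral_riesz_mul_jap_le (n := m + 2) hmn
  have hR := rieszMass_nonneg (m + 2) m
  obtain ⟨A, hA⟩ : ∃ A, A = C * (2 ^ (m + 4) * rieszMass (m + 2) m + D) := ⟨_, rfl⟩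
  have hA0 : 0 ≤ A := by rw [hA]; positivity
  obtain ⟨t, ht, ht2, htA⟩ : ∃ t : ℝ, 0 < t ∧ t ≤ 1 / 2 ∧ A * t ≤ 1 / 2 := by
    refine ⟨min (1 / 2) (1 / (2 * (A + 1))), by positivity, min_le_left _ _, ?_⟩
    calc A * min (1 / 2) (1 / (2 * (A + 1))) ≤ A * (1 / (2 * (A + 1))) := by
          gcongr; exact min_le_right _ _
      _ ≤ 1 / 2 := by
          rw [mul_one_div, div_le_div_iff₀ (by positivity) (by positivity)]; linarith
  -- `N` localizes to the diagonal and `O` to the outside of a ball; `r` and `w k` are the kernel and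
  -- the weights. The comparison principle is applied with `p = ⟨x⟩^{-n}` and `q = ⟨x⟩^{1-n}`.
  obtain ⟨N, hN⟩ : ∃ N : Rn (m + 2) → Rn (m + 2) → ℝ≥0∞,
    ∀ x y, N x y = if ‖x - y‖ < t then 1 else 0 := ⟨_, fun _ _ => rfl⟩
  obtain ⟨O, hO⟩ : ∃ O : Rn (m + 2) → ℝ≥0∞,
    ∀ y, O y = if t⁻¹ < ‖y‖ then 1 else 0 := ⟨_, fun _ => rfl⟩
  obtain ⟨r, hr⟩ : ∃ r : Rn (m + 2) → Rn (m + 2) → ℝ≥0∞,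
    ∀ x y, r x y = ENNReal.ofReal (riesz m (x - y)) := ⟨_, fun _ _ => rfl⟩
  obtain ⟨w, hw⟩ : ∃ w : ℕ → Rn (m + 2) → ℝ≥0∞,
    ∀ k x, w k x = ENNReal.ofReal (jap k x) := ⟨_, fun _ _ => rfl⟩
  simp only [← hr, ← hw] at hD hfin h
  have hNm : Measurable (Function.uncurry N) := by
    simp only [Function.uncurry_def, hN]
    exact Measurable.ite (measurableSet_lt (by fun_prop) measurable_const) measurable_const
      measurable_const
  have hOm : Measurable O := by
    rw [funext hO]
    exact Measurable.ite (measurableSet_lt measurable_const (by fun_prop)) measurable_const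
      measurable_const
  have hrm : Measurable (Function.uncurry r) := by
    simp only [hr, Function.uncurry_def]; fun_prop
  have hwm (k : ℕ) : Measurable (w k) := by rw [funext (hw k)]; fun_prop
  have hN1 (x) : Measurable (N x) := hNm.comp measurable_prodMk_left
  have hr1 (x) : Measurable (r x) := hrm.comp measurable_prodMk_left
  have hwmul (j k : ℕ) (x) : w j x * w k x = w (j + k) x := by
    simp only [hw]
    rw [← ENNReal.ofReal_mul (jap_nonneg j x), jap_add]
  have hNsymm (x y) : N x y = N y x := by simp only [hN, norm_sub_rev]
  have hrsymm (x y) : r x y = r y x := by simp only [hr, riesz_sub_comm m x y]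
  have near (k : ℕ) (x) : ∫⁻ y, N x y * (r x y * w k y) ≤
      ENNReal.ofReal (2 ^ k * rieszMass (m + 2) m * t * jap k x) := by
    simp only [hN, hr, hw]
    exact lintegral_near_riesz_mul_jap_le hmn k ht ht2 x
  have out (k : ℕ) (y) : O y * w (k + 1) y ≤ ENNReal.ofReal (t * jap k y) := by
    rw [hO, hw]; exact out_mul_jap_succ_le k ht y
  have hhalf : ENNReal.ofReal (1 / 2) = 2⁻¹ := by
    rw [one_div, ENNReal.ofReal_inv_of_pos (by norm_num)]; simp
  have key := ae_le_of_le_lintegral_kernel (μ := (volume : Measure (Rn (m + 2))))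
    (k := fun x y => ENNReal.ofReal C * w 2 x * ((N x y + O y) * (r x y * w 2 y)))
    (Φ := Φ) (p := w (m + 2)) (q := w (m + 1)) ?_ hΦ (hwm _) (hwm _)
    (ENNReal.ofReal (C * (((1 + t⁻¹) / t + 1) ^ m * (1 + t⁻¹) ^ (m + 1))) *
      ∫⁻ x, w (m + 1) x * Φ x) ?_ ?_ ?_ hfin ?_
  · refine ⟨(2 * (ENNReal.ofReal (C * (((1 + t⁻¹) / t + 1) ^ m * (1 + t⁻¹) ^ (m + 1))) *
      ∫⁻ x, w (m + 1) x * Φ x)).toReal, ENNReal.toReal_nonneg, ?_⟩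
    filter_upwards [key] with x hx
    rw [ENNReal.ofReal_mul ENNReal.toReal_nonneg, ENNReal.ofReal_toReal, ← hw]
    · exact hx
    · exact ENNReal.mul_ne_top (by simp) (ENNReal.mul_ne_top (by simp) hfin)
  · have : Measurable fun z : Rn (m + 2) × Rn (m + 2) => w 2 z.1 := (hwm 2).comp measurable_fst
    have h2 : Measurable fun z : Rn (m + 2) × Rn (m + 2) => w 2 z.2 := (hwm 2).comp measurable_snd
    have h3 : Measurable fun z : Rn (m + 2) × Rn (m + 2) => O z.2 := hOm.comp measurable_snd
    exact (measurable_const.mul this).mul ((hNm.add h3).mul (hrm.mul h2))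
  · filter_upwards [h] with x hx
    refine hx.trans ?_
    have hpt (y) : r x y * w 2 y * Φ y ≤ (N x y + O y) * (r x y * w 2 y) * Φ y +
        ENNReal.ofReal (((1 + t⁻¹) / t + 1) ^ m * (1 + t⁻¹) ^ (m + 1) * jap m x) *
          (w (m + 1) y * Φ y) := by
      rw [← mul_assoc (ENNReal.ofReal _), ← add_mul]
      simp only [hN, hO, hr, hw]
      exact mul_le_mul_left (riesz_mul_le_near_out_add m ht (m + 1) x y) _
    calc ENNReal.ofReal (C * jap 2 x) * ∫⁻ y, r x y * w 2 y * Φ y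
        ≤ ENNReal.ofReal (C * jap 2 x) * ∫⁻ y, ((N x y + O y) * (r x y * w 2 y) * Φ y +
          ENNReal.ofReal (((1 + t⁻¹) / t + 1) ^ m * (1 + t⁻¹) ^ (m + 1) * jap m x) *
          (w (m + 1) y * Φ y)) := by gcongr with y; exact hpt y
      _ = _ := by
        have hm1 : Measurable fun y => (N x y + O y) * (r x y * w 2 y) * Φ y := by fun_prop
        rw [lintegral_add_left hm1, lintegral_const_mul _ (by fun_prop), mul_add]
        congr 1
        · rw [ENNReal.ofReal_mul hC, ← hw]
          simp only [mul_assoc (ENNReal.ofReal C * w 2 x)]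
          rw [lintegral_const_mul _ hm1]
        · simp only [hw, ← mul_assoc]
          rw [mul_right_comm _ _ (ENNReal.ofReal (jap (m + 2) x)),
            ← ENNReal.ofReal_mul (by have := jap_nonneg 2 x; positivity),
            ← ENNReal.ofReal_mul (by positivity), jap_add m 2]
          congr 2
          ring
  -- the restricted kernel halves `⟨x⟩^{-n}`
  · intro x
    have hj := jap_nonneg (m + 2) x
    have hj4 := jap_nonneg (m + 4) x
    have hjm := jap_nonneg m x
    have hj2 := jap_nonneg 2 x
    have hout : ∫⁻ y, O y * (r x y * w (m + 4) y) ≤ ENNReal.ofReal (t * D * jap m x) := by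
      calc ∫⁻ y, O y * (r x y * w (m + 4) y)
          ≤ ∫⁻ y, ENNReal.ofReal t * (r x y * w (m + 3) y) := by
            refine lintegral_mono fun y => ?_
            have := out (m + 3) y
            rw [ENNReal.ofReal_mul ht.le, ← hw] at this
            calc O y * (r x y * w (m + 4) y) = r x y * (O y * w (m + 4) y) := by ring
              _ ≤ r x y * (ENNReal.ofReal t * w (m + 3) y) := mul_le_mul_right this _
              _ = _ := by ring
        _ = ENNReal.ofReal t * ∫⁻ y, r x y * w (m + 3) y :=
            lintegral_const_mul _ (by fun_prop)
        _ ≤ ENNReal.ofReal t * ENNReal.ofReal (D * jap m x) := mul_le_mul_right (hD x) _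
        _ = _ := by rw [← ENNReal.ofReal_mul ht.le, mul_assoc]
    calc ∫⁻ y, ENNReal.ofReal C * w 2 x * ((N x y + O y) * (r x y * w 2 y)) * w (m + 2) y
        = ∫⁻ y, ENNReal.ofReal C * w 2 x *
            (N x y * (r x y * w (m + 4) y) + O y * (r x y * w (m + 4) y)) := by
          refine lintegral_congr fun y => ?_
          rw [show m + 4 = 2 + (m + 2) by ring, ← hwmul 2 (m + 2)]
          ring
      _ = ENNReal.ofReal C * w 2 x *
            ((∫⁻ y, N x y * (r x y * w (m + 4) y)) + ∫⁻ y, O y * (r x y * w (m + 4) y)) := by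
          rw [lintegral_const_mul _ (by fun_prop), lintegral_add_left (by fun_prop)]
      _ ≤ ENNReal.ofReal C * w 2 x *
            (ENNReal.ofReal (2 ^ (m + 4) * rieszMass (m + 2) m * t * jap (m + 4) x) +
              ENNReal.ofReal (t * D * jap m x)) := by
          gcongr
          exact near (m + 4) x
      _ = ENNReal.ofReal (C * jap 2 x *
            (2 ^ (m + 4) * rieszMass (m + 2) m * t * jap (m + 4) x + t * D * jap m x)) := by
          rw [hw, ← ENNReal.ofReal_add (by positivity) (by positivity), ← ENNReal.ofReal_mul hC,
            ← ENNReal.ofReal_mul (by positivity)]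
      _ ≤ ENNReal.ofReal (1 / 2 * jap (m + 2) x) := by
          refine ENNReal.ofReal_le_ofReal ?_
          calc C * jap 2 x *
              (2 ^ (m + 4) * rieszMass (m + 2) m * t * jap (m + 4) x + t * D * jap m x)
              ≤ C * jap 2 x *
              (2 ^ (m + 4) * rieszMass (m + 2) m * t * jap m x + t * D * jap m x) := by
                gcongr
                exact jap_anti (by omega) x
            _ = A * t * jap (m + 2) x := by rw [hA, jap_add m 2]; ring
            _ ≤ _ := by gcongr
      _ = _ := by rw [ENNReal.ofReal_mul (by norm_num), hhalf, hw]
  -- the transposed kernel halves `⟨x⟩^{1-n}`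
  · intro y
    have hj := jap_nonneg (m + 1) y
    have hj4 := jap_nonneg (m + 3) y
    have hjm := jap_nonneg m y
    have hj2 := jap_nonneg 2 y
    have hout : O y * w 2 y * ∫⁻ x, r y x * w (m + 3) x ≤
        ENNReal.ofReal (t * D * jap (m + 1) y) := by
      calc O y * w 2 y * ∫⁻ x, r y x * w (m + 3) x ≤ O y * w 2 y * ENNReal.ofReal (D * jap m y) :=
            mul_le_mul_right (hD y) _
        _ = ENNReal.ofReal D * (O y * w (m + 2) y) := by
            rw [ENNReal.ofReal_mul hD0.le, ← hwmul m 2, hw m]; ring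
        _ ≤ ENNReal.ofReal D * ENNReal.ofReal (t * jap (m + 1) y) :=
            mul_le_mul_right (out (m + 1) y) _
        _ = _ := by rw [← ENNReal.ofReal_mul hD0.le]; congr 1; ring
    calc ∫⁻ x, w (m + 1) x * (ENNReal.ofReal C * w 2 x * ((N x y + O y) * (r x y * w 2 y)))
        = ∫⁻ x, ENNReal.ofReal C *
            (w 2 y * (N y x * (r y x * w (m + 3) x)) +
              O y * w 2 y * (r y x * w (m + 3) x)) := by
          refine lintegral_congr fun x => ?_
          rw [show m + 3 = 2 + (m + 1) by ring, ← hwmul 2 (m + 1), hNsymm, hrsymm]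
          ring
      _ = ENNReal.ofReal C * (w 2 y * (∫⁻ x, N y x * (r y x * w (m + 3) x)) +
            O y * w 2 y * ∫⁻ x, r y x * w (m + 3) x) := by
          rw [lintegral_const_mul _ (by fun_prop), lintegral_add_left (by fun_prop),
            lintegral_const_mul _ (by fun_prop), lintegral_const_mul _ (by fun_prop)]
      _ ≤ ENNReal.ofReal C *
            (w 2 y * ENNReal.ofReal (2 ^ (m + 3) * rieszMass (m + 2) m * t * jap (m + 3) y) +
              ENNReal.ofReal (t * D * jap (m + 1) y)) := by
          gcongr
          exact near (m + 3) y
      _ = ENNReal.ofReal (C * (jap 2 y *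
            (2 ^ (m + 3) * rieszMass (m + 2) m * t * jap (m + 3) y) + t * D * jap (m + 1) y)) := by
          rw [hw, ← ENNReal.ofReal_mul hj2, ← ENNReal.ofReal_add (by positivity) (by positivity),
            ← ENNReal.ofReal_mul hC]
      _ ≤ ENNReal.ofReal (1 / 2 * jap (m + 1) y) := by
          refine ENNReal.ofReal_le_ofReal ?_
          calc C * (jap 2 y *
              (2 ^ (m + 3) * rieszMass (m + 2) m * t * jap (m + 3) y) + t * D * jap (m + 1) y)
              ≤ C * (1 *
              (2 ^ (m + 4) * rieszMass (m + 2) m * t * jap (m + 1) y) +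
                t * D * jap (m + 1) y) := by
                gcongr
                · exact jap_le_one 2 y
                · norm_num
                · omega
                · exact jap_anti (by omega) y
            _ = A * t * jap (m + 1) y := by rw [hA]; ring
            _ ≤ _ := by gcongr
      _ = _ := by rw [ENNReal.ofReal_mul (by norm_num), hhalf, hw]
  · intro x
    simpa [hw] using jap_pos (m + 1) x

end Decay

/-! ### Test functions and the regularized Newtonian kernel -/

section Calculus

variable {n : ℕ}

/-- The partial derivative `∂ᵢ u` of a real-valued function on `ℝⁿ`. -/
noncomputable def pd (i : Fin n) (u : Rn n → ℝ) (x : Rn n) : ℝ :=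
  fderiv ℝ u x (EuclideanSpace.single i 1)

/-- Smooth functions of compact support, unbundled. -/
structure IsTest (η : Rn n → ℝ) : Prop where
  contDiff : ContDiff ℝ (⊤ : ℕ∞) η
  hasCompactSupport : HasCompactSupport η

lemma isTest_coe (η : TestFn n) : IsTest (η : Rn n → ℝ) :=
  ⟨η.contDiff, η.hasCompactSupport⟩

lemma contDiff_pd {u : Rn n → ℝ} (hu : ContDiff ℝ (⊤ : ℕ∞) u) (i : Fin n) :
    ContDiff ℝ (⊤ : ℕ∞) (pd i u) :=
  (hu.fderiv_right (m := (⊤ : ℕ∞)) (by simp)).clm_apply contDiff_const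

lemma IsTest.pd {η : Rn n → ℝ} (hη : IsTest η) (i : Fin n) : IsTest (pd i η) :=
  ⟨contDiff_pd hη.contDiff i, hη.hasCompactSupport.fderiv_apply ℝ _⟩

lemma IsTest.continuous {η : Rn n → ℝ} (hη : IsTest η) : Continuous η := hη.contDiff.continuous

lemma IsTest.mul_left {χ u : Rn n → ℝ} (hχ : IsTest χ) (hu : ContDiff ℝ (⊤ : ℕ∞) u) :
    IsTest fun x => χ x * u x :=
  ⟨hχ.contDiff.mul hu, hχ.hasCompactSupport.mul_right⟩

lemma isTest_sum {ι : Type*} (s : Finset ι) {f : ι → Rn n → ℝ} (hf : ∀ i ∈ s, IsTest (f i)) :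
    IsTest fun x => ∑ i ∈ s, f i x := by
  classical
  induction s using Finset.induction_on with
  | empty =>
    simp only [Finset.sum_empty]
    exact ⟨contDiff_const, HasCompactSupport.zero⟩
  | insert a s ha ih =>
    have h1 := hf a (Finset.mem_insert_self a s)
    have h2 := ih fun i hi => hf i (Finset.mem_insert_of_mem hi)
    simp only [Finset.sum_insert ha]
    exact ⟨h1.contDiff.add h2.contDiff, h1.hasCompactSupport.add h2.hasCompactSupport⟩

lemma IsTest.comp_add_right {η : Rn n → ℝ} (hη : IsTest η) (y : Rn n) :
    IsTest fun x => η (x + y) :=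
  ⟨hη.contDiff.comp (contDiff_id.add contDiff_const),
    hη.hasCompactSupport.comp_homeomorph (Homeomorph.addRight y)⟩

lemma pd_comp_add_right (i : Fin n) (η : Rn n → ℝ) (y : Rn n) :
    pd i (fun x => η (x + y)) = fun x => pd i η (x + y) := by
  funext x
  simp only [pd, fderiv_comp_add_right]

lemma laplacian_eq_sum_pd {u : Rn n → ℝ} (hu : ContDiff ℝ 2 u) (x : Rn n) :
    Laplacian.laplacian u x = ∑ i, pd i (pd i u) x := by
  rw [InnerProductSpace.laplacian_eq_iteratedFDeriv_orthonormalBasis u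
    (EuclideanSpace.basisFun (Fin n) ℝ)]
  refine Finset.sum_congr rfl fun i _ => ?_
  rw [iteratedFDeriv_two_apply]
  simp only [pd, EuclideanSpace.basisFun_apply, Matrix.cons_val_zero, Matrix.cons_val_one]
  have hd : DifferentiableAt ℝ (fderiv ℝ u) x :=
    (hu.fderiv_right (m := 1) (by norm_num)).differentiable (by norm_num) x
  have h : pd i u = fun y => fderiv ℝ u y (EuclideanSpace.single i 1) := rfl
  rw [h, fderiv_clm_apply hd (differentiableAt_const _)]
  simp

lemma IsTest.laplacian_eq {η : Rn n → ℝ} (hη : IsTest η) (x : Rn n) :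
    Laplacian.laplacian η x = ∑ i, ThresholdResonance.pd i (ThresholdResonance.pd i η) x :=
  laplacian_eq_sum_pd (contDiff_infty.1 hη.contDiff 2) x

lemma pd_mul {f g : Rn n → ℝ} {x : Rn n} (hf : DifferentiableAt ℝ f x)
    (hg : DifferentiableAt ℝ g x) (i : Fin n) :
    pd i (fun x => f x * g x) x = pd i f x * g x + f x * pd i g x := by
  simp only [pd]
  rw [fderiv_fun_mul hf hg]
  simp only [add_apply, smul_apply, smul_eq_mul]
  ring

/-- Integration by parts against a test function. -/
lemma IsTest.integral_pd_mul {η h : Rn n → ℝ} (hη : IsTest η) (hh : ContDiff ℝ 1 h) (i : Fin n) :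
    ∫ x, ThresholdResonance.pd i η x * h x = -∫ x, η x * ThresholdResonance.pd i h x := by
  have hc : Continuous (ThresholdResonance.pd i h) :=
    (hh.continuous_fderiv (by norm_num)).clm_apply continuous_const
  have h1 := integral_mul_fderiv_eq_neg_fderiv_mul_of_integrable (μ := (volume : Measure (Rn n)))
    (f := η) (g := h) (v := EuclideanSpace.single i 1)
    (((hη.pd i).continuous.mul hh.continuous).integrable_of_hasCompactSupport
      (hη.pd i).hasCompactSupport.mul_right)
    ((hη.continuous.mul hc).integrable_of_hasCompactSupport hη.hasCompactSupport.mul_right)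
    ((hη.continuous.mul hh.continuous).integrable_of_hasCompactSupport
      hη.hasCompactSupport.mul_right)
    (fun x _ => hη.contDiff.differentiable (by simp) x)
    (fun x _ => hh.differentiable (by norm_num) x)
  simp only [ThresholdResonance.pd]
  rw [h1, neg_neg]

lemma contDiff_norm_sq_add_rpow {c : ℝ} (hc : 0 < c) (p : ℝ) :
    ContDiff ℝ (⊤ : ℕ∞) fun z : Rn n => (‖z‖ ^ 2 + c) ^ p :=
  ((contDiff_norm_sq ℝ).add contDiff_const).rpow_const_of_ne fun z => by positivity

lemma pd_norm_sq_add_rpow {c : ℝ} (hc : 0 < c) (p : ℝ) (i : Fin n) (z : Rn n) :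
    pd i (fun z : Rn n => (‖z‖ ^ 2 + c) ^ p) z = 2 * p * (z i * (‖z‖ ^ 2 + c) ^ (p - 1)) := by
  have h1 : HasFDerivAt (fun z : Rn n => ‖z‖ ^ 2 + c) (2 • innerSL ℝ z) z :=
    (hasStrictFDerivAt_norm_sq z).hasFDerivAt.add_const c
  have h2 := h1.rpow_const (p := p) (Or.inl (by positivity))
  rw [pd, h2.fderiv]
  simp [EuclideanSpace.inner_single_right]
  ring

lemma pd_coord (i : Fin n) (z : Rn n) : pd i (fun z : Rn n => z i) z = 1 := by
  have h : HasFDerivAt (fun z : Rn n => z i) (EuclideanSpace.proj (𝕜 := ℝ) i) z :=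
    (EuclideanSpace.proj (𝕜 := ℝ) i).hasFDerivAt
  rw [pd, h.fderiv]
  simp

/-- The Laplacian of the regularized Newtonian kernel `(|z|² + c)^{1-n/2}` is a multiple of an
approximate identity as `c → 0`. -/
lemma sum_pd_pd_norm_sq_add_rpow {c : ℝ} (hc : 0 < c) (z : Rn n) :
    ∑ i, pd i (pd i fun z : Rn n => (‖z‖ ^ 2 + c) ^ (1 - (n : ℝ) / 2)) z =
      -(n * ((n : ℝ) - 2)) * (c * (‖z‖ ^ 2 + c) ^ (-((n : ℝ) / 2) - 1)) := by
  have hq : 0 < ‖z‖ ^ 2 + c := by positivity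
  have hi (i : Fin n) : pd i (pd i fun z : Rn n => (‖z‖ ^ 2 + c) ^ (1 - (n : ℝ) / 2)) z =
      (2 - n) * (‖z‖ ^ 2 + c) ^ (-((n : ℝ) / 2)) +
        (2 - n) * (-n) * (‖z‖ ^ 2 + c) ^ (-((n : ℝ) / 2) - 1) * (z i) ^ 2 := by
    have h1 : (pd i fun z : Rn n => (‖z‖ ^ 2 + c) ^ (1 - (n : ℝ) / 2)) =
        fun z => z i * ((2 - n) * (‖z‖ ^ 2 + c) ^ (-((n : ℝ) / 2))) := by
      funext z
      rw [pd_norm_sq_add_rpow hc, show 1 - (n : ℝ) / 2 - 1 = -((n : ℝ) / 2) by ring]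
      ring
    have hd := (contDiff_norm_sq_add_rpow (n := n) hc (-((n : ℝ) / 2))).differentiable (by simp) z
    have hd2 : DifferentiableAt ℝ (fun z : Rn n => z i) z :=
      (EuclideanSpace.proj (𝕜 := ℝ) i).differentiableAt
    have h3 : pd i (fun z : Rn n => (2 - (n : ℝ)) * (‖z‖ ^ 2 + c) ^ (-((n : ℝ) / 2))) z =
        (2 - n) * (2 * (-((n : ℝ) / 2)) * (z i * (‖z‖ ^ 2 + c) ^ (-((n : ℝ) / 2) - 1))) := by
      rw [← pd_norm_sq_add_rpow hc]
      simp only [pd]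
      rw [fderiv_const_mul hd]
      simp
    rw [h1, pd_mul hd2 (hd.const_mul _), pd_coord, h3]
    ring
  have hsq : ∑ i, (z i) ^ 2 = ‖z‖ ^ 2 := by
    rw [EuclideanSpace.norm_sq_eq]; simp
  have hpow : (‖z‖ ^ 2 + c) ^ (-((n : ℝ) / 2)) =
      (‖z‖ ^ 2 + c) ^ (-((n : ℝ) / 2) - 1) * (‖z‖ ^ 2 + c) := by
    rw [Real.rpow_sub_one hq.ne']; field_simp
  simp only [hi, Finset.sum_add_distrib, ← Finset.mul_sum, hsq]
  rw [Finset.sum_const, Finset.card_univ,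
    Fintype.card_fin, nsmul_eq_mul, hpow]
  ring

lemma riesz_eq_rpow (m : ℕ) (z : Rn n) : riesz m z = (‖z‖ ^ 2) ^ (-((m : ℝ) / 2)) := by
  rw [riesz, Real.rpow_neg (by positivity), ← Real.rpow_natCast ‖z‖ 2,
    ← Real.rpow_mul (norm_nonneg z), ← Real.rpow_natCast]
  congr 2
  push_cast; ring

lemma norm_sq_add_rpow_le_riesz (m : ℕ) {c : ℝ} (hc : 0 ≤ c) {z : Rn n} (hz : z ≠ 0) :
    (‖z‖ ^ 2 + c) ^ (-((m : ℝ) / 2)) ≤ riesz m z := by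
  rw [riesz_eq_rpow]
  have : 0 < ‖z‖ := norm_pos_iff.2 hz
  exact Real.rpow_le_rpow_of_nonpos (by positivity) (by linarith) (by
    have : (0 : ℝ) ≤ m := Nat.cast_nonneg m
    linarith)

lemma norm_mul_riesz_succ_le (m : ℕ) (z : Rn n) : ‖z‖ * riesz (m + 1) z ≤ riesz m z := by
  rcases eq_or_ne z 0 with rfl | hz
  · simp [riesz]
  · have : ‖z‖ ≠ 0 := norm_ne_zero_iff.2 hz
    apply le_of_eq
    rw [riesz, riesz, pow_succ]
    field_simp

lemma tendsto_norm_sq_add_rpow {z : Rn n} (hz : z ≠ 0) (m : ℕ) :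
    Tendsto (fun k : ℕ => (‖z‖ ^ 2 + (1 / ((k : ℝ) + 1)) ^ 2) ^ (-((m : ℝ) / 2))) atTop
      (𝓝 (riesz m z)) := by
  have h : Tendsto (fun k : ℕ => ‖z‖ ^ 2 + (1 / ((k : ℝ) + 1)) ^ 2) atTop (𝓝 (‖z‖ ^ 2)) := by
    simpa using (tendsto_one_div_add_atTop_nhds_zero_nat (𝕜 := ℝ)).pow 2 |>.const_add (‖z‖ ^ 2)
  rw [riesz_eq_rpow]
  exact h.rpow_const (Or.inl (by have := norm_pos_iff.2 hz; positivity))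

lemma ae_ne_zero (hn : 1 ≤ n) : ∀ᵐ z : Rn n, z ≠ 0 := by
  have : Nontrivial (Rn n) := Module.nontrivial_of_finrank_pos (R := ℝ) (by simp; omega)
  exact Measure.ae_ne volume 0

lemma abs_coord_le_norm (z : Rn n) (i : Fin n) : |z i| ≤ ‖z‖ := by
  simpa using PiLp.norm_apply_le z i

lemma IsTest.integrable_mul_riesz {η : Rn n → ℝ} (hη : IsTest η) {m : ℕ} (hm : m < n) :
    Integrable fun z => η z * riesz m z :=
  (locallyIntegrable_riesz hm).integrable_smul_left_of_hasCompactSupport hη.continuous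
    hη.hasCompactSupport

lemma norm_mul_le_norm_mul_of_abs_le (a : ℝ) {b c : ℝ} (h : |b| ≤ c) : ‖a * b‖ ≤ ‖a * c‖ := by
  rw [norm_mul, norm_mul]
  exact mul_le_mul_of_nonneg_left (h.trans (le_abs_self c)) (norm_nonneg a)

/-- The distributional gradient of `|z|^{2-n}` is the pointwise one, obtained as a limit of the smooth
kernels `(|z|² + s²)^{1-n/2}`. -/
lemma IsTest.integral_pd_mul_riesz (hn : 3 ≤ n) {η : Rn n → ℝ} (hη : IsTest η) (i : Fin n) :
    ∫ z, ThresholdResonance.pd i η z * riesz (n - 2) z =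
      ((n : ℝ) - 2) * ∫ z, η z * (z i * riesz n z) := by
  have hcast : ((n - 2 : ℕ) : ℝ) = (n : ℝ) - 2 := by rw [Nat.cast_sub (by omega)]; simp
  have hp : -(((n - 2 : ℕ) : ℝ) / 2) = 1 - (n : ℝ) / 2 := by rw [hcast]; ring
  have hreg (k : ℕ) : ∫ z, ThresholdResonance.pd i η z *
      (‖z‖ ^ 2 + (1 / ((k : ℝ) + 1)) ^ 2) ^ (-(((n - 2 : ℕ) : ℝ) / 2)) =
      ((n : ℝ) - 2) * ∫ z, η z * (z i *
        (‖z‖ ^ 2 + (1 / ((k : ℝ) + 1)) ^ 2) ^ (-((n : ℝ) / 2))) := by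
    have hc : (0 : ℝ) < (1 / ((k : ℝ) + 1)) ^ 2 := by positivity
    rw [hη.integral_pd_mul (contDiff_infty.1 (contDiff_norm_sq_add_rpow hc _) 1) i,
      ← integral_neg, ← integral_const_mul]
    refine integral_congr_ae (Eventually.of_forall fun z => ?_)
    simp only
    rw [pd_norm_sq_add_rpow hc, hp, show 1 - (n : ℝ) / 2 - 1 = -((n : ℝ) / 2) by ring]
    ring
  have hmeas (m : ℕ) (k : ℕ) : Continuous fun z : Rn n =>
      (‖z‖ ^ 2 + (1 / ((k : ℝ) + 1)) ^ 2) ^ (-((m : ℝ) / 2)) :=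
    (contDiff_norm_sq_add_rpow (by positivity) _).continuous
  have hcoord : Continuous fun z : Rn n => z i := by fun_prop
  have h1 : Tendsto (fun k : ℕ => ∫ z, ThresholdResonance.pd i η z *
      (‖z‖ ^ 2 + (1 / ((k : ℝ) + 1)) ^ 2) ^ (-(((n - 2 : ℕ) : ℝ) / 2))) atTop
      (𝓝 (∫ z, ThresholdResonance.pd i η z * riesz (n - 2) z)) := by
    refine tendsto_integral_of_dominated_convergence
      (fun z => ‖ThresholdResonance.pd i η z * riesz (n - 2) z‖)
      (fun k => ((hη.pd i).continuous.mul (hmeas _ k)).aestronglyMeasurable)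
      ((hη.pd i).integrable_mul_riesz (by omega)).norm (fun k => ?_) ?_
    · filter_upwards [ae_ne_zero (n := n) (by omega)] with z hz
      refine norm_mul_le_norm_mul_of_abs_le _ ?_
      rw [abs_of_nonneg (by positivity)]
      exact norm_sq_add_rpow_le_riesz _ (by positivity) hz
    · filter_upwards [ae_ne_zero (n := n) (by omega)] with z hz
      exact (tendsto_norm_sq_add_rpow hz _).const_mul _
  have h2 : Tendsto (fun k : ℕ => ((n : ℝ) - 2) * ∫ z, η z * (z i *
        (‖z‖ ^ 2 + (1 / ((k : ℝ) + 1)) ^ 2) ^ (-((n : ℝ) / 2)))) atTop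
      (𝓝 (((n : ℝ) - 2) * ∫ z, η z * (z i * riesz n z))) := by
    refine Tendsto.const_mul _ (tendsto_integral_of_dominated_convergence
      (fun z => ‖η z * riesz (n - 1) z‖)
      (fun k => (hη.continuous.mul (hcoord.mul (hmeas n k))).aestronglyMeasurable)
      (hη.integrable_mul_riesz (by omega)).norm (fun k => ?_) ?_)
    · filter_upwards [ae_ne_zero (n := n) (by omega)] with z hz
      refine norm_mul_le_norm_mul_of_abs_le _ ?_
      rw [abs_mul, abs_of_nonneg
        (show 0 ≤ (‖z‖ ^ 2 + (1 / ((k : ℝ) + 1)) ^ 2) ^ (-((n : ℝ) / 2)) by positivity)]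
      have h3 := norm_mul_riesz_succ_le (n - 1) z
      rw [show n - 1 + 1 = n by omega] at h3
      refine le_trans ?_ h3
      exact mul_le_mul (abs_coord_le_norm z i) (norm_sq_add_rpow_le_riesz n (by positivity) hz)
        (by positivity) (norm_nonneg z)
    · filter_upwards [ae_ne_zero (n := n) (by omega)] with z hz
      exact ((tendsto_norm_sq_add_rpow hz n).const_mul _).const_mul _
  simp only [hreg] at h1
  exact tendsto_nhds_unique h1 h2

end Calculus

/-! ### The fundamental solution of the Laplacian -/

section FundamentalSolution

variable {n : ℕ}

lemma IsTest.integral_sum_pd_pd_mul {η h : Rn n → ℝ} (hη : IsTest η)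
    (hh : ContDiff ℝ (⊤ : ℕ∞) h) :
    ∫ x, (∑ i, ThresholdResonance.pd i (ThresholdResonance.pd i η) x) * h x =
      ∫ x, η x * ∑ i, ThresholdResonance.pd i (ThresholdResonance.pd i h) x := by
  have hint {f g : Rn n → ℝ} (hf : IsTest f) (hg : ContDiff ℝ (⊤ : ℕ∞) g) :
      Integrable fun x => f x * g x :=
    (hf.continuous.mul hg.continuous).integrable_of_hasCompactSupport
      hf.hasCompactSupport.mul_right
  simp only [Finset.sum_mul, Finset.mul_sum]
  rw [integral_finsetSum _ fun i _ => hint ((hη.pd i).pd i) hh,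
    integral_finsetSum _ fun i _ => hint hη (contDiff_pd (contDiff_pd hh i) i)]
  refine Finset.sum_congr rfl fun i _ => ?_
  rw [(hη.pd i).integral_pd_mul (contDiff_infty.1 hh 1),
    hη.integral_pd_mul (contDiff_infty.1 (contDiff_pd hh i) 1), neg_neg]

lemma integral_mul_approxIdentity (η : Rn n → ℝ) {s : ℝ} (hs : 0 < s) :
    ∫ z, η z * (s ^ 2 * (‖z‖ ^ 2 + s ^ 2) ^ (-((n : ℝ) / 2) - 1)) =
      ∫ u, η (s • u) * jap (n + 2) u := by
  have h := Measure.integral_comp_smul (volume : Measure (Rn n))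
    (fun z => η z * (s ^ n * (s ^ 2 * (‖z‖ ^ 2 + s ^ 2) ^ (-((n : ℝ) / 2) - 1)))) s
  have hs2 : (0 : ℝ) ≤ s ^ 2 := by positivity
  have hpt (u : Rn n) : s ^ n * (s ^ 2 * (‖s • u‖ ^ 2 + s ^ 2) ^ (-((n : ℝ) / 2) - 1)) =
      jap (n + 2) u := by
    have h1 : ‖s • u‖ ^ 2 + s ^ 2 = s ^ 2 * (1 + ‖u‖ ^ 2) := by
      rw [norm_smul, mul_pow, Real.norm_of_nonneg hs.le]; ring
    have h2 : (s ^ 2) ^ (-((n : ℝ) / 2) - 1) = (s ^ (n + 2))⁻¹ := by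
      rw [← Real.rpow_natCast s 2, ← Real.rpow_mul hs.le, ← Real.rpow_natCast s (n + 2),
        ← Real.rpow_neg hs.le]
      congr 1; push_cast; ring
    rw [h1, Real.mul_rpow hs2 (by positivity), h2, jap_eq_rpow, ← mul_assoc, ← mul_assoc,
      ← pow_add, mul_inv_cancel₀ (by positivity), one_mul]
    congr 1; push_cast; ring
  simp only [hpt] at h
  rw [h, abs_of_pos (by simp; positivity), smul_eq_mul, ← integral_const_mul]
  refine integral_congr_ae (Eventually.of_forall fun z => ?_)
  have hfr : Module.finrank ℝ (Rn n) = n := by simp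
  simp only [hfr]
  field_simp

lemma tendsto_integral_comp_smul_mul_jap {η : Rn n → ℝ} (hη : IsTest η) :
    Tendsto (fun k : ℕ => ∫ u, η ((1 / ((k : ℝ) + 1)) • u) * jap (n + 2) u) atTop
      (𝓝 (η 0 * ∫ u : Rn n, jap (n + 2) u)) := by
  obtain ⟨M, hM⟩ := hη.continuous.bounded_above_of_compact_support hη.hasCompactSupport
  rw [← integral_const_mul]
  refine tendsto_integral_of_dominated_convergence (fun u => M * jap (n + 2) u)
    (fun k => (Continuous.mul (hη.continuous.comp (continuous_const_smul _))
      (continuous_jap _)).aestronglyMeasurable)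
    ((integrable_jap (by omega)).const_mul M) (fun k => ?_) ?_
  · refine Eventually.of_forall fun u => ?_
    rw [norm_mul, Real.norm_of_nonneg (jap_nonneg _ u)]
    exact mul_le_mul_of_nonneg_right (hM _) (jap_nonneg _ u)
  · refine Eventually.of_forall fun u => Tendsto.mul_const _ ?_
    have h : Tendsto (fun k : ℕ => (1 / ((k : ℝ) + 1)) • u) atTop (𝓝 0) := by
      simpa using (tendsto_one_div_add_atTop_nhds_zero_nat (𝕜 := ℝ)).smul_const u
    exact (hη.continuous.tendsto 0).comp h

/-- The radial integral behind the mass of `⟨u⟩^{-n-2}`; a primitive is `n⁻¹ (y / √(1 + y²))^n`. -/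
lemma integral_Ioi_pow_mul_sqrt_inv {n : ℕ} (hn : 1 ≤ n) :
    ∫ y in Set.Ioi (0 : ℝ), y ^ (n - 1) • (√(1 + y ^ 2) ^ (n + 2))⁻¹ = (n : ℝ)⁻¹ := by
  have hn0 : (n : ℝ) ≠ 0 := by positivity
  have hd (y : ℝ) : HasDerivAt (fun y : ℝ => (n : ℝ)⁻¹ * (y / √(1 + y ^ 2)) ^ n)
      (y ^ (n - 1) • (√(1 + y ^ 2) ^ (n + 2))⁻¹) y := by
    have hq : 0 < 1 + y ^ 2 := by positivity
    have hsq : √(1 + y ^ 2) ^ 2 = 1 + y ^ 2 := Real.sq_sqrt hq.le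
    have hs : 0 < √(1 + y ^ 2) := Real.sqrt_pos.2 hq
    have h1 : HasDerivAt (fun y : ℝ => √(1 + y ^ 2)) (2 * y / (2 * √(1 + y ^ 2))) y := by
      have : HasDerivAt (fun y : ℝ => 1 + y ^ 2) (2 * y) y := by
        simpa using (hasDerivAt_pow 2 y).const_add 1
      exact this.sqrt hq.ne'
    have h2 := (((hasDerivAt_id y).div h1 hs.ne').pow n).const_mul (n : ℝ)⁻¹
    refine h2.congr_deriv ?_
    simp only [id, smul_eq_mul]
    have h3 : (1 * √(1 + y ^ 2) - y * (2 * y / (2 * √(1 + y ^ 2)))) / √(1 + y ^ 2) ^ 2 =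
        (√(1 + y ^ 2) ^ 3)⁻¹ := by
      field_simp
      rw [hsq]; ring
    rw [show ((id : ℝ → ℝ) / fun y : ℝ => √(1 + y ^ 2)) y = y / √(1 + y ^ 2) from rfl, h3, div_pow,
      show n + 2 = n - 1 + 3 by omega, pow_add]
    field_simp
  have ht : Tendsto (fun y : ℝ => (n : ℝ)⁻¹ * (y / √(1 + y ^ 2)) ^ n) atTop
      (𝓝 ((n : ℝ)⁻¹ * 1 ^ n)) := by
    refine (Tendsto.pow ?_ n).const_mul _
    -- `y / √(1 + y²) = sin (arctan y)`
    have h : Tendsto (fun y : ℝ => Real.sin (Real.arctan y)) atTop (𝓝 (Real.sin (Real.pi / 2))) :=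
      (Real.continuous_sin.tendsto _).comp
        (Real.tendsto_arctan_atTop.mono_right nhdsWithin_le_nhds)
    simpa [Real.sin_arctan] using h
  have h := integral_Ioi_of_hasDerivAt_of_nonneg' (a := 0) (fun y _ => hd y)
    (fun y hy => by
      have : (0 : ℝ) < y := hy
      rw [smul_eq_mul]
      positivity) ht
  rw [h]
  simp [show n ≠ 0 by omega]

lemma integral_jap_add_two (hn : 1 ≤ n) :
    ∫ u : Rn n, jap (n + 2) u = (n : ℝ)⁻¹ * sphereArea n := by
  have : Nontrivial (Rn n) := Module.nontrivial_of_finrank_pos (R := ℝ) (by simp; omega)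
  have : Nonempty (Fin n) := ⟨⟨0, by omega⟩⟩
  have h := integral_fun_norm_addHaar (volume : Measure (Rn n))
    fun y : ℝ => (√(1 + y ^ 2) ^ (n + 2))⁻¹
  have hfr : Module.finrank ℝ (Rn n) = n := by simp
  rw [hfr, integral_Ioi_pow_mul_sqrt_inv hn] at h
  simp only [jap, bracket]
  have hn0 : (0 : ℝ) < n := by positivity
  have hG : Real.Gamma ((n : ℝ) / 2 + 1) = n / 2 * Real.Gamma ((n : ℝ) / 2) :=
    Real.Gamma_add_one (by positivity)
  have hG0 : 0 < Real.Gamma ((n : ℝ) / 2) := Real.Gamma_pos_of_pos (by positivity)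
  have hpi : √Real.pi ^ n = Real.pi ^ ((n : ℝ) / 2) := by
    rw [Real.sqrt_eq_rpow, ← Real.rpow_mul_natCast Real.pi_pos.le]
    congr 1; ring
  rw [h, Measure.real, EuclideanSpace.volume_ball, Fintype.card_fin, hG, sphereArea, hpi]
  simp only [ENNReal.ofReal_one, one_pow, one_mul]
  rw [ENNReal.toReal_ofReal (by positivity), nsmul_eq_mul, smul_eq_mul]
  field_simp

lemma sphereArea_pos (hn : 1 ≤ n) : 0 < sphereArea n := by
  have hn0 : (0 : ℝ) < n := by positivity
  have hG0 : 0 < Real.Gamma ((n : ℝ) / 2) := Real.Gamma_pos_of_pos (by positivity)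
  unfold sphereArea
  positivity

/-- `|z|^{2-n}` is a multiple of the fundamental solution of the Laplacian: the Laplacians of the
regularizations `(|z|² + s²)^{1-n/2}` form an approximate identity. -/
lemma IsTest.integral_sum_pd_pd_mul_riesz (hn : 3 ≤ n) {η : Rn n → ℝ} (hη : IsTest η) :
    ∫ z, (∑ i, ThresholdResonance.pd i (ThresholdResonance.pd i η) z) * riesz (n - 2) z =
      -(((n : ℝ) - 2) * sphereArea n * η 0) := by
  have hcast : ((n - 2 : ℕ) : ℝ) = (n : ℝ) - 2 := by rw [Nat.cast_sub (by omega)]; simp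
  have hp : -(((n - 2 : ℕ) : ℝ) / 2) = 1 - (n : ℝ) / 2 := by rw [hcast]; ring
  have hn0 : (n : ℝ) ≠ 0 := by positivity
  have hL : IsTest fun z => ∑ i, ThresholdResonance.pd i (ThresholdResonance.pd i η) z :=
    isTest_sum _ fun i _ => (hη.pd i).pd i
  have hreg (k : ℕ) : ∫ z, (∑ i, ThresholdResonance.pd i (ThresholdResonance.pd i η) z) *
      (‖z‖ ^ 2 + (1 / ((k : ℝ) + 1)) ^ 2) ^ (-(((n - 2 : ℕ) : ℝ) / 2)) =
      -(n * ((n : ℝ) - 2)) * ∫ u, η ((1 / ((k : ℝ) + 1)) • u) * jap (n + 2) u := by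
    have hc : (0 : ℝ) < (1 / ((k : ℝ) + 1)) ^ 2 := by positivity
    rw [hη.integral_sum_pd_pd_mul (contDiff_norm_sq_add_rpow hc _),
      ← integral_mul_approxIdentity η (by positivity), ← integral_const_mul, hp]
    refine integral_congr_ae (Eventually.of_forall fun z => ?_)
    simp only
    rw [sum_pd_pd_norm_sq_add_rpow hc]
    ring
  have h1 : Tendsto (fun k : ℕ => ∫ z,
      (∑ i, ThresholdResonance.pd i (ThresholdResonance.pd i η) z) *
      (‖z‖ ^ 2 + (1 / ((k : ℝ) + 1)) ^ 2) ^ (-(((n - 2 : ℕ) : ℝ) / 2))) atTop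
      (𝓝 (∫ z, (∑ i, ThresholdResonance.pd i (ThresholdResonance.pd i η) z) *
        riesz (n - 2) z)) := by
    refine tendsto_integral_of_dominated_convergence
      (fun z => ‖(∑ i, ThresholdResonance.pd i (ThresholdResonance.pd i η) z) * riesz (n - 2) z‖)
      (fun k => (hL.continuous.mul
        (contDiff_norm_sq_add_rpow (by positivity) _).continuous).aestronglyMeasurable)
      (hL.integrable_mul_riesz (by omega)).norm (fun k => ?_) ?_
    · filter_upwards [ae_ne_zero (n := n) (by omega)] with z hz
      refine norm_mul_le_norm_mul_of_abs_le _ ?_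
      rw [abs_of_nonneg (by positivity)]
      exact norm_sq_add_rpow_le_riesz _ (by positivity) hz
    · filter_upwards [ae_ne_zero (n := n) (by omega)] with z hz
      exact (tendsto_norm_sq_add_rpow hz _).const_mul _
  simp only [hreg] at h1
  rw [tendsto_nhds_unique h1 ((tendsto_integral_comp_smul_mul_jap hη).const_mul _),
    integral_jap_add_two (by omega)]
  field_simp

/-- The normalization `[(n-2) ω_{n-1}]⁻¹` of the Green's function. -/
noncomputable def greenConst (n : ℕ) : ℝ := (((n : ℝ) - 2) * sphereArea n)⁻¹

lemma greenConst_pos (hn : 3 ≤ n) : 0 < greenConst n := by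
  have h3 : (3 : ℝ) ≤ n := by exact_mod_cast hn
  exact inv_pos.2 (mul_pos (by linarith) (sphereArea_pos (by omega)))

lemma g₀_eq (hn : 3 ≤ n) (x y : Rn n) : g₀ x y = greenConst n * riesz (n - 2) (x - y) := by
  rw [g₀, greenConst, riesz]
  congr 1
  rw [← Real.rpow_natCast, ← Real.rpow_neg (norm_nonneg _), Nat.cast_sub (by omega)]
  congr 1
  push_cast; ring

/-- The `i`-th component of the gradient in `x` of the Green's function `g₀ x y`. -/
noncomputable def gradG₀ (i : Fin n) (x y : Rn n) : ℝ :=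
  -(((n : ℝ) - 2) * greenConst n) * ((x - y) i * riesz n (x - y))

lemma abs_gradG₀_le (hn : 3 ≤ n) (i : Fin n) (x y : Rn n) :
    |gradG₀ i x y| ≤ ((n : ℝ) - 2) * greenConst n * riesz (n - 1) (x - y) := by
  have h3 : (3 : ℝ) ≤ n := by exact_mod_cast hn
  have h4 := greenConst_pos hn
  have h2 := norm_mul_riesz_succ_le (n - 1) (x - y)
  rw [show n - 1 + 1 = n by omega] at h2
  have h5 : 0 ≤ ((n : ℝ) - 2) * greenConst n := mul_nonneg (by linarith) h4.le
  rw [gradG₀, abs_mul, abs_neg, abs_of_nonneg h5, abs_mul, abs_of_nonneg (riesz_nonneg _ _)]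
  refine mul_le_mul_of_nonneg_left (le_trans ?_ h2) h5
  exact mul_le_mul_of_nonneg_right (abs_coord_le_norm _ i) (riesz_nonneg _ _)

lemma IsTest.integral_pd_mul_g₀ (hn : 3 ≤ n) {η : Rn n → ℝ} (hη : IsTest η) (i : Fin n)
    (y : Rn n) :
    ∫ x, ThresholdResonance.pd i η x * g₀ x y = -∫ x, η x * gradG₀ i x y := by
  have h := (hη.comp_add_right y).integral_pd_mul_riesz hn i
  rw [pd_comp_add_right] at h
  rw [← integral_add_right_eq_self (μ := volume) _ y,
    ← integral_add_right_eq_self (μ := volume) (fun x => η x * gradG₀ i x y) y]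
  simp only [g₀_eq hn, gradG₀, add_sub_cancel_right]
  calc ∫ x, ThresholdResonance.pd i η (x + y) * (greenConst n * riesz (n - 2) x)
      = greenConst n * ∫ x, ThresholdResonance.pd i η (x + y) * riesz (n - 2) x := by
        rw [← integral_const_mul]; congr 1; funext x; ring
    _ = greenConst n * (((n : ℝ) - 2) * ∫ z, η (z + y) * (z i * riesz n z)) := by rw [h]
    _ = _ := by
        rw [← integral_const_mul, ← integral_const_mul, ← integral_neg]; congr 1; funext x; ring

/-- `g₀` inverts `-Δ` on test functions. -/
lemma IsTest.integral_sum_pd_pd_mul_g₀ (hn : 3 ≤ n) {η : Rn n → ℝ} (hη : IsTest η) (y : Rn n) :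
    ∫ x, (∑ i, ThresholdResonance.pd i (ThresholdResonance.pd i η) x) * g₀ x y = -η y := by
  have h := (hη.comp_add_right y).integral_sum_pd_pd_mul_riesz hn
  simp only [pd_comp_add_right] at h
  rw [← integral_add_right_eq_self (μ := volume) _ y]
  simp only [g₀_eq hn, add_sub_cancel_right]
  have h3 : (3 : ℝ) ≤ n := by exact_mod_cast hn
  have h4 := sphereArea_pos (n := n) (by omega)
  have h5 : (n : ℝ) - 2 ≠ 0 := by linarith
  calc ∫ x, (∑ i, ThresholdResonance.pd i (ThresholdResonance.pd i η) (x + y)) *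
        (greenConst n * riesz (n - 2) x)
      = greenConst n * ∫ x, (∑ i, ThresholdResonance.pd i (ThresholdResonance.pd i η) (x + y)) *
          riesz (n - 2) x := by
        rw [← integral_const_mul]; congr 1; funext x; ring
    _ = _ := by
        rw [h, greenConst, zero_add]
        field_simp

end FundamentalSolution

/-! ### Newtonian potentials and their weak derivatives -/

section Potentials

variable {n : ℕ}

/-- A measurable kernel on `ℝⁿ × ℝⁿ` dominated by a multiple of `|x - y|^{-m}`. -/
structure IsRieszBounded (K : Rn n → Rn n → ℝ) (m : ℕ) (c : ℝ) : Prop where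
  measurable : Measurable (Function.uncurry K)
  nonneg : 0 ≤ c
  bound : ∀ x y, |K x y| ≤ c * riesz m (x - y)

lemma isRieszBounded_g₀ (hn : 3 ≤ n) :
    IsRieszBounded (g₀ : Rn n → Rn n → ℝ) (n - 2) (greenConst n) where
  measurable := by
    simp only [Function.uncurry_def, g₀_eq hn]
    fun_prop
  nonneg := (greenConst_pos hn).le
  bound x y := by
    rw [g₀_eq hn, abs_of_nonneg (mul_nonneg (greenConst_pos hn).le (riesz_nonneg _ _))]

lemma isRieszBounded_gradG₀ (hn : 3 ≤ n) (i : Fin n) :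
    IsRieszBounded (gradG₀ i : Rn n → Rn n → ℝ) (n - 1) (((n : ℝ) - 2) * greenConst n) where
  measurable := by
    simp only [Function.uncurry_def, gradG₀]
    fun_prop
  nonneg := by
    have h3 : (3 : ℝ) ≤ n := by exact_mod_cast hn
    exact mul_nonneg (by linarith) (greenConst_pos hn).le
  bound x y := abs_gradG₀_le hn i x y

lemma integrable_riesz_mul_jap {m : ℕ} (hm : m < n) (x : Rn n) :
    Integrable fun y => riesz m (x - y) * jap (n + 1) y := by
  obtain ⟨C, _, hC⟩ := exists_lintegral_riesz_mul_jap_le hm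
  refine ⟨Measurable.aestronglyMeasurable (by fun_prop), ?_⟩
  rw [hasFiniteIntegral_iff_ofReal
    (Eventually.of_forall fun y => mul_nonneg (riesz_nonneg _ _) (jap_nonneg _ _))]
  simp only [ENNReal.ofReal_mul (riesz_nonneg _ _)]
  exact (hC x).trans_lt ENNReal.ofReal_lt_top

lemma exists_integral_riesz_mul_jap_le {m : ℕ} (hm : m < n) :
    ∃ C : ℝ, 0 < C ∧ ∀ x : Rn n, ∫ y, riesz m (x - y) * jap (n + 1) y ≤ C * jap m x := by
  obtain ⟨C, hC0, hC⟩ := exists_lintegral_riesz_mul_jap_le hm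
  refine ⟨C, hC0, fun x => ?_⟩
  have h := ofReal_integral_eq_lintegral_ofReal (integrable_riesz_mul_jap hm x)
    (Eventually.of_forall fun y => mul_nonneg (riesz_nonneg _ _) (jap_nonneg _ _))
  simp only [ENNReal.ofReal_mul (riesz_nonneg _ _)] at h
  have h2 := hC x
  rw [← h] at h2
  exact (ENNReal.ofReal_le_ofReal_iff (mul_nonneg hC0.le (jap_nonneg _ _))).1 h2

lemma IsRieszBounded.measurable_right {K : Rn n → Rn n → ℝ} {m : ℕ} {c : ℝ}
    (hK : IsRieszBounded K m c) (x : Rn n) : Measurable (K x) :=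
  hK.measurable.comp measurable_prodMk_left

lemma IsRieszBounded.swap {K : Rn n → Rn n → ℝ} {m : ℕ} {c : ℝ}
    (hK : IsRieszBounded K m c) : IsRieszBounded (fun x y => K y x) m c where
  measurable := hK.measurable.comp measurable_swap
  nonneg := hK.nonneg
  bound x y := by rw [riesz_sub_comm]; exact hK.bound y x

/-- Potentials of functions of size `⟨y⟩^{-n-1}` converge absolutely everywhere. -/
lemma IsRieszBounded.integrable_of_le {K : Rn n → Rn n → ℝ} {m : ℕ} {c : ℝ}
    (hK : IsRieszBounded K m c) (hm : m < n) {F : Type*} [NormedAddCommGroup F] [NormedSpace ℝ F]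
    {f : Rn n → F} (hf : AEStronglyMeasurable f) {B : ℝ}
    (hB : ∀ᵐ y, ‖f y‖ ≤ B * jap (n + 1) y) (x : Rn n) :
    Integrable fun y => K x y • f y := by
  refine Integrable.mono' ((integrable_riesz_mul_jap hm x).const_mul (c * B))
    ((hK.measurable_right x).aestronglyMeasurable.smul hf) ?_
  filter_upwards [hB] with y hy
  rw [norm_smul]
  calc ‖K x y‖ * ‖f y‖ ≤ (c * riesz m (x - y)) * (B * jap (n + 1) y) :=
        mul_le_mul (hK.bound x y) hy (norm_nonneg _)
          (mul_nonneg hK.nonneg (riesz_nonneg _ _))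
    _ = _ := by ring

/-- Potentials of functions of size `⟨y⟩^{-n-1}` with respect to a kernel dominated by `|x - y|^{-m}`
decay like `⟨x⟩^{-m}`. -/
lemma IsRieszBounded.exists_norm_integral_le {K : Rn n → Rn n → ℝ} {m : ℕ} {c : ℝ}
    (hK : IsRieszBounded K m c) (hm : m < n) {F : Type*} [NormedAddCommGroup F] [NormedSpace ℝ F]
    {f : Rn n → F} {B : ℝ} (hB : ∀ᵐ y, ‖f y‖ ≤ B * jap (n + 1) y) :
    ∃ C : ℝ, 0 ≤ C ∧ ∀ x, ‖∫ y, K x y • f y‖ ≤ C * jap m x := by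
  obtain ⟨C, hC0, hC⟩ := exists_integral_riesz_mul_jap_le (n := n) hm
  have hB' : ∀ᵐ y, ‖f y‖ ≤ |B| * jap (n + 1) y := by
    filter_upwards [hB] with y hy
    exact hy.trans (mul_le_mul_of_nonneg_right (le_abs_self B) (jap_nonneg _ _))
  refine ⟨c * |B| * C, by have := hK.nonneg; positivity, fun x => ?_⟩
  calc ‖∫ y, K x y • f y‖ ≤ ∫ y, c * |B| * (riesz m (x - y) * jap (n + 1) y) := by
        refine norm_integral_le_of_norm_le ((integrable_riesz_mul_jap hm x).const_mul _) ?_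
        filter_upwards [hB'] with y hy
        rw [norm_smul]
        calc ‖K x y‖ * ‖f y‖ ≤ (c * riesz m (x - y)) * (|B| * jap (n + 1) y) :=
              mul_le_mul (hK.bound x y) hy (norm_nonneg _)
                (mul_nonneg hK.nonneg (riesz_nonneg _ _))
          _ = _ := by ring
    _ = c * |B| * ∫ y, riesz m (x - y) * jap (n + 1) y := integral_const_mul _ _
    _ ≤ c * |B| * (C * jap m x) :=
        mul_le_mul_of_nonneg_left (hC x) (mul_nonneg hK.nonneg (abs_nonneg B))
    _ = _ := by ring

/-- Absolute convergence of the double integral `∬ ζ(x) K(x, y) f(y)` when `ζ = O(⟨x⟩^{-n-1})` and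
`⟨y⟩^{-m} f` is integrable. -/
lemma IsRieszBounded.integrable_prod {K : Rn n → Rn n → ℝ} {m : ℕ} {c : ℝ}
    (hK : IsRieszBounded K m c) (hm : m < n) {f : Rn n → ℂ} (hf : AEStronglyMeasurable f)
    (hfi : Integrable fun y => jap m y • f y) {ζ : Rn n → ℝ} (hζm : AEStronglyMeasurable ζ)
    {M : ℝ} (hζ : ∀ᵐ x, |ζ x| ≤ M * jap (n + 1) x) :
    Integrable (Function.uncurry fun x y => ζ x • (K x y • f y))
      ((volume : Measure (Rn n)).prod volume) := by
  obtain ⟨C, hC0, hC⟩ := exists_integral_riesz_mul_jap_le (n := n) hm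
  have hmeas : AEStronglyMeasurable (Function.uncurry fun x y => ζ x • (K x y • f y))
      ((volume : Measure (Rn n)).prod volume) :=
    hζm.comp_fst.smul (hK.measurable.aestronglyMeasurable.smul hf.comp_snd)
  have hM : 0 ≤ M := by
    obtain ⟨x, hx⟩ := hζ.exists
    have := (abs_nonneg _).trans hx
    exact nonneg_of_mul_nonneg_left this (jap_pos _ _)
  have hbd (y : Rn n) : ∀ᵐ x, ‖ζ x • (K x y • f y)‖ ≤
      (M * c * ‖f y‖) * (riesz m (y - x) * jap (n + 1) x) := by
    filter_upwards [hζ] with x hx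
    rw [norm_smul, norm_smul]
    calc ‖ζ x‖ * (‖K x y‖ * ‖f y‖)
        ≤ (M * jap (n + 1) x) * ((c * riesz m (x - y)) * ‖f y‖) := by
          refine mul_le_mul hx (mul_le_mul_of_nonneg_right (hK.bound x y) (norm_nonneg _))
            (by positivity) (mul_nonneg hM (jap_nonneg _ _))
      _ = _ := by rw [riesz_sub_comm]; ring
  rw [integrable_prod_iff' hmeas]
  constructor
  · filter_upwards [hmeas.prodMk_right] with y hy
    exact Integrable.mono' ((integrable_riesz_mul_jap hm y).const_mul _) hy
      (hbd y)
  · refine Integrable.mono' (hfi.norm.const_mul (M * c * C)) hmeas.norm.prod_swap.integral_prod_right' ?_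
    refine Eventually.of_forall fun y => ?_
    rw [Real.norm_of_nonneg (integral_nonneg fun x => norm_nonneg _), norm_smul,
      Real.norm_of_nonneg (jap_nonneg _ _)]
    calc ∫ x, ‖(Function.uncurry fun x y => ζ x • (K x y • f y)) (x, y)‖
        ≤ ∫ x, (M * c * ‖f y‖) * (riesz m (y - x) * jap (n + 1) x) :=
          integral_mono_of_nonneg (Eventually.of_forall fun x => norm_nonneg _)
            ((integrable_riesz_mul_jap hm y).const_mul _) (hbd y)
      _ = (M * c * ‖f y‖) * ∫ x, riesz m (y - x) * jap (n + 1) x := integral_const_mul _ _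
      _ ≤ (M * c * ‖f y‖) * (C * jap m y) :=
          mul_le_mul_of_nonneg_left (hC y) (by have := hK.nonneg; positivity)
      _ = _ := by ring

lemma IsRieszBounded.ae_integrable {K : Rn n → Rn n → ℝ} {m : ℕ} {c : ℝ}
    (hK : IsRieszBounded K m c) (hm : m < n) {f : Rn n → ℂ} (hf : AEStronglyMeasurable f)
    (hfi : Integrable fun y => jap m y • f y) :
    ∀ᵐ x, Integrable fun y => K x y • f y := by
  have h := (hK.integrable_prod hm hf hfi (continuous_jap (n + 1)).aestronglyMeasurable
    (M := 1) (Eventually.of_forall fun x => by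
      rw [one_mul, abs_of_nonneg (jap_nonneg _ _)])).prod_right_ae
  filter_upwards [h] with x hx
  have h2 := hx.smul (jap (n + 1) x)⁻¹
  refine h2.congr (Eventually.of_forall fun y => ?_)
  simp only [Pi.smul_apply, Function.uncurry_apply_pair]
  rw [inv_smul_smul₀ (jap_pos (n + 1) x).ne']

lemma IsRieszBounded.integrable_jap_smul {K : Rn n → Rn n → ℝ} {m : ℕ} {c : ℝ}
    (hK : IsRieszBounded K m c) (hm : m < n) {f : Rn n → ℂ} (hf : AEStronglyMeasurable f)
    (hfi : Integrable fun y => jap m y • f y) :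
    Integrable fun x => jap (n + 1) x • ∫ y, K x y • f y := by
  have h := (hK.integrable_prod hm hf hfi (continuous_jap (n + 1)).aestronglyMeasurable
    (M := 1) (Eventually.of_forall fun x => by
      rw [one_mul, abs_of_nonneg (jap_nonneg _ _)])).integral_prod_left
  simpa only [Function.uncurry_apply_pair, integral_smul] using h

lemma locallyIntegrable_of_jap_smul {k : ℕ} {f : Rn n → ℂ}
    (h : Integrable fun x => jap k x • f x) : LocallyIntegrable f := by
  rw [← locallyIntegrableOn_univ]
  have h2 := h.locallyIntegrable.locallyIntegrableOn Set.univ |>.continuousOn_smul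
    (𝕜 := ℝ) isOpen_univ.isLocallyClosed (g := fun x => bracket x ^ k)
    (by fun_prop)
  refine h2.congr (Eventually.of_forall fun x => ?_)
  simp only [jap]
  rw [smul_inv_smul₀ (pow_pos (bracket_pos x) k).ne']

lemma IsTest.exists_abs_le_jap {η : Rn n → ℝ} (hη : IsTest η) (k : ℕ) :
    ∃ M : ℝ, ∀ x, |η x| ≤ M * jap k x := by
  have hc : Continuous fun x => bracket x ^ k * η x :=
    (continuous_bracket.pow k).mul hη.continuous
  obtain ⟨M, hM⟩ := hc.bounded_above_of_compact_support hη.hasCompactSupport.mul_left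
  refine ⟨M, fun x => ?_⟩
  have h := hM x
  rw [norm_mul, Real.norm_of_nonneg (pow_pos (bracket_pos x) k).le] at h
  rw [jap, ← div_eq_mul_inv, le_div_iff₀ (pow_pos (bracket_pos x) k), mul_comm]
  exact h

/-- Fubini for the pairing of a potential with a rapidly decaying function. -/
lemma IsRieszBounded.integral_smul_integral {K : Rn n → Rn n → ℝ} {m : ℕ} {c : ℝ}
    (hK : IsRieszBounded K m c) (hm : m < n) {f : Rn n → ℂ} (hf : AEStronglyMeasurable f)
    (hfi : Integrable fun y => jap m y • f y) {ζ : Rn n → ℝ} (hζm : AEStronglyMeasurable ζ)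
    {M : ℝ} (hζ : ∀ᵐ x, |ζ x| ≤ M * jap (n + 1) x) :
    ∫ x, ζ x • ∫ y, K x y • f y = ∫ y, (∫ x, ζ x * K x y) • f y := by
  have h := integral_integral_swap (hK.integrable_prod hm hf hfi hζm hζ)
  simp only [integral_smul] at h
  rw [h]
  refine integral_congr_ae (Eventually.of_forall fun y => ?_)
  simp only [smul_smul]
  rw [integral_smul_const]

lemma IsTest.integral_smul_integral {ζ : Rn n → ℝ} (hζ : IsTest ζ) {K : Rn n → Rn n → ℝ} {m : ℕ}
    {c : ℝ} (hK : IsRieszBounded K m c) (hm : m < n) {f : Rn n → ℂ}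
    (hf : AEStronglyMeasurable f) (hfi : Integrable fun y => jap m y • f y) :
    ∫ x, ζ x • ∫ y, K x y • f y = ∫ y, (∫ x, ζ x * K x y) • f y := by
  obtain ⟨M, hM⟩ := hζ.exists_abs_le_jap (n + 1)
  exact hK.integral_smul_integral hm hf hfi hζ.continuous.aestronglyMeasurable
    (Eventually.of_forall hM)

/-- The gradient of the zero-energy potential of `f`. -/
noncomputable def gradPotential (i : Fin n) (f : Rn n → ℂ) (x : Rn n) : ℂ :=
  ∫ y, gradG₀ i x y • f y

lemma integrable_jap_smul_anti {j k : ℕ} (h : j ≤ k) {f : Rn n → ℂ}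
    (hf : AEStronglyMeasurable f) (hfi : Integrable fun y => jap j y • f y) :
    Integrable fun y => jap k y • f y := by
  refine hfi.mono ((continuous_jap k).aestronglyMeasurable.smul hf)
    (Eventually.of_forall fun y => ?_)
  rw [norm_smul, norm_smul, Real.norm_of_nonneg (jap_nonneg _ _),
    Real.norm_of_nonneg (jap_nonneg _ _)]
  exact mul_le_mul_of_nonneg_right (jap_anti h y) (norm_nonneg _)

lemma locallyIntegrable_freeResolventZero (hn : 3 ≤ n) {f : Rn n → ℂ}
    (hf : AEStronglyMeasurable f) (hfi : Integrable fun y => jap (n - 2) y • f y) :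
    LocallyIntegrable (freeResolventZero f) :=
  locallyIntegrable_of_jap_smul ((isRieszBounded_g₀ hn).integrable_jap_smul (by omega) hf hfi)

lemma hasWeakPartial_freeResolventZero (hn : 3 ≤ n) {f : Rn n → ℂ}
    (hf : AEStronglyMeasurable f) (hfi : Integrable fun y => jap (n - 2) y • f y) (i : Fin n) :
    HasWeakPartial (freeResolventZero f) (gradPotential i f) i := by
  have hfi' := integrable_jap_smul_anti (show n - 2 ≤ n - 1 by omega) hf hfi
  have hG := isRieszBounded_gradG₀ hn i
  refine ⟨locallyIntegrable_freeResolventZero hn hf hfi,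
    locallyIntegrable_of_jap_smul (hG.integrable_jap_smul (by omega) hf hfi'), fun η => ?_⟩
  have hη := isTest_coe η
  have h1 := (hη.pd i).integral_smul_integral (isRieszBounded_g₀ hn) (by omega) hf hfi
  have h2 := hη.integral_smul_integral hG (by omega) hf hfi'
  simp only [hη.integral_pd_mul_g₀ hn i, neg_smul, integral_neg] at h1
  rw [← h2] at h1
  exact h1

/-- The operator `(h₀ + 0)⁻¹` inverts `-Δ` in the sense of distributions. -/
lemma hasWeakLaplacian_freeResolventZero (hn : 3 ≤ n) {f : Rn n → ℂ}
    (hf : AEStronglyMeasurable f) (hfi : Integrable fun y => jap (n - 2) y • f y) :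
    HasWeakLaplacian (freeResolventZero f) (-f) := by
  refine ⟨locallyIntegrable_freeResolventZero hn hf hfi,
    (locallyIntegrable_of_jap_smul hfi).neg, fun η => ?_⟩
  have hη := isTest_coe η
  have hL : IsTest fun z => ∑ i, pd i (pd i (η : Rn n → ℝ)) z :=
    isTest_sum _ fun i _ => (hη.pd i).pd i
  have h1 := hL.integral_smul_integral (isRieszBounded_g₀ hn) (by omega) hf hfi
  simp only [hη.integral_sum_pd_pd_mul_g₀ hn] at h1
  simp only [hη.laplacian_eq]
  rw [show (∫ x, (∑ i, pd i (pd i (η : Rn n → ℝ)) x) • freeResolventZero f x) = _ from h1]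
  simp

/-- The Newtonian potential of a test function. -/
noncomputable def testPotential (η : Rn n → ℝ) (y : Rn n) : ℝ := ∫ x, η x * g₀ x y

lemma integral_smul_freeResolventZero (hn : 3 ≤ n) {f : Rn n → ℂ}
    (hf : AEStronglyMeasurable f) (hfi : Integrable fun y => jap (n - 2) y • f y)
    {η : Rn n → ℝ} (hη : IsTest η) :
    ∫ x, η x • freeResolventZero f x = ∫ y, testPotential η y • f y :=
  hη.integral_smul_integral (isRieszBounded_g₀ hn) (by omega) hf hfi

lemma testPotential_eq_convolution (hn : 3 ≤ n) (η : Rn n → ℝ) :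
    testPotential η = convolution (fun t => greenConst n * riesz (n - 2) t) η
      (ContinuousLinearMap.mul ℝ ℝ) volume := by
  funext y
  rw [testPotential, convolution_def, ← integral_sub_left_eq_self _ _ y]
  refine integral_congr_ae (Eventually.of_forall fun t => ?_)
  simp only [g₀_eq hn, ContinuousLinearMap.mul_apply']
  rw [show y - t - y = -t by abel, riesz_neg]
  ring

lemma locallyIntegrable_const_mul_riesz (hn : 3 ≤ n) :
    LocallyIntegrable (fun t : Rn n => greenConst n * riesz (n - 2) t) :=
  (locallyIntegrable_riesz (n := n) (m := n - 2) (by omega)).smul (greenConst n)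

lemma IsTest.contDiff_testPotential (hn : 3 ≤ n) {η : Rn n → ℝ} (hη : IsTest η) :
    ContDiff ℝ (⊤ : ℕ∞) (testPotential η) := by
  rw [testPotential_eq_convolution hn]
  exact hη.hasCompactSupport.contDiff_convolution_right _ (locallyIntegrable_const_mul_riesz hn)
    hη.contDiff

lemma IsTest.pd_testPotential (hn : 3 ≤ n) {η : Rn n → ℝ} (hη : IsTest η) (i : Fin n) :
    ThresholdResonance.pd i (testPotential η) = testPotential (ThresholdResonance.pd i η) := by
  funext y
  rw [testPotential_eq_convolution hn, testPotential_eq_convolution hn, ThresholdResonance.pd,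
    (hη.hasCompactSupport.hasFDerivAt_convolution_right _ (locallyIntegrable_const_mul_riesz hn)
      (contDiff_infty.1 hη.contDiff 1) y).fderiv,
    convolution_precompR_apply _ (locallyIntegrable_const_mul_riesz hn)
      (hη.hasCompactSupport.fderiv ℝ) (hη.contDiff.continuous_fderiv (by simp))]
  rfl

lemma IsTest.exists_abs_testPotential_le (hn : 3 ≤ n) {η : Rn n → ℝ} (hη : IsTest η) :
    ∃ C : ℝ, 0 ≤ C ∧ ∀ y, |testPotential η y| ≤ C * jap (n - 2) y := by
  obtain ⟨M, hM⟩ := hη.exists_abs_le_jap (n + 1)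
  obtain ⟨C, hC0, hC⟩ := (isRieszBounded_g₀ hn).swap.exists_norm_integral_le (by omega)
    (f := η) (Eventually.of_forall hM)
  refine ⟨C, hC0, fun y => ?_⟩
  have := hC y
  simpa only [testPotential, smul_eq_mul, mul_comm, Real.norm_eq_abs] using this

/-- The potential of a derivative of a test function decays like the gradient of the Green's function:
the derivative is moved onto the kernel. -/
lemma IsTest.exists_abs_testPotential_pd_le (hn : 3 ≤ n) {η : Rn n → ℝ} (hη : IsTest η)
    (i : Fin n) :
    ∃ C : ℝ, 0 ≤ C ∧ ∀ y, |testPotential (ThresholdResonance.pd i η) y| ≤ C * jap (n - 1) y := by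
  obtain ⟨M, hM⟩ := hη.exists_abs_le_jap (n + 1)
  obtain ⟨C, hC0, hC⟩ := (isRieszBounded_gradG₀ hn i).swap.exists_norm_integral_le (by omega)
    (f := η) (Eventually.of_forall hM)
  refine ⟨C, hC0, fun y => ?_⟩
  have := hC y
  rw [testPotential, hη.integral_pd_mul_g₀ hn i, abs_neg]
  simpa only [smul_eq_mul, mul_comm, Real.norm_eq_abs] using this

lemma IsTest.testPotential_sum_pd_pd (hn : 3 ≤ n) {η : Rn n → ℝ} (hη : IsTest η) (y : Rn n) :
    testPotential (fun x => ∑ i, ThresholdResonance.pd i (ThresholdResonance.pd i η) x) y =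
      -η y :=
  hη.integral_sum_pd_pd_mul_g₀ hn y

lemma IsTest.integrable_mul_g₀ (hn : 3 ≤ n) {η : Rn n → ℝ} (hη : IsTest η) (y : Rn n) :
    Integrable fun x => η x * g₀ x y := by
  obtain ⟨M, hM⟩ := hη.exists_abs_le_jap (n + 1)
  have h := (isRieszBounded_g₀ hn).swap.integrable_of_le (by omega)
    hη.continuous.aestronglyMeasurable (Eventually.of_forall hM) y
  simpa only [smul_eq_mul, mul_comm] using h

lemma IsTest.sum_testPotential_pd_pd (hn : 3 ≤ n) {η : Rn n → ℝ} (hη : IsTest η) (y : Rn n) :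
    ∑ i, testPotential (ThresholdResonance.pd i (ThresholdResonance.pd i η)) y = -η y := by
  rw [← hη.testPotential_sum_pd_pd hn]
  simp only [testPotential, Finset.sum_mul]
  rw [integral_finsetSum _ fun i _ => ((hη.pd i).pd i).integrable_mul_g₀ hn y]

end Potentials

/-! ### Square integrable zero-energy solutions are Newtonian potentials -/

section Representation

variable {n : ℕ}

lemma pd_comp_smul {η : Rn n → ℝ} (hη : Differentiable ℝ η) (i : Fin n) (ε : ℝ) :
    pd i (fun x => η (ε • x)) = fun x => ε * pd i η (ε • x) := by
  funext x
  have h : HasFDerivAt (fun x : Rn n => ε • x) (ε • ContinuousLinearMap.id ℝ (Rn n)) x :=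
    (hasFDerivAt_id x).const_smul ε
  have h2 := (hη (ε • x)).hasFDerivAt.comp x h
  have h3 : (fun x => η (ε • x)) = η ∘ fun x : Rn n => ε • x := rfl
  rw [pd, h3, h2.fderiv]
  simp [pd]

lemma IsTest.comp_smul {η : Rn n → ℝ} (hη : IsTest η) {ε : ℝ} (hε : ε ≠ 0) :
    IsTest fun x => η (ε • x) :=
  ⟨hη.contDiff.comp (contDiff_const_smul ε), hη.hasCompactSupport.comp_smul hε⟩

lemma mul_jap_one_smul_le {ε : ℝ} (hε : 0 < ε) (hε1 : ε ≤ 1) (x : Rn n) :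
    ε * jap 1 (ε • x) ≤ jap 1 x := by
  have h : ε * bracket x ≤ bracket (ε • x) := by
    rw [bracket, bracket]
    refine Real.le_sqrt_of_sq_le ?_
    rw [mul_pow, Real.sq_sqrt (by positivity), norm_smul, Real.norm_of_nonneg hε.le]
    nlinarith [sq_nonneg ‖x‖, pow_le_one₀ hε.le hε1 (n := 2)]
  have hx := bracket_pos x
  have hx2 := bracket_pos (ε • x)
  rw [jap, jap, pow_one, pow_one, ← div_eq_mul_inv, div_le_iff₀ hx2, inv_mul_eq_div,
    le_div_iff₀ hx]
  exact h

/-- Rescaled test functions `ε η(εx)`, `0 < ε ≤ 1`, are `O(⟨x⟩⁻¹)` uniformly in `ε`, and they tend to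
zero uniformly in `x`. -/
lemma IsTest.exists_abs_mul_comp_smul_le {η : Rn n → ℝ} (hη : IsTest η) :
    ∃ M : ℝ, 0 ≤ M ∧ ∀ ε : ℝ, 0 < ε → ε ≤ 1 → ∀ x,
      |ε * η (ε • x)| ≤ M * jap 1 x ∧ |ε * η (ε • x)| ≤ M * ε := by
  obtain ⟨M, hM⟩ := hη.exists_abs_le_jap 1
  refine ⟨|M|, abs_nonneg M, fun ε hε hε1 x => ?_⟩
  have h1 : |η (ε • x)| ≤ |M| * jap 1 (ε • x) :=
    (hM _).trans (mul_le_mul_of_nonneg_right (le_abs_self M) (jap_nonneg _ _))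
  rw [abs_mul, abs_of_pos hε]
  constructor
  · calc ε * |η (ε • x)| ≤ ε * (|M| * jap 1 (ε • x)) := by gcongr
      _ = |M| * (ε * jap 1 (ε • x)) := by ring
      _ ≤ |M| * jap 1 x := by gcongr; exact mul_jap_one_smul_le hε hε1 x
  · calc ε * |η (ε • x)| ≤ ε * (|M| * 1) := by
          gcongr
          exact h1.trans (by gcongr; exact jap_le_one _ _)
      _ = _ := by ring

lemma sum_pd_pd_mul {f g : Rn n → ℝ} (hf : ContDiff ℝ (⊤ : ℕ∞) f) (hg : ContDiff ℝ (⊤ : ℕ∞) g)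
    (x : Rn n) :
    ∑ i, pd i (pd i fun x => f x * g x) x =
      ∑ i, (pd i (pd i f) x * g x + 2 * pd i f x * pd i g x) + f x * ∑ i, pd i (pd i g) x := by
  rw [Finset.mul_sum, ← Finset.sum_add_distrib]
  refine Finset.sum_congr rfl fun i _ => ?_
  have hd {u : Rn n → ℝ} (hu : ContDiff ℝ (⊤ : ℕ∞) u) : Differentiable ℝ u :=
    hu.differentiable (by simp)
  have h1 : (pd i fun x => f x * g x) = fun x => pd i f x * g x + f x * pd i g x :=
    funext fun x => pd_mul (hd hf x) (hd hg x) i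
  have hf' := hd (contDiff_pd hf i)
  have hg' := hd (contDiff_pd hg i)
  have h2 : pd i (fun x => pd i f x * g x + f x * pd i g x) x =
      pd i (fun x => pd i f x * g x) x + pd i (fun x => f x * pd i g x) x := by
    have ha : DifferentiableAt ℝ (fun x => pd i f x * g x) x := (hf' x).mul (hd hg x)
    have hb : DifferentiableAt ℝ (fun x => f x * pd i g x) x := (hd hf x).mul (hg' x)
    rw [pd, fderiv_fun_add ha hb]
    rfl
  rw [h1, h2, pd_mul (hf' x) (hd hg x), pd_mul (hd hf x) (hg' x)]
  ring

/-- By the Cauchy-Schwarz inequality, `L²` is contained in `L¹` with weight `⟨x⟩^{-k}` if `2k > n`. -/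
lemma integrable_jap_smul_of_memLp_two {k : ℕ} (hk : n < 2 * k) {f : Rn n → ℂ}
    (hf : MemLp f 2) : Integrable fun x => jap k x • f x := by
  have h : MemLp (jap k : Rn n → ℝ) 2 := by
    refine memLp_jap ?_ (by norm_num)
    rw [mul_comm]
    exact_mod_cast hk
  exact memLp_one_iff_integrable.1 (hf.smul h)

/-- Cutoffs `χ(x / R)` and the size of the commutator terms of the Laplacian with them. -/
lemma exists_cutoff {u : Rn n → ℝ} {k : ℕ}
    {C : ℝ} (hC : 0 ≤ C) (h0 : ∀ x, |u x| ≤ C * jap k x) (h1 : ∀ i x, |pd i u x| ≤ C * jap k x) :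
    ∃ χ : ℕ → Rn n → ℝ, ∃ M : ℝ, 0 ≤ M ∧
      (∀ j, IsTest (χ j)) ∧ (∀ j x, |χ j x| ≤ 1) ∧
      (∀ x, Tendsto (fun j => χ j x) atTop (𝓝 1)) ∧
      (∀ j x, |∑ i, (pd i (pd i (χ j)) x * u x + 2 * pd i (χ j) x * pd i u x)| ≤
        M * jap (k + 1) x) ∧
      (∀ x, Tendsto (fun j => ∑ i, (pd i (pd i (χ j)) x * u x + 2 * pd i (χ j) x * pd i u x))
        atTop (𝓝 0)) := by
  let b : ContDiffBump (0 : Rn n) := ⟨1, 2, by norm_num, by norm_num⟩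
  have hb : IsTest (b : Rn n → ℝ) := ⟨b.contDiff, b.hasCompactSupport⟩
  have hbd : Differentiable ℝ (b : Rn n → ℝ) := hb.contDiff.differentiable (by simp)
  choose M₁ hM₁ hM₁' using fun i => (hb.pd i).exists_abs_mul_comp_smul_le
  choose M₂ hM₂ hM₂' using fun i => ((hb.pd i).pd i).exists_abs_mul_comp_smul_le
  obtain ⟨ε, hε⟩ : ∃ ε : ℕ → ℝ, ∀ j, ε j = 1 / ((j : ℝ) + 1) := ⟨_, fun _ => rfl⟩
  have hε0 (j) : 0 < ε j := by rw [hε]; positivity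
  have hε1 (j) : ε j ≤ 1 := by
    rw [hε, div_le_one (by positivity)]
    linarith [Nat.cast_nonneg (α := ℝ) j]
  have hεt : Tendsto ε atTop (𝓝 0) := by
    rw [funext hε]; exact tendsto_one_div_add_atTop_nhds_zero_nat
  have hp1 (j) (i) : pd i (fun x => b (ε j • x)) = fun x => ε j * pd i b (ε j • x) :=
    pd_comp_smul hbd i _
  have hp2 (j) (i) (x) : pd i (pd i (fun x => b (ε j • x))) x =
      ε j * (ε j * pd i (pd i b) (ε j • x)) := by
    have hd := (hb.pd i).contDiff.differentiable (by simp)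
    have h3 := congrFun (pd_comp_smul hd i (ε j)) x
    rw [hp1, ← h3]
    have hd' : Differentiable ℝ fun x => pd i b (ε j • x) :=
      hd.comp (differentiable_id.const_smul (ε j))
    rw [pd, fderiv_const_mul (hd' x)]
    rfl
  -- each commutator term is small both in the weight and in the cutoff parameter
  have hterm (j) (i) (x) (s : ℝ) (hs : 0 ≤ s) (h2 : |ε j * pd i b (ε j • x)| ≤ M₁ i * s)
      (h3 : |ε j * pd i (pd i b) (ε j • x)| ≤ M₂ i * s) :
      |pd i (pd i (fun x => b (ε j • x))) x * u x +
        2 * pd i (fun x => b (ε j • x)) x * pd i u x| ≤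
      (M₂ i + 2 * M₁ i) * C * (jap k x * s) := by
    have hj := jap_nonneg k x
    rw [hp2, hp1]
    refine (abs_add_le _ _).trans ?_
    rw [abs_mul, abs_mul, abs_mul (2 * _), abs_mul 2, abs_of_pos (hε0 j), abs_two]
    have e1 : ε j * |ε j * pd i (pd i b) (ε j • x)| * |u x| ≤ 1 * (M₂ i * s) * (C * jap k x) := by
      have := hM₂ i
      gcongr
      · exact hε1 j
      · exact h0 x
    have e2 : 2 * |ε j * pd i b (ε j • x)| * |pd i u x| ≤ 2 * (M₁ i * s) * (C * jap k x) := by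
      have := hM₁ i
      gcongr
      exact h1 i x
    calc _ ≤ _ := add_le_add e1 e2
      _ = _ := by ring
  have hM0 (i) : 0 ≤ (M₂ i + 2 * M₁ i) * C := by
    have := hM₁ i; have := hM₂ i; positivity
  refine ⟨fun j x => b (ε j • x), ∑ i, (M₂ i + 2 * M₁ i) * C, Finset.sum_nonneg fun i _ => hM0 i,
    fun j => hb.comp_smul (hε0 j).ne', fun j x => ?_, fun x => ?_, fun j x => ?_, fun x => ?_⟩
  · rw [abs_of_nonneg b.nonneg]; exact b.le_one
  · have h2 : Tendsto (fun j => ε j • x) atTop (𝓝 0) := by simpa using hεt.smul_const x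
    have h3 := (hb.continuous.tendsto 0).comp h2
    rwa [b.one_of_mem_closedBall (by simp [b.rIn_pos.le])] at h3
  · refine (Finset.abs_sum_le_sum_abs _ _).trans ?_
    rw [Finset.sum_mul]
    refine Finset.sum_le_sum fun i _ => ?_
    rw [jap_add]
    exact hterm j i x _ (jap_nonneg 1 x) (hM₁' i _ (hε0 j) (hε1 j) x).1
      (hM₂' i _ (hε0 j) (hε1 j) x).1
  · have hz : ∑ _i : Fin n, (0 : ℝ) = 0 := Finset.sum_const_zero
    refine (tendsto_finsetSum Finset.univ fun i _ => ?_).trans (le_of_eq (congrArg 𝓝 hz))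
    refine squeeze_zero_norm (a := fun j => (M₂ i + 2 * M₁ i) * C * (jap k x * ε j))
      (fun j => hterm j i x _ (hε0 j).le (hM₁' i _ (hε0 j) (hε1 j) x).2
        (hM₂' i _ (hε0 j) (hε1 j) x).2) ?_
    simpa using (hεt.const_mul (jap k x)).const_mul ((M₂ i + 2 * M₁ i) * C)

/-- Unbundled form of the distributional equation. -/
lemma IsDistributionalSolution.integral_eq_zero {v : Rn n → ℝ} {ψ : Rn n → ℂ}
    (h : IsDistributionalSolution v ψ) {ζ : Rn n → ℝ} (hζ : IsTest ζ) :
    ∫ x, (-(∑ i, pd i (pd i ζ) x) + v x * ζ x) • ψ x = 0 := by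
  have h2 := h.2 ⟨ζ, hζ.contDiff, hζ.hasCompactSupport, by simp⟩
  rw [← h2]
  refine integral_congr_ae (Eventually.of_forall fun x => ?_)
  simp only
  rw [← hζ.laplacian_eq]
  rfl

section

variable {v : Rn n → ℝ} {C : ℝ}

lemma ae_abs_le_jap_four (hdecay : ∀ᵐ x : Rn n, |v x| ≤ C * bracket x ^ (-4 : ℤ)) :
    ∀ᵐ x : Rn n, |v x| ≤ C * jap 4 x := by
  filter_upwards [hdecay] with x hx
  rw [jap, show ((bracket x) ^ 4)⁻¹ = bracket x ^ (-4 : ℤ) by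
    rw [zpow_neg]; norm_cast]
  exact hx

lemma integrable_jap_smul_potential_smul (hvm : AEStronglyMeasurable v) (hn : 3 ≤ n)
    (hv : ∀ᵐ x : Rn n, |v x| ≤ C * jap 4 x) {ψ : Rn n → ℂ} (hψ : MemLp ψ 2) :
    Integrable fun y => jap (n - 2) y • (v y • ψ y) := by
  have h := (integrable_jap_smul_of_memLp_two (n := n) (k := n + 2) (by omega) hψ).norm.const_mul C
  refine Integrable.mono' h
    ((continuous_jap _).aestronglyMeasurable.smul (hvm.smul hψ.aestronglyMeasurable)) ?_
  filter_upwards [hv] with x hx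
  have hj := jap_nonneg (n - 2) x
  rw [norm_smul, norm_smul, norm_smul, Real.norm_of_nonneg hj,
    Real.norm_of_nonneg (jap_nonneg (n + 2) x), show n + 2 = n - 2 + 4 by omega, jap_add]
  calc jap (n - 2) x * (‖v x‖ * ‖ψ x‖) ≤ jap (n - 2) x * (C * jap 4 x * ‖ψ x‖) := by
        gcongr; exact hx
    _ = _ := by ring

/-- A square integrable zero-energy solution is the potential of its own source: no harmonic
function is left over. The equation is tested with the Newtonian potential `u` of a test function,
cut off at radius `R → ∞`; the commutator terms are `O(⟨x⟩^{1-n})`, which is in `L²`. -/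
theorem IsDistributionalSolution.eq_neg_freeResolventZero (hn : 3 ≤ n)
    (hvm : AEStronglyMeasurable v) (hC : 0 < C) (hv : ∀ᵐ x : Rn n, |v x| ≤ C * jap 4 x)
    {ψ : Rn n → ℂ} (hψ : MemLp ψ 2) (h : IsDistributionalSolution v ψ) :
    ψ =ᵐ[volume] fun x => -freeResolventZero (fun y => v y • ψ y) x := by
  have hf : AEStronglyMeasurable fun y => v y • ψ y := hvm.smul hψ.aestronglyMeasurable
  have hfi := integrable_jap_smul_potential_smul hvm hn hv hψ
  have hR := locallyIntegrable_freeResolventZero hn hf hfi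
  have hψl : LocallyIntegrable ψ := h.1
  have key (η : Rn n → ℝ) (hη : IsTest η) :
      ∫ x, η x • (ψ x + freeResolventZero (fun y => v y • ψ y) x) = 0 := by
    obtain ⟨C₀, hC₀, hu⟩ := hη.exists_abs_testPotential_le hn
    choose C₁ hC₁ hu1 using fun i => (hη.pd i).exists_abs_testPotential_le hn
    have hus := hη.contDiff_testPotential hn
    have hj := jap_nonneg (n := n) (n - 2)
    have hS : 0 ≤ ∑ i, C₁ i := Finset.sum_nonneg fun i _ => hC₁ i
    have hle1 (i) : C₁ i ≤ C₀ + ∑ i, C₁ i :=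
      (Finset.single_le_sum (fun i _ => hC₁ i) (Finset.mem_univ i)).trans (by linarith)
    obtain ⟨χ, M, hM, hχ, hχ1, hχt, hE, hEt⟩ := exists_cutoff (u := testPotential η) (k := n - 2)
      (C := C₀ + ∑ i, C₁ i) (by positivity)
      (fun x => (hu x).trans (mul_le_mul_of_nonneg_right (by linarith) (hj x)))
      (fun i x => by
        rw [hη.pd_testPotential hn]
        exact (hu1 i x).trans (mul_le_mul_of_nonneg_right (hle1 i) (hj x)))
    rw [show n - 2 + 1 = n - 1 by omega] at hE
    obtain ⟨u, hudef⟩ : ∃ u, u = testPotential η := ⟨_, rfl⟩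
    rw [← hudef] at hus hu hE hEt
    have hΔu (x) : ∑ i, pd i (pd i u) x = -η x := by
      rw [hudef, ← hη.sum_testPotential_pd_pd hn x]
      refine Finset.sum_congr rfl fun i _ => ?_
      rw [hη.pd_testPotential hn, (hη.pd i).pd_testPotential hn]
    obtain ⟨E, hEdef⟩ : ∃ E : ℕ → Rn n → ℝ, ∀ j x, E j x =
      ∑ i, (pd i (pd i (χ j)) x * u x + 2 * pd i (χ j) x * pd i u x) := ⟨_, fun _ _ => rfl⟩
    simp only [← hEdef] at hE hEt
    have hEm (j) : Continuous (E j) := by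
      rw [funext (hEdef j)]
      refine continuous_finsetSum _ fun i _ => ?_
      exact ((((hχ j).pd i).pd i).continuous.mul hus.continuous).add
        ((((hχ j).pd i).continuous.const_mul 2).mul (contDiff_pd hus i).continuous)
    -- `Δ(χu) = E - χη`, where `E` collects the commutator terms
    have heq (j) : ∫ x, (-(E j x + χ j x * -η x) + v x * (χ j x * u x)) • ψ x = 0 := by
      rw [← h.integral_eq_zero ((hχ j).mul_left hus)]
      refine integral_congr_ae (Eventually.of_forall fun x => ?_)
      simp only
      rw [sum_pd_pd_mul (hχ j).contDiff hus, hΔu, hEdef]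
    obtain ⟨N, hN⟩ := hη.exists_abs_le_jap (n - 1)
    have hjap : Integrable fun x => jap (n - 1) x • ψ x :=
      integrable_jap_smul_of_memLp_two (by omega) hψ
    have hbu (x : Rn n) (hx : |v x| ≤ C * jap 4 x) : |v x| * |u x| ≤ C * C₀ * jap (n - 1) x := by
      have e : jap 4 x * jap (n - 2) x ≤ jap (n - 1) x := by
        rw [← jap_add]; exact jap_anti (by omega) x
      calc |v x| * |u x| ≤ (C * jap 4 x) * (C₀ * jap (n - 2) x) :=
            mul_le_mul hx (hu x) (abs_nonneg _) (mul_nonneg hC.le (jap_nonneg _ _))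
        _ = C * C₀ * (jap 4 x * jap (n - 2) x) := by ring
        _ ≤ _ := by gcongr
    have hlim : Tendsto (fun j => ∫ x, (-(E j x + χ j x * -η x) + v x * (χ j x * u x)) • ψ x)
        atTop (𝓝 (∫ x, (-(0 + 1 * -η x) + v x * (1 * u x)) • ψ x)) := by
      refine tendsto_integral_of_dominated_convergence
        (fun x => (M + N + C * C₀) * ‖jap (n - 1) x • ψ x‖) (fun j => ?_)
        (hjap.norm.const_mul _) (fun j => ?_) ?_
      · refine AEStronglyMeasurable.smul (f := fun x => -(E j x + χ j x * -η x) +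
          v x * (χ j x * u x)) ?_ hψ.aestronglyMeasurable
        exact ((hEm j).add ((hχ j).continuous.mul hη.continuous.neg)).neg.aestronglyMeasurable.add
          (hvm.mul ((hχ j).continuous.mul hus.continuous).aestronglyMeasurable)
      · filter_upwards [hv] with x hx
        rw [norm_smul, norm_smul, Real.norm_of_nonneg (jap_nonneg _ x), ← mul_assoc (M + N + C * C₀)]
        refine mul_le_mul_of_nonneg_right ?_ (norm_nonneg _)
        have e1 := hE j x
        have e2 := hN x
        have e3 := hbu x hx
        have e4 := hχ1 j x
        calc ‖-(E j x + χ j x * -η x) + v x * (χ j x * u x)‖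
            ≤ (|E j x| + |χ j x| * |η x|) + |χ j x| * (|v x| * |u x|) := by
              rw [Real.norm_eq_abs]
              refine (abs_add_le _ _).trans (add_le_add ?_ (le_of_eq ?_))
              · rw [abs_neg]
                refine (abs_add_le _ _).trans (add_le_add le_rfl (le_of_eq ?_))
                rw [abs_mul, abs_neg]
              · rw [abs_mul, abs_mul]; ring
          _ ≤ (|E j x| + 1 * |η x|) + 1 * (|v x| * |u x|) := by gcongr
          _ ≤ _ := by linarith
      · refine Eventually.of_forall fun x => ?_
        have ht := ((hEt x).add ((hχt x).mul_const (-η x))).neg.add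
          (((hχt x).mul_const (u x)).const_mul (v x))
        exact ht.smul_const (ψ x)
    simp only [heq] at hlim
    have h0 := tendsto_nhds_unique tendsto_const_nhds hlim
    have hi1 : Integrable fun x => η x • ψ x :=
      hψl.integrable_smul_left_of_hasCompactSupport hη.continuous hη.hasCompactSupport
    have hi2 : Integrable fun x => η x • freeResolventZero (fun y => v y • ψ y) x :=
      hR.integrable_smul_left_of_hasCompactSupport hη.continuous hη.hasCompactSupport
    have hi3 : Integrable fun x => u x • (v x • ψ x) := by
      refine Integrable.mono' (hjap.norm.const_mul (C * C₀))
        (hus.continuous.aestronglyMeasurable.smul hf) ?_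
      filter_upwards [hv] with x hx
      rw [norm_smul, norm_smul, norm_smul, ← mul_assoc, ← mul_assoc,
        Real.norm_of_nonneg (jap_nonneg _ x)]
      refine mul_le_mul_of_nonneg_right ?_ (norm_nonneg _)
      rw [mul_comm]
      exact hbu x hx
    have hpair := integral_smul_freeResolventZero hn hf hfi hη
    simp only [smul_add]
    rw [integral_add hi1 hi2, hpair, ← hudef, ← integral_add hi1 hi3, h0]
    refine integral_congr_ae (Eventually.of_forall fun x => ?_)
    simp only [smul_smul, ← add_smul]
    congr 1
    ring
  have hz := ae_eq_zero_of_integral_contDiff_smul_eq_zero (hψl.add hR)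
    fun η h1 h2 => key η ⟨h1, h2⟩
  filter_upwards [hz] with x hx
  exact eq_neg_of_add_eq_zero_left hx

end

end Representation

/-! ### Second derivatives of Newtonian potentials -/

/-- A linear functional bounded by the seminorm pulled back from a Hilbert space is represented by
a vector of that space. -/
lemma exists_inner_eq_of_abs_le {V H : Type*} [AddCommGroup V] [Module ℝ V]
    [NormedAddCommGroup H] [InnerProductSpace ℝ H] [CompleteSpace H] (ι : V →ₗ[ℝ] H)
    (T : V →ₗ[ℝ] ℝ) (B : ℝ) (h : ∀ x, |T x| ≤ B * ‖ι x‖) :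
    ∃ k : H, ∀ x, T x = inner ℝ k (ι x) := by
  have hker : LinearMap.ker ι ≤ LinearMap.ker T := fun x hx => by
    rw [LinearMap.mem_ker] at hx ⊢
    have h1 := h x
    rw [hx, norm_zero, mul_zero] at h1
    exact abs_nonpos_iff.1 h1
  let F : LinearMap.range ι →ₗ[ℝ] ℝ :=
    (LinearMap.ker ι).liftQ T hker ∘ₗ ι.quotKerEquivRange.symm.toLinearMap
  have hF (x : V) : F ⟨ι x, x, rfl⟩ = T x := by
    have h1 : ι.quotKerEquivRange.symm ⟨ι x, x, rfl⟩ = (LinearMap.ker ι).mkQ x := by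
      rw [LinearEquiv.symm_apply_eq]
      rfl
    simp only [F, LinearMap.comp_apply, LinearEquiv.coe_coe, h1]
    exact Submodule.liftQ_apply _ _ _
  let G : LinearMap.range ι →L[ℝ] ℝ := F.mkContinuous B (by
    rintro ⟨_, x, rfl⟩
    rw [hF]
    exact h x)
  obtain ⟨g, hg, -⟩ := exists_extension_norm_eq (LinearMap.range ι) G
  refine ⟨(InnerProductSpace.toDual ℝ H).symm g, fun x => ?_⟩
  rw [InnerProductSpace.toDual_symm_apply, ← hF]
  exact (hg ⟨ι x, x, rfl⟩).symm

section SecondDerivatives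

variable {n : ℕ}

lemma pd_comm {u : Rn n → ℝ} (hu : ContDiff ℝ (⊤ : ℕ∞) u) (i j : Fin n) :
    pd i (pd j u) = pd j (pd i u) := by
  have h2 : ContDiff ℝ 2 u := contDiff_infty.1 hu 2
  have h (i j : Fin n) (x : Rn n) : pd i (pd j u) x =
      fderiv ℝ (fderiv ℝ u) x (EuclideanSpace.single i 1) (EuclideanSpace.single j 1) := by
    have hd : DifferentiableAt ℝ (fderiv ℝ u) x :=
      (h2.fderiv_right (m := 1) (by norm_num)).differentiable (by norm_num) x
    have h : pd j u = fun y => fderiv ℝ u y (EuclideanSpace.single j 1) := rfl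
    rw [pd, h, fderiv_clm_apply hd (differentiableAt_const _)]
    simp
  funext x
  rw [h, h]
  exact (h2.contDiffAt.isSymmSndFDerivAt (by simp)) _ _

lemma integrable_testPotential_pd_mul (hn : 3 ≤ n) {α β : Rn n → ℝ} (hα : IsTest α)
    (hβ : IsTest β) (i j : Fin n) :
    Integrable fun x => testPotential (pd i α) x * testPotential (pd j β) x := by
  obtain ⟨A, hA, ha⟩ := hα.exists_abs_testPotential_pd_le hn i
  obtain ⟨B, hB, hb⟩ := hβ.exists_abs_testPotential_pd_le hn j
  refine Integrable.mono' ((integrable_jap (n := n) (k := n - 1 + (n - 1))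
    (by omega)).const_mul (A * B))
    (((hα.pd i).contDiff_testPotential hn).continuous.mul
      ((hβ.pd j).contDiff_testPotential hn).continuous).aestronglyMeasurable
    (Eventually.of_forall fun x => ?_)
  rw [norm_mul, jap_add]
  calc _ ≤ (A * jap (n - 1) x) * (B * jap (n - 1) x) :=
        mul_le_mul (ha x) (hb x) (abs_nonneg _) (mul_nonneg hA (jap_nonneg _ _))
    _ = _ := by ring

lemma integral_testPotential_pd_mul_pd (hn : 3 ≤ n) {α β : Rn n → ℝ} (hα : IsTest α)
    (hβ : IsTest β) (i j k : Fin n) :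
    ∫ x, testPotential (pd k (pd i α)) x * testPotential (pd j β) x =
      -∫ x, testPotential (pd i α) x * testPotential (pd k (pd j β)) x := by
  have h := integral_mul_fderiv_eq_neg_fderiv_mul_of_integrable (μ := (volume : Measure (Rn n)))
    (f := testPotential (pd i α)) (g := testPotential (pd j β)) (v := EuclideanSpace.single k 1)
    ?_ ?_ (integrable_testPotential_pd_mul hn hα hβ i j)
    (fun x _ => ((hα.pd i).contDiff_testPotential hn).differentiable (by simp) x)
    (fun x _ => ((hβ.pd j).contDiff_testPotential hn).differentiable (by simp) x)
  · have e1 (x) := congrFun ((hα.pd i).pd_testPotential hn k) x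
    have e2 (x) := congrFun ((hβ.pd j).pd_testPotential hn k) x
    simp only [pd] at e1 e2 h ⊢
    simp only [e1, e2] at h
    rw [h, neg_neg]
  · have := integrable_testPotential_pd_mul hn (hα.pd i) hβ k j
    rw [← (hα.pd i).pd_testPotential hn k] at this
    exact this
  · have := integrable_testPotential_pd_mul hn hα (hβ.pd j) i k
    rw [← (hβ.pd j).pd_testPotential hn k] at this
    exact this

/-- The `L²` estimate `‖∂ᵢ∂ⱼ u‖ ≤ ‖Δ u‖` for the Newtonian potential `u` of a test function. -/
lemma IsTest.integral_sq_testPotential_le (hn : 3 ≤ n) {η : Rn n → ℝ} (hη : IsTest η)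
    (i j : Fin n) :
    ∫ x, testPotential (ThresholdResonance.pd i (ThresholdResonance.pd j η)) x ^ 2 ≤
      ∫ x, η x ^ 2 := by
  -- moving the two derivatives by parts gives `‖∂ᵢ∂ⱼ u‖² = ⟪∂ᵢ² u, ∂ⱼ² u⟫`, which sums to `‖Δu‖²`
  have hid (i j : Fin n) :
      ∫ x, testPotential (ThresholdResonance.pd i (ThresholdResonance.pd j η)) x ^ 2 =
      ∫ x, testPotential (ThresholdResonance.pd i (ThresholdResonance.pd i η)) x *
        testPotential (ThresholdResonance.pd j (ThresholdResonance.pd j η)) x := by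
    simp only [pow_two]
    rw [integral_testPotential_pd_mul_pd hn hη (hη.pd j) j i i,
      pd_comm hη.contDiff i j, pd_comm (hη.pd i).contDiff i j,
      ← integral_testPotential_pd_mul_pd hn hη (hη.pd i) j i j]
    simp only [mul_comm]
  have hint (i j k l : Fin n) := integrable_testPotential_pd_mul hn (hη.pd j) (hη.pd l) i k
  have hsum : ∑ i, ∑ j,
      ∫ x, testPotential (ThresholdResonance.pd i (ThresholdResonance.pd j η)) x ^ 2 =
      ∫ x, η x ^ 2 := by
    simp only [hid]
    rw [← show ∫ x, ∑ i, ∑ j,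
        testPotential (ThresholdResonance.pd i (ThresholdResonance.pd i η)) x *
        testPotential (ThresholdResonance.pd j (ThresholdResonance.pd j η)) x = ∫ x, η x ^ 2 by
      refine integral_congr_ae (Eventually.of_forall fun x => ?_)
      simp only
      rw [← Finset.sum_mul_sum, hη.sum_testPotential_pd_pd hn]
      ring]
    rw [integral_finsetSum _ fun i _ => integrable_finsetSum _ fun j _ => hint i i j j]
    refine Finset.sum_congr rfl fun i _ => ?_
    rw [integral_finsetSum _ fun j _ => hint i i j j]
  rw [← hsum]
  have h0 (i j : Fin n) :
      0 ≤ ∫ x, testPotential (ThresholdResonance.pd i (ThresholdResonance.pd j η)) x ^ 2 :=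
    integral_nonneg fun x => sq_nonneg _
  refine le_trans ?_ (Finset.single_le_sum (fun i _ => Finset.sum_nonneg fun j _ => h0 i j)
    (Finset.mem_univ i))
  exact Finset.single_le_sum (fun j _ => h0 i j) (Finset.mem_univ j)

lemma IsTest.memLp_two {η : Rn n → ℝ} (hη : IsTest η) : MemLp η 2 :=
  hη.continuous.memLp_of_hasCompactSupport hη.hasCompactSupport

lemma norm_toLp_eq_sqrt {f : Rn n → ℝ} (hf : MemLp f 2) :
    ‖hf.toLp f‖ = √(∫ x, f x ^ 2) := by
  rw [norm_eq_sqrt_real_inner, L2.inner_def]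
  congr 1
  refine integral_congr_ae ?_
  filter_upwards [hf.coeFn_toLp] with x hx
  rw [hx]
  simp [pow_two]

lemma norm_integral_smul_le {f : Rn n → ℝ} {g : Rn n → ℂ} (hf : MemLp f 2) (hg : MemLp g 2) :
    ‖∫ x, f x • g x‖ ≤ √(∫ x, f x ^ 2) * √(∫ x, ‖g x‖ ^ 2) := by
  have h := integral_mul_norm_le_Lp_mul_Lq (μ := (volume : Measure (Rn n))) (f := f)
    (g := fun x => ‖g x‖) (p := 2) (q := 2) Real.HolderConjugate.two_two
    (by simpa using hf) (by simpa using hg.norm)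
  simp only [norm_norm] at h
  refine (norm_integral_le_integral_norm _).trans ?_
  simp only [norm_smul]
  refine h.trans (le_of_eq ?_)
  rw [Real.sqrt_eq_rpow, Real.sqrt_eq_rpow]
  simp only [Real.rpow_ofNat, Real.norm_eq_abs, sq_abs]

/-- A real-linear functional on test functions bounded in the `L²` norm is given by an `L²`
function. -/
lemma exists_memLp_two_of_norm_le (T : TestFn n →ₗ[ℝ] ℂ) (B : ℝ)
    (hT : ∀ η : TestFn n, ‖T η‖ ≤ B * √(∫ x, η x ^ 2)) :
    ∃ k : Rn n → ℂ, MemLp k 2 ∧ ∀ η : TestFn n, T η = ∫ x, η x • k x := by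
  let ι : TestFn n →ₗ[ℝ] Lp ℝ 2 (volume : Measure (Rn n)) :=
    { toFun := fun η => (isTest_coe η).memLp_two.toLp _
      map_add' := fun _ _ => rfl
      map_smul' := fun _ _ => rfl }
  have hι (η : TestFn n) : ‖ι η‖ = √(∫ x, η x ^ 2) :=
    norm_toLp_eq_sqrt (isTest_coe η).memLp_two
  obtain ⟨k₁, hk₁⟩ := exists_inner_eq_of_abs_le ι (Complex.reLm ∘ₗ T) B fun η => by
    rw [hι]
    exact (Complex.abs_re_le_norm _).trans (hT η)
  obtain ⟨k₂, hk₂⟩ := exists_inner_eq_of_abs_le ι (Complex.imLm ∘ₗ T) B fun η => by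
    rw [hι]
    exact (Complex.abs_im_le_norm _).trans (hT η)
  have hpair (k : Lp ℝ 2 (volume : Measure (Rn n))) (η : TestFn n) :
      inner ℝ k (ι η) = ∫ x, η x * k x := by
    rw [L2.inner_def]
    refine integral_congr_ae ?_
    filter_upwards [(isTest_coe η).memLp_two.coeFn_toLp] with x hx
    rw [show (ι η) x = η x from hx]
    simp
  have hi (k : Lp ℝ 2 (volume : Measure (Rn n))) (η : TestFn n) :
      Integrable fun x => η x * k x :=
    (isTest_coe η).memLp_two.integrable_mul (Lp.memLp k)
  have hm1 : MemLp (fun x => ((k₁ x : ℝ) : ℂ)) 2 (volume : Measure (Rn n)) := (Lp.memLp k₁).ofReal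
  have hm2 : MemLp (fun x => ((k₂ x : ℝ) : ℂ)) 2 (volume : Measure (Rn n)) := (Lp.memLp k₂).ofReal
  refine ⟨fun x => (k₁ x : ℂ) + Complex.I * (k₂ x : ℂ), hm1.add (hm2.const_mul Complex.I),
    fun η => ?_⟩
  have e1 : (T η).re = ∫ x, η x * k₁ x := (hk₁ η).trans (hpair k₁ η)
  have e2 : (T η).im = ∫ x, η x * k₂ x := (hk₂ η).trans (hpair k₂ η)
  have e3 : ∫ x, η x • ((k₁ x : ℂ) + Complex.I * (k₂ x : ℂ)) =
      ∫ x, (((η x * k₁ x : ℝ) : ℂ) + Complex.I * ((η x * k₂ x : ℝ) : ℂ)) := by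
    refine integral_congr_ae (Eventually.of_forall fun x => ?_)
    simp only [Complex.real_smul]
    push_cast
    ring
  rw [e3, integral_add (hi k₁ η).ofReal ((hi k₂ η).ofReal.const_mul _), integral_const_mul,
    integral_complex_ofReal, integral_complex_ofReal, ← e1, ← e2, mul_comm, Complex.re_add_im]

lemma IsTest.memLp_testPotential_pd (hn : 3 ≤ n) {η : Rn n → ℝ} (hη : IsTest η) (i : Fin n) :
    MemLp (testPotential (ThresholdResonance.pd i η)) 2 := by
  rw [memLp_two_iff_integrable_sq
    ((hη.pd i).contDiff_testPotential hn).continuous.aestronglyMeasurable]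
  simpa only [pow_two] using integrable_testPotential_pd_mul hn hη hη i i

/-- The potential of a square integrable function has second derivatives in `L²`. -/
theorem exists_hasWeakPartial_gradPotential (hn : 3 ≤ n) {f : Rn n → ℂ} (hf2 : MemLp f 2)
    (hfi : Integrable fun y => jap (n - 2) y • f y) (i j : Fin n) :
    ∃ k : Rn n → ℂ, HasWeakPartial (gradPotential i f) k j ∧ MemLp k 2 := by
  have hf := hf2.aestronglyMeasurable
  have hw := hasWeakPartial_freeResolventZero hn hf hfi i
  have hg : LocallyIntegrable (gradPotential i f) := hw.2.1
  have hint (η : TestFn n) : Integrable fun x => pd j (η : Rn n → ℝ) x • gradPotential i f x :=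
    hg.integrable_smul_left_of_hasCompactSupport ((isTest_coe η).pd j).continuous
      ((isTest_coe η).pd j).hasCompactSupport
  have hdiff (η : TestFn n) : Differentiable ℝ (η : Rn n → ℝ) :=
    (isTest_coe η).contDiff.differentiable (by simp)
  let T : TestFn n →ₗ[ℝ] ℂ :=
    { toFun := fun η => ∫ x, pd j (η : Rn n → ℝ) x • gradPotential i f x
      map_add' := fun η θ => by
        rw [← integral_add (hint η) (hint θ)]
        refine integral_congr_ae (Eventually.of_forall fun x => ?_)
        have : pd j ((η + θ : TestFn n) : Rn n → ℝ) x =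
            pd j (η : Rn n → ℝ) x + pd j (θ : Rn n → ℝ) x := by
          have h1 : ((η + θ : TestFn n) : Rn n → ℝ) = fun x => η x + θ x := rfl
          rw [h1, pd, fderiv_fun_add (hdiff η x) (hdiff θ x)]
          rfl
        simp only [this, add_smul]
      map_smul' := fun c η => by
        rw [RingHom.id_apply, ← integral_smul]
        refine integral_congr_ae (Eventually.of_forall fun x => ?_)
        have : pd j ((c • η : TestFn n) : Rn n → ℝ) x = c * pd j (η : Rn n → ℝ) x := by
          have h1 : ((c • η : TestFn n) : Rn n → ℝ) = fun x => c * η x := rfl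
          rw [h1, pd, fderiv_const_mul (hdiff η x)]
          rfl
        simp only [this, mul_smul] }
  -- `T η` is the pairing of `f` with the second derivative `∂ᵢ∂ⱼ` of the potential of `η`
  obtain ⟨k, hk2, hk⟩ := exists_memLp_two_of_norm_le T (√(∫ x, ‖f x‖ ^ 2)) fun η => by
    have hη := isTest_coe η
    have hζ := hη.pd j
    have h1 := hw.2.2 ⟨pd j (η : Rn n → ℝ), hζ.contDiff, hζ.hasCompactSupport, by simp⟩
    have h2 : T η = -∫ x, testPotential (pd i (pd j (η : Rn n → ℝ))) x • f x := by
      rw [← integral_smul_freeResolventZero hn hf hfi (hζ.pd i)]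
      refine (neg_eq_iff_eq_neg.2 ?_).symm
      exact h1
    rw [h2, norm_neg, mul_comm]
    refine (norm_integral_smul_le (hζ.memLp_testPotential_pd hn i) hf2).trans ?_
    refine mul_le_mul_of_nonneg_right (Real.sqrt_le_sqrt ?_) (Real.sqrt_nonneg _)
    exact hη.integral_sq_testPotential_le hn i j
  refine ⟨fun x => -k x, ⟨hg, (hk2.neg.locallyIntegrable (by norm_num)), fun η => ?_⟩, hk2.neg⟩
  simp only [smul_neg, integral_neg, neg_neg]
  exact hk η

end SecondDerivatives

/-! ### The Birman-Schwinger kernel -/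

section BirmanSchwinger

variable {n : ℕ} {v : Rn n → ℝ} {C : ℝ}

lemma v₁_mul_v₂ (v : Rn n → ℝ) (x : Rn n) : v₁ v x * v₂ v x = v x := by
  unfold v₁ v₂
  rw [mul_left_comm, Real.mul_self_sqrt (abs_nonneg _)]
  split_ifs with h
  · rw [one_mul, abs_of_nonneg h]
  · rw [abs_of_neg (not_le.1 h)]; ring

lemma abs_v₂ (v : Rn n → ℝ) (x : Rn n) : |v₂ v x| = v₁ v x := by
  unfold v₁ v₂
  rw [abs_mul, abs_of_nonneg (Real.sqrt_nonneg _)]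
  split_ifs <;> simp

lemma v₁_nonneg (v : Rn n → ℝ) (x : Rn n) : 0 ≤ v₁ v x := Real.sqrt_nonneg _

lemma aestronglyMeasurable_v₁ (hvm : AEStronglyMeasurable v) : AEStronglyMeasurable (v₁ v) := by
  have h : Measurable fun t : ℝ => √|t| := by fun_prop
  exact (h.comp_aemeasurable hvm.aemeasurable).aestronglyMeasurable

lemma aestronglyMeasurable_v₂ (hvm : AEStronglyMeasurable v) : AEStronglyMeasurable (v₂ v) := by
  have h1 : Measurable fun t : ℝ => if 0 ≤ t then (1 : ℝ) else -1 :=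
    Measurable.ite measurableSet_Ici measurable_const measurable_const
  have h : Measurable fun t : ℝ => (if 0 ≤ t then (1 : ℝ) else -1) * √|t| :=
    h1.mul (by fun_prop)
  exact (h.comp_aemeasurable hvm.aemeasurable).aestronglyMeasurable

lemma ae_v₁_le (hC : 0 < C) (hv : ∀ᵐ x : Rn n, |v x| ≤ C * jap 4 x) :
    ∀ᵐ x : Rn n, v₁ v x ≤ √C * jap 2 x := by
  filter_upwards [hv] with x hx
  unfold v₁
  rw [← Real.sqrt_sq (jap_nonneg 2 x), ← Real.sqrt_mul hC.le, pow_two, ← jap_add]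
  exact Real.sqrt_le_sqrt hx

lemma integrable_jap_smul_v₁_smul (hn : 3 ≤ n) (hvm : AEStronglyMeasurable v) (hC : 0 < C)
    (hv : ∀ᵐ x : Rn n, |v x| ≤ C * jap 4 x) {φ : Rn n → ℂ} (hφ : MemLp φ 2) :
    Integrable fun y => jap (n - 2) y • (v₁ v y • φ y) := by
  have h := (integrable_jap_smul_of_memLp_two (n := n) (k := n) (by omega) hφ).norm.const_mul (√C)
  refine Integrable.mono' h ((continuous_jap _).aestronglyMeasurable.smul
    ((aestronglyMeasurable_v₁ hvm).smul hφ.aestronglyMeasurable)) ?_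
  filter_upwards [ae_v₁_le hC hv] with x hx
  have hj := jap_nonneg (n - 2) x
  have e : jap n x = jap (n - 2) x * jap 2 x := by rw [← jap_add]; congr 1; omega
  rw [norm_smul, norm_smul, norm_smul, Real.norm_of_nonneg hj, Real.norm_of_nonneg (v₁_nonneg v x),
    Real.norm_of_nonneg (jap_nonneg n x), e]
  calc jap (n - 2) x * (v₁ v x * ‖φ x‖) ≤ jap (n - 2) x * (√C * jap 2 x * ‖φ x‖) := by gcongr
    _ = _ := by ring

/-- Membership in the graph of the Birman-Schwinger operator: absolute convergence of the integral
is automatic on `L²`. -/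
lemma mem_graph_bsOperator_iff (hn : 3 ≤ n) (hvm : AEStronglyMeasurable v) (hC : 0 < C)
    (hv : ∀ᵐ x : Rn n, |v x| ≤ C * jap 4 x) (p : L2 n × L2 n) :
    p ∈ (bsOperator v).graph ↔
      p.2 =ᵐ[volume] fun x => v₂ v x • freeResolventZero (fun y => v₁ v y • p.1 y) x := by
  rw [LinearPMap.mem_graph_iff]
  constructor
  · rintro ⟨φ, h1, h2⟩
    rw [← h2, ← h1]
    exact MemLp.coeFn_toLp φ.2.2
  · intro h
    have hd : p.1 ∈ bsDomain v :=
      ⟨(isRieszBounded_g₀ hn).ae_integrable (by omega)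
        ((aestronglyMeasurable_v₁ hvm).smul (Lp.aestronglyMeasurable p.1))
        (integrable_jap_smul_v₁_smul hn hvm hC hv (Lp.memLp p.1)),
        (memLp_congr_ae h).1 (Lp.memLp p.2)⟩
    refine ⟨⟨p.1, hd⟩, rfl, ?_⟩
    refine Lp.ext ?_
    exact (MemLp.coeFn_toLp hd.2).trans h.symm

lemma exists_inner_eq_integral_smul {w : Rn n → ℝ} (hw : MemLp w 2) :
    ∃ k : L2 n, ∀ φ : L2 n, inner ℂ k φ = ∫ x, w x • φ x := by
  have hwc : MemLp (fun x => (w x : ℂ)) 2 (volume : Measure (Rn n)) := hw.ofReal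
  refine ⟨hwc.toLp _, fun φ => ?_⟩
  rw [L2.inner_def]
  refine integral_congr_ae ?_
  filter_upwards [hwc.coeFn_toLp] with x hx
  rw [hx]
  simp [mul_comm]

/-- The Birman-Schwinger operator on its natural domain is already closed: its graph is cut out by
continuous linear equations, one for each test function. -/
lemma isClosed_bsOperator (hn : 3 ≤ n) (hvm : AEStronglyMeasurable v) (hC : 0 < C)
    (hv : ∀ᵐ x : Rn n, |v x| ≤ C * jap 4 x) : (bsOperator v).IsClosed := by
  have hv2m := aestronglyMeasurable_v₂ hvm
  have hv1m := aestronglyMeasurable_v₁ hvm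
  have hG := isRieszBounded_g₀ hn
  have hv1 := ae_v₁_le hC hv
  have hζ (η : Rn n → ℝ) (hη : IsTest η) : ∃ M, ∀ᵐ x, |η x * v₂ v x| ≤ M * jap (n + 1) x := by
    obtain ⟨M, hM⟩ := hη.exists_abs_le_jap (n + 1)
    refine ⟨M * √C, ?_⟩
    filter_upwards [hv1] with x hx
    rw [abs_mul, abs_v₂]
    have hM0 : 0 ≤ M * jap (n + 1) x := (abs_nonneg _).trans (hM x)
    calc |η x| * v₁ v x ≤ (M * jap (n + 1) x) * (√C * 1) := by
          refine mul_le_mul (hM x) (hx.trans ?_) (v₁_nonneg v x) hM0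
          gcongr
          exact jap_le_one 2 x
      _ = _ := by ring
  -- the weight through which a test function sees the image of the operator
  have hrep (η : Rn n → ℝ) (hη : IsTest η) : ∃ w : Rn n → ℝ, MemLp w 2 ∧ ∀ φ : L2 n,
      ∫ x, η x • (v₂ v x • freeResolventZero (fun y => v₁ v y • φ y) x) =
        ∫ y, w y • φ y := by
    obtain ⟨M, hM⟩ := hζ η hη
    have hζm : AEStronglyMeasurable fun x => η x * v₂ v x :=
      hη.continuous.aestronglyMeasurable.mul hv2m
    obtain ⟨D, hD0, hD⟩ := hG.swap.exists_norm_integral_le (by omega)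
      (f := fun x => η x * v₂ v x) hM
    have hsm : AEStronglyMeasurable fun y => ∫ x, g₀ x y • (η x * v₂ v x) :=
      (AEStronglyMeasurable.smul hG.measurable.aestronglyMeasurable
        hζm.comp_fst).prod_swap.integral_prod_right'
    refine ⟨fun y => (∫ x, η x * v₂ v x * g₀ x y) * v₁ v y, ?_, fun φ => ?_⟩
    · have hj : MemLp (fun y : Rn n => D * √C * jap n y) 2 := by
        refine MemLp.const_mul (memLp_jap ?_ (by norm_num)) _
        have : 0 < n := by omega
        norm_cast
        omega
      refine hj.of_le ?_ ?_
      · refine AEStronglyMeasurable.mul ?_ hv1m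
        refine hsm.congr (Eventually.of_forall fun y => ?_)
        simp only [smul_eq_mul, mul_comm]
      · filter_upwards [hv1] with y hy
        have h1 := hD y
        simp only [smul_eq_mul] at h1
        have e : jap n y = jap (n - 2) y * jap 2 y := by rw [← jap_add]; congr 1; omega
        rw [norm_mul, Real.norm_of_nonneg (v₁_nonneg v y), Real.norm_of_nonneg
          (show 0 ≤ D * √C * jap n y from mul_nonneg (by positivity) (jap_nonneg n y)), e]
        have h2 : ‖∫ x, η x * v₂ v x * g₀ x y‖ ≤ D * jap (n - 2) y := by
          simpa only [mul_comm (g₀ _ _)] using h1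
        calc _ ≤ (D * jap (n - 2) y) * (√C * jap 2 y) :=
              mul_le_mul h2 hy (v₁_nonneg v y) (mul_nonneg hD0 (jap_nonneg _ _))
          _ = _ := by ring
    · have h := hG.integral_smul_integral (by omega)
        (hv1m.smul (Lp.aestronglyMeasurable φ))
        (integrable_jap_smul_v₁_smul hn hvm hC hv (Lp.memLp φ)) hζm hM
      simp only [mul_smul] at h ⊢
      exact h
  -- the graph consists of the pairs `(φ, χ)` for which `χ` and the image of `φ` agree when tested
  -- against every `η`
  have hset : ((bsOperator v).graph : Set (L2 n × L2 n)) =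
      ⋂ η : {η : Rn n → ℝ // IsTest η}, {p | ∫ x, η.1 x • p.2 x =
        ∫ x, η.1 x • (v₂ v x • freeResolventZero (fun y => v₁ v y • p.1 y) x)} := by
    ext p
    rw [SetLike.mem_coe, mem_graph_bsOperator_iff hn hvm hC hv, Set.mem_iInter]
    have hF : AEStronglyMeasurable fun y => v₁ v y • p.1 y :=
      hv1m.smul (Lp.aestronglyMeasurable p.1)
    have hFi := integrable_jap_smul_v₁_smul hn hvm hC hv (Lp.memLp p.1)
    constructor
    · intro h η
      refine integral_congr_ae ?_
      filter_upwards [h] with x hx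
      rw [hx]
    · intro h
      have hl2 : LocallyIntegrable p.2 := (Lp.memLp p.2).locallyIntegrable (by norm_num)
      have hb : ∀ᵐ x, ‖v₂ v x‖ ≤ √C := by
        filter_upwards [hv1] with x hx
        rw [Real.norm_eq_abs, abs_v₂]
        exact hx.trans (mul_le_of_le_one_right (Real.sqrt_nonneg C) (jap_le_one 2 x))
      have hl1 : LocallyIntegrable
          fun x => v₂ v x • freeResolventZero (fun y => v₁ v y • p.1 y) x := by
        refine locallyIntegrable_of_jap_smul (k := n + 1) ?_
        have h1 := (hG.integrable_jap_smul (by omega) hF hFi).bdd_smul (√C) hv2m hb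
        refine h1.congr (Eventually.of_forall fun x => ?_)
        change v₂ v x • (jap (n + 1) x • freeResolventZero (fun y => v₁ v y • p.1 y) x) =
          jap (n + 1) x • (v₂ v x • freeResolventZero (fun y => v₁ v y • p.1 y) x)
        exact smul_comm _ _ _
      have hz := ae_eq_zero_of_integral_contDiff_smul_eq_zero (hl2.sub hl1) fun η h1 h2 => by
        have hη : IsTest η := ⟨h1, h2⟩
        simp only [Pi.sub_apply, smul_sub]
        rw [integral_sub
          (hl2.integrable_smul_left_of_hasCompactSupport hη.continuous hη.hasCompactSupport)
          (hl1.integrable_smul_left_of_hasCompactSupport hη.continuous hη.hasCompactSupport),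
          sub_eq_zero]
        exact h ⟨η, hη⟩
      filter_upwards [hz] with x hx
      exact sub_eq_zero.1 hx
  rw [LinearPMap.IsClosed, hset]
  refine isClosed_iInter fun η => ?_
  obtain ⟨w, hw, hw'⟩ := hrep η.1 η.2
  obtain ⟨k₁, hk₁⟩ := exists_inner_eq_integral_smul η.2.memLp_two
  obtain ⟨k₂, hk₂⟩ := exists_inner_eq_integral_smul hw
  simp only [hw', ← hk₁, ← hk₂]
  exact isClosed_eq (by fun_prop) (by fun_prop)

/-- The Birman-Schwinger kernel consists of the `L²` solutions of `φ = -v₂ (h₀ + 0)⁻¹ v₁ φ`. -/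
theorem mem_bsKernel_iff (hn : 3 ≤ n) (hvm : AEStronglyMeasurable v) (hC : 0 < C)
    (hv : ∀ᵐ x : Rn n, |v x| ≤ C * jap 4 x) (φ : L2 n) :
    φ ∈ bsKernel v ↔
      φ =ᵐ[volume] fun x => -(v₂ v x • freeResolventZero (fun y => v₁ v y • φ y) x) := by
  have hc := isClosed_bsOperator hn hvm hC hv
  have hclos : (bsOperator v).closure = bsOperator v := by
    apply LinearPMap.eq_of_eq_graph
    rw [← hc.isClosable.graph_closure_eq_closure_graph]
    exact hc.submodule_topologicalClosure_eq
  have hgr : φ ∈ bsKernel v ↔ (φ, -φ) ∈ (bsOperator v).graph := by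
    rw [bsKernel, hclos, kerIdAdd, Submodule.mem_map, LinearPMap.mem_graph_iff]
    constructor
    · rintro ⟨x, hx, rfl⟩
      refine ⟨x, rfl, ?_⟩
      rw [LinearMap.mem_ker] at hx
      exact eq_neg_of_add_eq_zero_right hx
    · rintro ⟨x, hx, hx2⟩
      refine ⟨x, ?_, hx⟩
      rw [LinearMap.mem_ker]
      have : (x : L2 n) + bsOperator v x = 0 := by rw [hx2, hx]; exact add_neg_cancel φ
      exact this
  rw [hgr, mem_graph_bsOperator_iff hn hvm hC hv]
  have hneg := Lp.coeFn_neg φ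
  constructor
  · intro h
    filter_upwards [h, hneg] with x h1 h2
    rw [h2] at h1
    rw [← h1]
    simp
  · intro h
    filter_upwards [h, hneg] with x h1 h2
    rw [h2, Pi.neg_apply, neg_eq_iff_eq_neg]
    exact h1

/-- Functions in the Birman-Schwinger kernel are `O(⟨x⟩^{-n})`. -/
theorem exists_norm_le_jap_of_mem_bsKernel (hn : 3 ≤ n) (hvm : AEStronglyMeasurable v)
    (hC : 0 < C) (hv : ∀ᵐ x : Rn n, |v x| ≤ C * jap 4 x) {φ : L2 n} (hφ : φ ∈ bsKernel v) :
    ∃ B : ℝ, 0 ≤ B ∧ ∀ᵐ x, ‖φ x‖ ≤ B * jap n x := by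
  rw [mem_bsKernel_iff hn hvm hC hv] at hφ
  have hv1 := ae_v₁_le hC hv
  have hκ := greenConst_pos hn
  have hm : Measurable fun x => ‖φ x‖ₑ := (Lp.stronglyMeasurable φ).measurable.enorm
  have hfin : ∫⁻ x, ENNReal.ofReal (jap (n - 1) x) * ‖φ x‖ₑ ≠ ⊤ := by
    have h := (integrable_jap_smul_of_memLp_two (n := n) (k := n - 1) (by omega)
      (Lp.memLp φ)).hasFiniteIntegral
    refine ne_of_lt (lt_of_le_of_lt (lintegral_mono fun x => ?_) h)
    rw [enorm_smul, Real.enorm_eq_ofReal (jap_nonneg _ x)]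
  obtain ⟨B, hB0, hB⟩ := exists_le_jap_of_le_lintegral_riesz hn hm hfin
    (C := C * greenConst n) (by positivity) (by
      filter_upwards [hφ, hv1] with x hx hx1
      have hint : ∫⁻ y, ‖g₀ x y • (v₁ v y • φ y)‖ₑ ≤ ENNReal.ofReal (greenConst n * √C) *
          ∫⁻ y, ENNReal.ofReal (riesz (n - 2) (x - y)) * ENNReal.ofReal (jap 2 y) * ‖φ y‖ₑ := by
        rw [← lintegral_const_mul _ (by fun_prop)]
        refine lintegral_mono_ae ?_
        filter_upwards [hv1] with y hy
        rw [enorm_smul, enorm_smul, g₀_eq hn,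
          Real.enorm_eq_ofReal (mul_nonneg hκ.le (riesz_nonneg _ _)),
          Real.enorm_eq_ofReal (v₁_nonneg v y), ← mul_assoc, ← mul_assoc, ← mul_assoc,
          ← ENNReal.ofReal_mul (mul_nonneg hκ.le (riesz_nonneg _ _)),
          ← ENNReal.ofReal_mul (by positivity),
          ← ENNReal.ofReal_mul (mul_nonneg (by positivity) (riesz_nonneg _ _))]
        refine mul_le_mul_left (ENNReal.ofReal_le_ofReal ?_) _
        calc _ ≤ greenConst n * riesz (n - 2) (x - y) * (√C * jap 2 y) :=
              mul_le_mul_of_nonneg_left hy (mul_nonneg hκ.le (riesz_nonneg _ _))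
          _ = _ := by ring
      rw [hx, enorm_neg, enorm_smul]
      have h2 : ‖v₂ v x‖ₑ ≤ ENNReal.ofReal (√C * jap 2 x) := by
        rw [Real.enorm_eq_ofReal_abs, abs_v₂]
        exact ENNReal.ofReal_le_ofReal hx1
      calc _ ≤ ENNReal.ofReal (√C * jap 2 x) * (ENNReal.ofReal (greenConst n * √C) *
          ∫⁻ y, ENNReal.ofReal (riesz (n - 2) (x - y)) * ENNReal.ofReal (jap 2 y) * ‖φ y‖ₑ) :=
            mul_le_mul' h2 ((enorm_integral_le_lintegral_enorm _).trans hint)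
        _ = _ := by
          rw [← mul_assoc, ← ENNReal.ofReal_mul (mul_nonneg (Real.sqrt_nonneg _) (jap_nonneg _ _))]
          congr 2
          calc √C * jap 2 x * (greenConst n * √C) = (√C * √C) * greenConst n * jap 2 x := by ring
            _ = _ := by rw [Real.mul_self_sqrt hC.le])
  refine ⟨B, hB0, ?_⟩
  filter_upwards [hB] with x hx
  rw [← ofReal_norm] at hx
  exact (ENNReal.ofReal_le_ofReal_iff (mul_nonneg hB0 (jap_nonneg _ _))).1 hx

end BirmanSchwinger

/-! ### Newtonian potentials of sources with mean zero -/

section ZeroMean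

variable {n : ℕ}

/-- The subtracted Riesz kernel gains one power of decay in `x`, at the price of a factor `‖y‖`. -/
lemma abs_riesz_sub_sub_riesz_le (m : ℕ) {x y : Rn n} (hx : x ≠ 0) (hxy : x ≠ y) :
    |riesz m (x - y) - riesz m x| ≤
      ∑ i ∈ Finset.range m, riesz (i + 1) (x - y) * riesz (m - i) x * ‖y‖ := by
  have ha : 0 < ‖x - y‖ := norm_pos_iff.2 (sub_ne_zero.2 hxy)
  have hb : 0 < ‖x‖ := norm_pos_iff.2 hx
  have hab : |‖x - y‖⁻¹ - ‖x‖⁻¹| ≤ ‖y‖ * (‖x - y‖⁻¹ * ‖x‖⁻¹) := by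
    have e : ‖x - y‖⁻¹ - ‖x‖⁻¹ = (‖x‖ - ‖x - y‖) * (‖x - y‖⁻¹ * ‖x‖⁻¹) := by field_simp
    rw [e, abs_mul, abs_of_pos (show 0 < ‖x - y‖⁻¹ * ‖x‖⁻¹ by positivity)]
    gcongr
    calc |‖x‖ - ‖x - y‖| ≤ ‖x - (x - y)‖ := abs_norm_sub_norm_le _ _
      _ = ‖y‖ := by congr 1; abel
  simp only [riesz, ← inv_pow]
  rw [← geom_sum₂_mul, abs_mul, abs_of_nonneg (by positivity)]
  calc _ ≤ (∑ i ∈ Finset.range m, ‖x - y‖⁻¹ ^ i * ‖x‖⁻¹ ^ (m - 1 - i)) *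
        (‖y‖ * (‖x - y‖⁻¹ * ‖x‖⁻¹)) := by gcongr
    _ = _ := by
      rw [Finset.sum_mul]
      refine Finset.sum_congr rfl fun i hi => ?_
      have : m - i = m - 1 - i + 1 := by have := Finset.mem_range.1 hi; omega
      rw [this]
      ring

lemma riesz_le_jap_of_one_le_norm (k : ℕ) {x : Rn n} (hx : 1 ≤ ‖x‖) :
    riesz k x ≤ 2 ^ k * jap k x := by
  have hb : bracket x ≤ 2 * ‖x‖ := (bracket_le_one_add_norm x).trans (by linarith)
  have hp : 0 < ‖x‖ := by linarith
  have h := bracket_pos x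
  unfold riesz jap
  rw [← div_eq_mul_inv, inv_eq_one_div, div_le_div_iff₀ (by positivity) (by positivity), one_mul,
    ← mul_pow]
  gcongr

lemma jap_le_two_mul_jap_succ (k : ℕ) {x : Rn n} (hx : ‖x‖ ≤ 1) :
    jap k x ≤ 2 * jap (k + 1) x := by
  have hb : bracket x ≤ 2 := (bracket_le_one_add_norm x).trans (by linarith)
  have h := bracket_pos x
  have e : jap (k + 1) x = jap k x * (bracket x)⁻¹ := by
    unfold jap; rw [pow_succ, mul_inv]
  have h2 : 1 ≤ 2 * (bracket x)⁻¹ := by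
    rw [← div_eq_mul_inv, le_div_iff₀ h]; linarith
  rw [e]
  nlinarith [jap_nonneg k x]

lemma norm_le_jap_anti {j k : ℕ} (h : j ≤ k) {F : Type*} [NormedAddCommGroup F] {f : Rn n → F}
    {B : ℝ} (hB0 : 0 ≤ B) (hB : ∀ᵐ y, ‖f y‖ ≤ B * jap k y) :
    ∀ᵐ y, ‖f y‖ ≤ B * jap j y := by
  filter_upwards [hB] with y hy
  exact hy.trans (mul_le_mul_of_nonneg_left (jap_anti h y) hB0)

lemma memLp_of_norm_le_jap {k : ℕ} {q : ℝ≥0∞} (hq : (n : ℝ≥0∞) < k * q) (hq0 : 1 ≤ q)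
    {f : Rn n → ℂ} (hf : AEStronglyMeasurable f) {B : ℝ} (hB : ∀ᵐ y, ‖f y‖ ≤ B * jap k y) :
    MemLp f q := by
  refine ((memLp_jap hq hq0).const_mul B).of_le hf ?_
  filter_upwards [hB] with y hy
  exact hy.trans (le_abs_self _)

lemma integrable_of_norm_le_jap {k : ℕ} (hk : n < k)
    {f : Rn n → ℂ} (hf : AEStronglyMeasurable f) {B : ℝ} (hB : ∀ᵐ y, ‖f y‖ ≤ B * jap k y) :
    Integrable f :=
  memLp_one_iff_integrable.1
    (memLp_of_norm_le_jap (by rw [mul_one]; exact_mod_cast hk) le_rfl hf hB)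

/-- A source with vanishing mean has a Newtonian potential that decays one order faster. -/
theorem exists_norm_freeResolventZero_le_of_integral_eq_zero (hn : 3 ≤ n) {f : Rn n → ℂ}
    (hf : AEStronglyMeasurable f) {B : ℝ} (hB0 : 0 ≤ B) (hB : ∀ᵐ y, ‖f y‖ ≤ B * jap (n + 2) y)
    (h0 : ∫ y, f y = 0) :
    ∃ D : ℝ, 0 ≤ D ∧ ∀ x, ‖freeResolventZero f x‖ ≤ D * jap (n - 1) x := by
  have hκ := greenConst_pos hn
  have hB1 := norm_le_jap_anti (j := n + 1) (by omega) hB0 hB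
  have hfi := integrable_of_norm_le_jap (by omega) hf hB
  obtain ⟨D₀, hD₀0, hD₀⟩ := (isRieszBounded_g₀ hn).exists_norm_integral_le (by omega) hB1
  have hex (i : ℕ) : ∃ C : ℝ, 0 < C ∧ (i + 1 < n →
      ∀ x : Rn n, ∫ y, riesz (i + 1) (x - y) * jap (n + 1) y ≤ C * jap (i + 1) x) := by
    by_cases hi : i + 1 < n
    · obtain ⟨C, hC, h⟩ := exists_integral_riesz_mul_jap_le hi
      exact ⟨C, hC, fun _ => h⟩
    · exact ⟨1, one_pos, fun h => absurd h hi⟩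
  choose A hA0 hA using hex
  set S : ℝ := ∑ i ∈ Finset.range (n - 2), A i * 2 ^ (n - 2 - i) with hS
  have hS0 : 0 ≤ S := Finset.sum_nonneg fun i _ => mul_nonneg (hA0 i).le (by positivity)
  refine ⟨2 * D₀ + greenConst n * B * S, by positivity, fun x => ?_⟩
  have hj := jap_nonneg (n - 1) x
  -- in the unit ball the weights are comparable, and the bound without the mean zero condition
  -- suffices
  rcases le_total ‖x‖ 1 with hx | hx
  · have h1 := jap_le_two_mul_jap_succ (n - 2) hx
    rw [show n - 2 + 1 = n - 1 by omega] at h1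
    calc ‖freeResolventZero f x‖ ≤ D₀ * (2 * jap (n - 1) x) :=
          (hD₀ x).trans (mul_le_mul_of_nonneg_left h1 hD₀0)
      _ ≤ _ := by
        have : 0 ≤ greenConst n * B * S * jap (n - 1) x := by positivity
        linarith
  · have hx0 : x ≠ 0 := norm_pos_iff.1 (by linarith)
    have hint := (isRieszBounded_g₀ hn).integrable_of_le (by omega) hf hB1 x
    have e : freeResolventZero f x =
        ∫ y, (greenConst n * (riesz (n - 2) (x - y) - riesz (n - 2) x)) • f y := by
      have e1 : (fun y => (greenConst n * (riesz (n - 2) (x - y) - riesz (n - 2) x)) • f y) =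
          fun y => g₀ x y • f y - (greenConst n * riesz (n - 2) x) • f y := by
        funext y
        rw [g₀_eq hn, ← sub_smul, ← mul_sub]
      have hfi' : Integrable fun y => (greenConst n * riesz (n - 2) x) • f y :=
        hfi.smul (greenConst n * riesz (n - 2) x)
      rw [e1, integral_sub hint hfi', integral_smul, h0, smul_zero, sub_zero]
      rfl
    have hI (i : ℕ) (hi : i ∈ Finset.range (n - 2)) :
        Integrable fun y => riesz (i + 1) (x - y) * jap (n + 1) y * riesz (n - 2 - i) x :=
      (integrable_riesz_mul_jap (by have := Finset.mem_range.1 hi; omega) x).mul_const _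
    rw [e]
    have hae : ∀ᵐ y : Rn n, y ≠ x := by
      have : Nonempty (Fin n) := ⟨⟨0, by omega⟩⟩
      have : Nontrivial (Rn n) := inferInstance
      exact Measure.ae_ne volume x
    calc ‖∫ y, (greenConst n * (riesz (n - 2) (x - y) - riesz (n - 2) x)) • f y‖
        ≤ ∫ y, greenConst n * B * ∑ i ∈ Finset.range (n - 2),
            riesz (i + 1) (x - y) * jap (n + 1) y * riesz (n - 2 - i) x := by
          refine norm_integral_le_of_norm_le ((integrable_finsetSum _ hI).const_mul _) ?_
          filter_upwards [hB, hae] with y hy hyx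
          have h1 := abs_riesz_sub_sub_riesz_le (n - 2) hx0 hyx.symm
          have h2 : ‖y‖ * ‖f y‖ ≤ B * jap (n + 1) y :=
            calc ‖y‖ * ‖f y‖ ≤ ‖y‖ * (B * jap (n + 2) y) := by gcongr
              _ = B * (‖y‖ * jap (n + 1 + 1) y) := by ring
              _ ≤ _ := mul_le_mul_of_nonneg_left (norm_mul_jap_succ_le _ _) hB0
          rw [norm_smul, Real.norm_eq_abs, abs_mul, abs_of_pos hκ]
          calc _ ≤ greenConst n * (∑ i ∈ Finset.range (n - 2),
                riesz (i + 1) (x - y) * riesz (n - 2 - i) x * ‖y‖) * ‖f y‖ := by gcongr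
            _ = greenConst n * ∑ i ∈ Finset.range (n - 2),
                riesz (i + 1) (x - y) * riesz (n - 2 - i) x * (‖y‖ * ‖f y‖) := by
              rw [mul_assoc, Finset.sum_mul]
              simp only [mul_assoc]
            _ ≤ greenConst n * ∑ i ∈ Finset.range (n - 2),
                riesz (i + 1) (x - y) * riesz (n - 2 - i) x * (B * jap (n + 1) y) := by
              refine mul_le_mul_of_nonneg_left (Finset.sum_le_sum fun i _ => ?_) hκ.le
              exact mul_le_mul_of_nonneg_left h2 (mul_nonneg (riesz_nonneg _ _) (riesz_nonneg _ _))
            _ = _ := by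
              rw [mul_assoc, Finset.mul_sum (a := B)]
              congr 1
              exact Finset.sum_congr rfl fun i _ => by ring
      _ = greenConst n * B * ∑ i ∈ Finset.range (n - 2),
            (∫ y, riesz (i + 1) (x - y) * jap (n + 1) y) * riesz (n - 2 - i) x := by
          rw [integral_const_mul, integral_finsetSum _ hI]
          simp only [integral_mul_const]
      _ ≤ greenConst n * B * ∑ i ∈ Finset.range (n - 2),
            A i * 2 ^ (n - 2 - i) * jap (n - 1) x := by
          refine mul_le_mul_of_nonneg_left (Finset.sum_le_sum fun i hi => ?_) (by positivity)
          have hi' := Finset.mem_range.1 hi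
          have ej : jap (n - 1) x = jap (i + 1) x * jap (n - 2 - i) x := by
            rw [← jap_add]; congr 1; omega
          calc _ ≤ (A i * jap (i + 1) x) * (2 ^ (n - 2 - i) * jap (n - 2 - i) x) :=
                mul_le_mul (hA i (by omega) x) (riesz_le_jap_of_one_le_norm _ hx)
                  (riesz_nonneg _ _) (mul_nonneg (hA0 i).le (jap_nonneg _ _))
            _ = _ := by rw [ej]; ring
      _ = greenConst n * B * S * jap (n - 1) x := by rw [← Finset.sum_mul, hS]; ring
      _ ≤ _ := by
        have : 0 ≤ 2 * D₀ * jap (n - 1) x := by positivity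
        linarith

end ZeroMean

section AEEquality

variable {n : ℕ} {f f' g : Rn n → ℂ}

lemma HasWeakPartial.congr {j : Fin n} (h : HasWeakPartial f g j) (hf : f =ᵐ[volume] f') :
    HasWeakPartial f' g j := by
  refine ⟨h.1.congr hf, h.2.1, fun η => ?_⟩
  rw [← h.2.2 η]
  refine integral_congr_ae ?_
  filter_upwards [hf] with x hx
  rw [hx]

lemma HasWeakLaplacian.congr (h : HasWeakLaplacian f g) (hf : f =ᵐ[volume] f') :
    HasWeakLaplacian f' g := by
  refine ⟨h.1.congr hf, h.2.1, fun η => ?_⟩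
  rw [← h.2.2 η]
  refine integral_congr_ae ?_
  filter_upwards [hf] with x hx
  rw [hx]

end AEEquality

/-! ### Threshold states -/

section Potentials

variable {n : ℕ} {F ψ : Rn n → ℂ} {B : ℝ} {q : ℝ≥0∞}

lemma integrable_jap_smul_of_norm_le_jap (hF : AEStronglyMeasurable F)
    (hB : ∀ᵐ y, ‖F y‖ ≤ B * jap (n + 2) y) (k : ℕ) : Integrable fun y => jap k y • F y := by
  refine integrable_of_norm_le_jap (k := n + 2) (by omega)
    ((continuous_jap k).aestronglyMeasurable.smul hF) (B := B) ?_
  filter_upwards [hB] with y hy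
  rw [norm_smul, Real.norm_of_nonneg (jap_nonneg k y)]
  exact (mul_le_of_le_one_left (norm_nonneg _) (jap_le_one k y)).trans hy

lemma memLp_of_eq_freeResolventZero (hn : 3 ≤ n) (hF : AEStronglyMeasurable F) (hB0 : 0 ≤ B)
    (hB : ∀ᵐ y, ‖F y‖ ≤ B * jap (n + 2) y) (hψ : ψ =ᵐ[volume] freeResolventZero F)
    (hq : (n : ℝ≥0∞) < (n - 2 : ℕ) * q) (hq0 : 1 ≤ q) : MemLp ψ q := by
  obtain ⟨D, -, hD⟩ := (isRieszBounded_g₀ hn).exists_norm_integral_le (by omega)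
    (norm_le_jap_anti (j := n + 1) (by omega) hB0 hB)
  exact (memLp_congr_ae hψ).2 (memLp_of_norm_le_jap hq hq0
    (locallyIntegrable_freeResolventZero hn hF
      (integrable_jap_smul_of_norm_le_jap hF hB _)).aestronglyMeasurable
    (Eventually.of_forall hD))

lemma memLp_gradPotential (hn : 3 ≤ n) (hF : AEStronglyMeasurable F) (hB0 : 0 ≤ B)
    (hB : ∀ᵐ y, ‖F y‖ ≤ B * jap (n + 2) y)
    (hq : (n : ℝ≥0∞) < (n - 1 : ℕ) * q) (hq0 : 1 ≤ q) (i : Fin n) :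
    MemLp (gradPotential i F) q := by
  obtain ⟨D, -, hD⟩ := (isRieszBounded_gradG₀ hn i).exists_norm_integral_le (by omega)
    (norm_le_jap_anti (j := n + 1) (by omega) hB0 hB)
  exact memLp_of_norm_le_jap hq hq0
    (hasWeakPartial_freeResolventZero hn hF
      (integrable_jap_smul_of_norm_le_jap hF hB _) i).2.1.aestronglyMeasurable
    (Eventually.of_forall hD)

lemma gradientMemLp_of_eq_freeResolventZero (hn : 3 ≤ n) (hF : AEStronglyMeasurable F)
    (hB0 : 0 ≤ B) (hB : ∀ᵐ y, ‖F y‖ ≤ B * jap (n + 2) y)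
    (hψ : ψ =ᵐ[volume] freeResolventZero F)
    (hq : (n : ℝ≥0∞) < (n - 1 : ℕ) * q) (hq0 : 1 ≤ q) : GradientMemLp ψ q :=
  ⟨fun i => gradPotential i F, fun i =>
    ⟨(hasWeakPartial_freeResolventZero hn hF
      (integrable_jap_smul_of_norm_le_jap hF hB _) i).congr hψ.symm,
    memLp_gradPotential hn hF hB0 hB hq hq0 i⟩⟩

lemma memLp_of_norm_le_jap_add_two (hF : AEStronglyMeasurable F)
    (hB : ∀ᵐ y, ‖F y‖ ≤ B * jap (n + 2) y) (hq0 : 1 ≤ q) : MemLp F q := by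
  refine memLp_of_norm_le_jap ?_ hq0 hF hB
  calc (n : ℝ≥0∞) < (n + 2 : ℕ) := by norm_cast; omega
    _ = (n + 2 : ℕ) * 1 := (mul_one _).symm
    _ ≤ _ := by gcongr

lemma laplacianMemLp_of_eq_freeResolventZero (hn : 3 ≤ n) (hF : AEStronglyMeasurable F)
    (hB : ∀ᵐ y, ‖F y‖ ≤ B * jap (n + 2) y)
    (hψ : ψ =ᵐ[volume] freeResolventZero F) (hq0 : 1 ≤ q) : LaplacianMemLp ψ q :=
  ⟨-F, (hasWeakLaplacian_freeResolventZero hn hF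
      (integrable_jap_smul_of_norm_le_jap hF hB _)).congr hψ.symm,
    (memLp_of_norm_le_jap_add_two hF hB hq0).neg⟩

lemma memW22_of_eq_freeResolventZero (hn : 3 ≤ n) (hF : AEStronglyMeasurable F)
    (hB0 : 0 ≤ B) (hB : ∀ᵐ y, ‖F y‖ ≤ B * jap (n + 2) y)
    (hψ : ψ =ᵐ[volume] freeResolventZero F) (h2 : MemLp ψ 2) : MemW22 ψ := by
  have hfi := integrable_jap_smul_of_norm_le_jap hF hB (n - 2)
  choose k hk using exists_hasWeakPartial_gradPotential hn
    (memLp_of_norm_le_jap_add_two hF hB (by norm_num)) hfi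
  refine ⟨h2, fun i => gradPotential i F, k, fun i =>
    ⟨(hasWeakPartial_freeResolventZero hn hF hfi i).congr hψ.symm, ?_⟩, hk⟩
  refine memLp_gradPotential hn hF hB0 hB ?_ (by norm_num) i
  norm_cast
  omega

lemma isDistributionalSolution_of_eq_freeResolventZero {v : Rn n → ℝ} (hn : 3 ≤ n)
    (hF : AEStronglyMeasurable F) (hB : ∀ᵐ y, ‖F y‖ ≤ B * jap (n + 2) y)
    (hψ : ψ =ᵐ[volume] freeResolventZero F) (hv : F =ᵐ[volume] fun y => -(v y • ψ y)) :
    IsDistributionalSolution v ψ := by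
  have hL := (hasWeakLaplacian_freeResolventZero hn hF
    (integrable_jap_smul_of_norm_le_jap hF hB _)).congr hψ.symm
  refine ⟨hL.1, fun η => ?_⟩
  have hη := isTest_coe η
  have hΔ : IsTest (Laplacian.laplacian (η : Rn n → ℝ)) := by
    rw [show Laplacian.laplacian (η : Rn n → ℝ) = _ from funext hη.laplacian_eq]
    exact isTest_sum _ fun i _ => (hη.pd i).pd i
  have h1 : Integrable fun x => Laplacian.laplacian (η : Rn n → ℝ) x • ψ x :=
    hL.1.integrable_smul_left_of_hasCompactSupport hΔ.continuous hΔ.hasCompactSupport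
  have h2 : Integrable fun x => η x • (-F) x :=
    hL.2.1.integrable_smul_left_of_hasCompactSupport hη.continuous hη.hasCompactSupport
  have e : (fun x => (-(Laplacian.laplacian (η : Rn n → ℝ) x) + v x * η x) • ψ x) =ᵐ[volume]
      fun x => η x • (-F) x - Laplacian.laplacian (η : Rn n → ℝ) x • ψ x := by
    filter_upwards [hv] with x hx
    rw [Pi.neg_apply, hx, neg_neg, add_smul, neg_smul, mul_comm, mul_smul]
    abel
  rw [integral_congr_ae e, integral_sub h2 h1, hL.2.2 η, sub_self]

end Potentials

section ThresholdStates

variable {n : ℕ} {v : Rn n → ℝ} {C : ℝ} {φ χ : L2 n} {ψ ξ : Rn n → ℂ}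

/-- `ψ = -(h₀ + 0)⁻¹ v₁ φ` for an element `φ` of the Birman-Schwinger kernel. Both the zero-energy
eigenfunctions and the resonance functions are of this form. -/
structure IsThresholdState (v : Rn n → ℝ) (φ : L2 n) (ψ : Rn n → ℂ) : Prop where
  mem : φ ∈ bsKernel v
  ae_eq : ψ =ᵐ[volume] fun x => -freeResolventZero (fun y => v₁ v y • φ y) x

lemma freeResolventZero_neg (f : Rn n → ℂ) (x : Rn n) :
    freeResolventZero (fun y => -f y) x = -freeResolventZero f x := by
  simp only [freeResolventZero, smul_neg, integral_neg]

lemma IsThresholdState.eq_v₂_smul (hn : 3 ≤ n) (hvm : AEStronglyMeasurable v)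
    (hC : 0 < C) (hv : ∀ᵐ x : Rn n, |v x| ≤ C * jap 4 x) (h : IsThresholdState v φ ψ) :
    φ =ᵐ[volume] fun x => v₂ v x • ψ x := by
  filter_upwards [(mem_bsKernel_iff hn hvm hC hv φ).1 h.mem, h.ae_eq] with x h1 h2
  rw [h1, h2, smul_neg]

lemma aestronglyMeasurable_v₁_smul (hvm : AEStronglyMeasurable v) (φ : L2 n) :
    AEStronglyMeasurable fun y => v₁ v y • φ y :=
  (aestronglyMeasurable_v₁ hvm).smul (Lp.aestronglyMeasurable φ)

lemma exists_norm_v₁_smul_le (hn : 3 ≤ n) (hvm : AEStronglyMeasurable v)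
    (hC : 0 < C) (hv : ∀ᵐ x : Rn n, |v x| ≤ C * jap 4 x) (hφ : φ ∈ bsKernel v) :
    ∃ B : ℝ, 0 ≤ B ∧ ∀ᵐ y, ‖v₁ v y • φ y‖ ≤ B * jap (n + 2) y := by
  obtain ⟨B, hB0, hB⟩ := exists_norm_le_jap_of_mem_bsKernel hn hvm hC hv hφ
  refine ⟨√C * B, by positivity, ?_⟩
  filter_upwards [hB, ae_v₁_le hC hv] with y h1 h2
  rw [norm_smul, Real.norm_of_nonneg (v₁_nonneg v y)]
  calc _ ≤ (√C * jap 2 y) * (B * jap n y) :=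
        mul_le_mul h2 h1 (norm_nonneg _) (mul_nonneg (Real.sqrt_nonneg _) (jap_nonneg _ _))
    _ = _ := by rw [jap_add]; ring

/-- A threshold state is the Newtonian potential of a source `F = -vψ = O(⟨x⟩^{-n-2})`. -/
lemma IsThresholdState.exists_source (hn : 3 ≤ n) (hvm : AEStronglyMeasurable v)
    (hC : 0 < C) (hv : ∀ᵐ x : Rn n, |v x| ≤ C * jap 4 x) (h : IsThresholdState v φ ψ) :
    ∃ (F : Rn n → ℂ) (B : ℝ), AEStronglyMeasurable F ∧ 0 ≤ B ∧
      (∀ᵐ y, ‖F y‖ ≤ B * jap (n + 2) y) ∧ ψ =ᵐ[volume] freeResolventZero F ∧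
      (F =ᵐ[volume] fun y => -(v y • ψ y)) ∧ F = fun y => -(v₁ v y • φ y) := by
  obtain ⟨B, hB0, hB⟩ := exists_norm_v₁_smul_le hn hvm hC hv h.mem
  refine ⟨fun y => -(v₁ v y • φ y), B, (aestronglyMeasurable_v₁_smul hvm φ).neg, hB0, ?_, ?_, ?_,
    rfl⟩
  · simpa only [norm_neg] using hB
  · filter_upwards [h.ae_eq] with x hx
    rw [hx, freeResolventZero_neg]
  · filter_upwards [h.eq_v₂_smul hn hvm hC hv] with y hy
    rw [hy, smul_smul, v₁_mul_v₂]

lemma IsThresholdState.eq_zero_iff (hn : 3 ≤ n) (hvm : AEStronglyMeasurable v)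
    (hC : 0 < C) (hv : ∀ᵐ x : Rn n, |v x| ≤ C * jap 4 x) (h : IsThresholdState v φ ψ) :
    φ = 0 ↔ ψ =ᵐ[volume] 0 := by
  constructor
  · rintro rfl
    have h0 : ∀ᵐ y : Rn n, (0 : L2 n) y = 0 := Lp.coeFn_zero ℂ 2 volume
    filter_upwards [h.ae_eq] with x hx
    rw [hx, freeResolventZero, integral_eq_zero_of_ae]
    · simp
    · filter_upwards [h0] with y hy
      rw [hy, smul_zero, smul_zero, Pi.zero_apply]
  · intro h0
    rw [Lp.eq_zero_iff_ae_eq_zero]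
    filter_upwards [h0, h.eq_v₂_smul hn hvm hC hv] with x hx hx'
    rw [hx', hx, Pi.zero_apply, smul_zero]

lemma IsThresholdState.isDistributionalSolution (hn : 3 ≤ n) (hvm : AEStronglyMeasurable v)
    (hC : 0 < C) (hv : ∀ᵐ x : Rn n, |v x| ≤ C * jap 4 x) (h : IsThresholdState v φ ψ) :
    IsDistributionalSolution v ψ := by
  obtain ⟨F, B, hF, -, hB, hψ, hFv, -⟩ := h.exists_source hn hvm hC hv
  exact isDistributionalSolution_of_eq_freeResolventZero hn hF hB hψ hFv

/-- A nonzero square integrable threshold state is an eigenfunction. -/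
lemma IsThresholdState.isEigenfunction (hn : 3 ≤ n) (hvm : AEStronglyMeasurable v)
    (hC : 0 < C) (hv : ∀ᵐ x : Rn n, |v x| ≤ C * jap 4 x) (h : IsThresholdState v φ ψ)
    (hφ : φ ≠ 0) (h2 : MemLp ψ 2) : IsEigenfunction v ψ := by
  obtain ⟨F, B, hF, hB0, hB, hψ, -, -⟩ := h.exists_source hn hvm hC hv
  exact ⟨memW22_of_eq_freeResolventZero hn hF hB0 hB hψ h2,
    fun h0 => hφ ((h.eq_zero_iff hn hvm hC hv).2 h0),
    h.isDistributionalSolution hn hvm hC hv⟩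

/-- A threshold state that is not square integrable is a resonance function. -/
lemma IsThresholdState.isResonanceFunction (hn : 3 ≤ n) (hvm : AEStronglyMeasurable v)
    (hC : 0 < C) (hv : ∀ᵐ x : Rn n, |v x| ≤ C * jap 4 x) (h : IsThresholdState v φ ψ)
    (h2 : ¬ MemLp ψ 2) : IsResonanceFunction v ψ := by
  refine ⟨⟨φ, h.mem, fun h0 => h2 ?_, h.ae_eq⟩, h.isDistributionalSolution hn hvm hC hv, h2⟩
  exact (memLp_congr_ae ((h.eq_zero_iff hn hvm hC hv).1 h0)).2 MemLp.zero

/-- Every eigenfunction is a threshold state, with `φ = v₂ ψ`. -/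
lemma IsEigenfunction.exists_isThresholdState (hn : 3 ≤ n) (hvm : AEStronglyMeasurable v)
    (hC : 0 < C) (hv : ∀ᵐ x : Rn n, |v x| ≤ C * jap 4 x) (h : IsEigenfunction v ψ) :
    ∃ φ : L2 n, φ ≠ 0 ∧ IsThresholdState v φ ψ := by
  have hψ2 := h.1.1
  have he := h.2.2.eq_neg_freeResolventZero hn hvm hC hv hψ2
  have hφ2 : MemLp (fun x => v₂ v x • ψ x) 2 := by
    refine (hψ2.const_smul (√C)).of_le
      ((aestronglyMeasurable_v₂ hvm).smul hψ2.aestronglyMeasurable) ?_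
    filter_upwards [ae_v₁_le hC hv] with x hx
    rw [Pi.smul_apply, norm_smul, norm_smul, Real.norm_eq_abs, abs_v₂,
      Real.norm_of_nonneg (Real.sqrt_nonneg C)]
    exact mul_le_mul_of_nonneg_right
      (hx.trans (mul_le_of_le_one_right (Real.sqrt_nonneg C) (jap_le_one 2 x))) (norm_nonneg _)
  have hφ := hφ2.coeFn_toLp
  set φ : L2 n := hφ2.toLp _
  have hs : ∀ᵐ y : Rn n, v₁ v y • φ y = v y • ψ y := by
    filter_upwards [hφ] with y hy
    rw [hy, smul_smul, v₁_mul_v₂]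
  have hr (x : Rn n) : freeResolventZero (fun y => v₁ v y • φ y) x =
      freeResolventZero (fun y => v y • ψ y) x := by
    refine integral_congr_ae ?_
    filter_upwards [hs] with y hy
    rw [hy]
  have hst : IsThresholdState v φ ψ := by
    refine ⟨(mem_bsKernel_iff hn hvm hC hv φ).2 ?_, ?_⟩
    · filter_upwards [hφ, he] with x h1 h2
      rw [h1, hr, ← smul_neg, ← h2]
    · filter_upwards [he] with x hx
      rw [hr, ← hx]
  exact ⟨φ, fun h0 => h.2.1 ((hst.eq_zero_iff hn hvm hC hv).1 h0), hst⟩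

lemma IsResonanceFunction.exists_isThresholdState (h : IsResonanceFunction v ψ) :
    ∃ φ : L2 n, φ ≠ 0 ∧ IsThresholdState v φ ψ := by
  obtain ⟨⟨φ, h1, h2, h3⟩, -⟩ := h
  exact ⟨φ, h2, h1, h3⟩

lemma integrable_g₀_smul_v₁_smul (hn : 3 ≤ n) (hvm : AEStronglyMeasurable v)
    (hC : 0 < C) (hv : ∀ᵐ x : Rn n, |v x| ≤ C * jap 4 x) (hφ : φ ∈ bsKernel v) (x : Rn n) :
    Integrable fun y => g₀ x y • (v₁ v y • φ y) := by
  obtain ⟨B, hB0, hB⟩ := exists_norm_v₁_smul_le hn hvm hC hv hφ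
  exact (isRieszBounded_g₀ hn).integrable_of_le (by omega) (aestronglyMeasurable_v₁_smul hvm φ)
    (norm_le_jap_anti (by omega) hB0 hB) x

lemma integrable_v₁_smul (hn : 3 ≤ n) (hvm : AEStronglyMeasurable v)
    (hC : 0 < C) (hv : ∀ᵐ x : Rn n, |v x| ≤ C * jap 4 x) (hφ : φ ∈ bsKernel v) :
    Integrable fun y => v₁ v y • φ y := by
  obtain ⟨B, hB0, hB⟩ := exists_norm_v₁_smul_le hn hvm hC hv hφ
  exact integrable_of_norm_le_jap (by omega) (aestronglyMeasurable_v₁_smul hvm φ) hB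

lemma ae_v₁_smul_sub_smul (v : Rn n → ℝ) (φ χ : L2 n) (c : ℂ) :
    ∀ᵐ y, v₁ v y • (φ - c • χ : L2 n) y = v₁ v y • φ y - c * (v₁ v y • χ y) := by
  filter_upwards [Lp.coeFn_sub φ (c • χ), Lp.coeFn_smul c χ] with y h1 h2
  rw [h1, Pi.sub_apply, h2, Pi.smul_apply, smul_sub, smul_eq_mul, mul_smul_comm]

lemma IsThresholdState.sub_const_mul (hn : 3 ≤ n) (hvm : AEStronglyMeasurable v)
    (hC : 0 < C) (hv : ∀ᵐ x : Rn n, |v x| ≤ C * jap 4 x) (h : IsThresholdState v φ ψ)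
    (h' : IsThresholdState v χ ξ) (c : ℂ) :
    IsThresholdState v (φ - c • χ) fun x => ψ x - c * ξ x := by
  refine ⟨(bsKernel v).sub_mem h.mem ((bsKernel v).smul_mem c h'.mem), ?_⟩
  filter_upwards [h.ae_eq, h'.ae_eq] with x h1 h2
  have i1 := integrable_g₀_smul_v₁_smul hn hvm hC hv h.mem x
  have i2 := integrable_g₀_smul_v₁_smul hn hvm hC hv h'.mem x
  have e : freeResolventZero (fun y => v₁ v y • (φ - c • χ : L2 n) y) x =
      freeResolventZero (fun y => v₁ v y • φ y) x -
        c * freeResolventZero (fun y => v₁ v y • χ y) x := by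
    simp only [freeResolventZero]
    rw [← integral_const_mul, ← integral_sub i1 (i2.const_mul c)]
    refine integral_congr_ae ?_
    filter_upwards [ae_v₁_smul_sub_smul v φ χ c] with y hy
    simp only [hy, smul_sub, Complex.real_smul]
    ring
  rw [h1, h2, e]
  ring

/-- The source of a threshold state that is not square integrable has a nonzero mean. -/
lemma IsThresholdState.memLp_two_of_integral_eq_zero (hn : 3 ≤ n) (hvm : AEStronglyMeasurable v)
    (hC : 0 < C) (hv : ∀ᵐ x : Rn n, |v x| ≤ C * jap 4 x) (h : IsThresholdState v φ ψ)
    (h0 : ∫ y, v₁ v y • φ y = 0) : MemLp ψ 2 := by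
  obtain ⟨F, B, hF, hB0, hB, hψ, -, hFe⟩ := h.exists_source hn hvm hC hv
  have hF0 : ∫ y, F y = 0 := by rw [hFe, integral_neg, h0, neg_zero]
  obtain ⟨D, -, hD⟩ := exists_norm_freeResolventZero_le_of_integral_eq_zero hn hF hB0 hB hF0
  refine (memLp_congr_ae hψ).2 (memLp_of_norm_le_jap (k := n - 1) ?_ (by norm_num)
    (locallyIntegrable_freeResolventZero hn hF
      (integrable_jap_smul_of_norm_le_jap hF hB _)).aestronglyMeasurable
    (Eventually.of_forall hD))
  norm_cast
  omega

lemma IsThresholdState.memLp (hn : 3 ≤ n) (hvm : AEStronglyMeasurable v)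
    (hC : 0 < C) (hv : ∀ᵐ x : Rn n, |v x| ≤ C * jap 4 x) (h : IsThresholdState v φ ψ)
    {q : ℝ≥0∞} (hq : (n : ℝ≥0∞) < (n - 2 : ℕ) * q) (hq0 : 1 ≤ q) : MemLp ψ q := by
  obtain ⟨F, B, hF, hB0, hB, hψ, -⟩ := h.exists_source hn hvm hC hv
  exact memLp_of_eq_freeResolventZero hn hF hB0 hB hψ hq hq0

lemma IsThresholdState.gradientMemLp (hn : 3 ≤ n) (hvm : AEStronglyMeasurable v)
    (hC : 0 < C) (hv : ∀ᵐ x : Rn n, |v x| ≤ C * jap 4 x) (h : IsThresholdState v φ ψ)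
    {q : ℝ≥0∞} (hq : (n : ℝ≥0∞) < (n - 1 : ℕ) * q) (hq0 : 1 ≤ q) : GradientMemLp ψ q := by
  obtain ⟨F, B, hF, hB0, hB, hψ, -⟩ := h.exists_source hn hvm hC hv
  exact gradientMemLp_of_eq_freeResolventZero hn hF hB0 hB hψ hq hq0

lemma IsThresholdState.laplacianMemLp (hn : 3 ≤ n) (hvm : AEStronglyMeasurable v)
    (hC : 0 < C) (hv : ∀ᵐ x : Rn n, |v x| ≤ C * jap 4 x) (h : IsThresholdState v φ ψ)
    {q : ℝ≥0∞} (hq0 : 1 ≤ q) : LaplacianMemLp ψ q := by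
  obtain ⟨F, B, hF, -, hB, hψ, -⟩ := h.exists_source hn hvm hC hv
  exact laplacianMemLp_of_eq_freeResolventZero hn hF hB hψ hq0

/-- Without a zero-energy eigenvalue the resonance function is unique up to constant multiples: two
resonance functions have a combination whose source has mean zero, hence which is square
integrable, and which vanishes because it cannot be an eigenfunction. -/
theorem IsResonanceFunction.exists_eq_const_mul (hn : 3 ≤ n) (hvm : AEStronglyMeasurable v)
    (hC : 0 < C) (hv : ∀ᵐ x : Rn n, |v x| ≤ C * jap 4 x) (he : ¬ IsZeroEigenvalue v)
    (h : IsResonanceFunction v ψ) (h' : IsResonanceFunction v ξ) :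
    ∃ c : ℂ, ψ =ᵐ[volume] fun x => c * ξ x := by
  obtain ⟨φ, -, hs⟩ := h.exists_isThresholdState
  obtain ⟨χ, -, hs'⟩ := h'.exists_isThresholdState
  have hm : ∫ y, v₁ v y • χ y ≠ 0 := fun h0 =>
    h'.2.2 (hs'.memLp_two_of_integral_eq_zero hn hvm hC hv h0)
  set c : ℂ := (∫ y, v₁ v y • φ y) / ∫ y, v₁ v y • χ y with hc
  have hd := hs.sub_const_mul hn hvm hC hv hs' c
  have h0 : ∫ y, v₁ v y • (φ - c • χ : L2 n) y = 0 := by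
    rw [integral_congr_ae (ae_v₁_smul_sub_smul v φ χ c),
      integral_sub (integrable_v₁_smul hn hvm hC hv hs.mem)
        ((integrable_v₁_smul hn hvm hC hv hs'.mem).const_mul c), integral_const_mul, hc,
      div_mul_cancel₀ _ hm, sub_self]
  have hz : φ - c • χ = 0 := by
    by_contra hne
    exact he ⟨_, hd.isEigenfunction hn hvm hC hv hne
      (hd.memLp_two_of_integral_eq_zero hn hvm hC hv h0)⟩
  refine ⟨c, ?_⟩
  filter_upwards [(hd.eq_zero_iff hn hvm hC hv).1 hz] with x hx
  exact sub_eq_zero.1 hx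

/-- A nonzero element of the Birman-Schwinger kernel gives an eigenfunction or a resonance function,
and every such function comes from the kernel. -/
theorem isRegularPoint_iff (hn : 3 ≤ n) (hvm : AEStronglyMeasurable v)
    (hC : 0 < C) (hv : ∀ᵐ x : Rn n, |v x| ≤ C * jap 4 x) :
    IsRegularPoint v ↔ bsKernel v = ⊥ := by
  constructor
  · rintro ⟨h1, h2⟩
    rw [Submodule.eq_bot_iff]
    intro φ hφ
    by_contra hne
    have hs : IsThresholdState v φ _ := ⟨hφ, EventuallyEq.rfl⟩
    by_cases hL : MemLp (fun x => -freeResolventZero (fun y => v₁ v y • φ y) x) 2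
    · exact h1 ⟨_, hs.isEigenfunction hn hvm hC hv hne hL⟩
    · exact h2 ⟨_, hs.isResonanceFunction hn hvm hC hv hL⟩
  · intro hb
    constructor
    · rintro ⟨ψ, h⟩
      obtain ⟨φ, h0, hs⟩ := h.exists_isThresholdState hn hvm hC hv
      exact h0 ((Submodule.eq_bot_iff _).1 hb φ hs.mem)
    · rintro ⟨ψ, h⟩
      obtain ⟨φ, h0, hs⟩ := h.exists_isThresholdState
      exact h0 ((Submodule.eq_bot_iff _).1 hb φ hs.mem)

end ThresholdStates

/-! ### Exponents -/

section Exponents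

/-- Interpolation between `L²` and `L^∞`. -/
lemma memLp_of_memLp_two_of_memLp_top {α E : Type*} [MeasurableSpace α] {μ : Measure α}
    [NormedAddCommGroup E] {f : α → E} (h2 : MemLp f 2 μ) (ht : MemLp f ⊤ μ) {q : ℝ≥0∞}
    (hq : 2 ≤ q) : MemLp f q μ := by
  rcases eq_or_ne q ⊤ with rfl | hqt
  · exact ht
  have hq0 : q ≠ 0 := (lt_of_lt_of_le (by norm_num) hq).ne'
  have hq2 : 2 ≤ q.toReal := by
    simpa using ENNReal.toReal_mono hqt hq
  set M : ℝ := (eLpNormEssSup f μ).toReal with hM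
  have hb : ∀ᵐ x ∂μ, ‖f x‖ ≤ M := by
    filter_upwards [enorm_ae_le_eLpNormEssSup f μ] with x hx
    have hlt : eLpNormEssSup f μ ≠ ⊤ := by
      simpa only [eLpNorm_exponent_top] using ht.eLpNorm_ne_top
    simpa using ENNReal.toReal_mono hlt hx
  rw [← integrable_norm_rpow_iff h2.1 hq0 hqt]
  have h := ((integrable_norm_rpow_iff h2.1 (by norm_num) (by norm_num)).2 h2).const_mul
    (M ^ (q.toReal - 2))
  refine h.mono' (h2.1.norm.aemeasurable.pow_const _).aestronglyMeasurable ?_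
  filter_upwards [hb] with x hx
  have hx0 := norm_nonneg (f x)
  rw [Real.norm_of_nonneg (Real.rpow_nonneg hx0 _), ENNReal.toReal_ofNat]
  calc ‖f x‖ ^ q.toReal = ‖f x‖ ^ ((q.toReal - 2) + 2) := by ring_nf
    _ = ‖f x‖ ^ (q.toReal - 2) * ‖f x‖ ^ (2 : ℝ) :=
      Real.rpow_add_of_nonneg hx0 (by linarith) (by norm_num)
    _ ≤ _ := by
      refine mul_le_mul_of_nonneg_right ?_ (Real.rpow_nonneg hx0 _)
      exact Real.rpow_le_rpow hx0 hx (by linarith)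

lemma natCast_lt_mul_of_ofReal_lt {n k : ℕ} (hk : k ≠ 0) {a : ℝ} (h : (n : ℝ) ≤ k * a) {q : ℝ≥0∞}
    (hq : ENNReal.ofReal a < q) : (n : ℝ≥0∞) < k * q := by
  have hk0 : (k : ℝ≥0∞) ≠ 0 := by exact_mod_cast hk
  calc (n : ℝ≥0∞) = ENNReal.ofReal n := (ENNReal.ofReal_natCast n).symm
    _ ≤ ENNReal.ofReal (k * a) := ENNReal.ofReal_le_ofReal h
    _ = k * ENNReal.ofReal a := by rw [ENNReal.ofReal_mul (by positivity), ENNReal.ofReal_natCast]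
    _ < k * q := (ENNReal.mul_lt_mul_iff_right hk0 (ENNReal.natCast_ne_top k)).2 hq

lemma one_le_of_ofReal_lt {a : ℝ} (h : 1 ≤ a) {q : ℝ≥0∞} (hq : ENNReal.ofReal a < q) : 1 ≤ q :=
  (by simpa using ENNReal.ofReal_le_ofReal h : (1 : ℝ≥0∞) ≤ ENNReal.ofReal a).trans hq.le

end Exponents

end ThresholdResonance

/-! ### Classification of the threshold behaviour -/

theorem theorem3p2 (n : ℕ) (hn : 3 ≤ n) (v : Rn n → ℝ) (hv : MemLp v ⊤ volume)
    (C : ℝ) (hC : 0 < C) (hdecay : ∀ᵐ x : Rn n, |v x| ≤ C * bracket x ^ (-4 : ℤ)) :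
    -- dimensions three and four
    ((n = 3 ∨ n = 4) →
      (∃! c : ThresholdCase, ThresholdCase.Holds v c) ∧
      (ThresholdCase.Holds v .II →
        ∃ ψ₀, IsResonanceFunction v ψ₀ ∧
          ∀ ψ, IsResonanceFunction v ψ → ∃ c : ℂ, ψ =ᵐ[volume] fun x => c * ψ₀ x) ∧
      (∀ ψ, IsResonanceFunction v ψ →
        (n = 3 → ∀ q : ℝ≥0∞, 3 < q → MemLp ψ q volume) ∧
        (n = 4 → ∀ q : ℝ≥0∞, 2 < q → MemLp ψ q volume) ∧
        GradientMemLp ψ 2 ∧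
        (∀ q : ℝ≥0∞, 2 ≤ q → LaplacianMemLp ψ q) ∧
        ¬ MemLp ψ 2 volume) ∧
      (∀ ψ, IsEigenfunction v ψ →
        (∀ q : ℝ≥0∞, 2 ≤ q → MemLp ψ q volume ∧ LaplacianMemLp ψ q) ∧
        GradientMemLp ψ 2)) ∧
    -- dimensions five and higher
    (5 ≤ n →
      Xor (IsRegularPoint v) (IsZeroEigenvalue v) ∧
      ¬ IsZeroResonance v ∧
      (∀ ψ, IsEigenfunction v ψ →
        (n ≤ 7 → ∀ q : ℝ≥0∞, ENNReal.ofReal ((n : ℝ) / ((n : ℝ) - 2)) < q →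
          MemLp ψ q volume ∧ LaplacianMemLp ψ q) ∧
        (8 ≤ n → ∀ q : ℝ≥0∞, ENNReal.ofReal (2 * (n : ℝ) / ((n : ℝ) + 4)) < q →
          q < ENNReal.ofReal (2 * (n : ℝ) / ((n : ℝ) - 4)) →
          MemLp ψ q volume ∧ LaplacianMemLp ψ q) ∧
        (n = 5 → ∀ q : ℝ≥0∞, 5 / 3 < q → q < ⊤ → GradientMemLp ψ q) ∧
        (n = 6 → ∀ q : ℝ≥0∞, 3 / 2 < q → q < ⊤ → GradientMemLp ψ q) ∧
        (n = 7 → ∀ q : ℝ≥0∞, 7 / 5 < q → q < 14 → GradientMemLp ψ q) ∧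
        (8 ≤ n → ∀ q : ℝ≥0∞, ENNReal.ofReal (2 * (n : ℝ) / ((n : ℝ) + 4)) < q →
          q < ENNReal.ofReal (2 * (n : ℝ) / ((n : ℝ) - 6)) → GradientMemLp ψ q))) ∧
    -- characterization of regularity
    (IsRegularPoint v ↔ bsKernel v = ⊥) := by
  have hvm := hv.aestronglyMeasurable
  have hj := ae_abs_le_jap_four hdecay
  have hstate {ψ : Rn n → ℂ} (h : IsEigenfunction v ψ) : ∃ φ, IsThresholdState v φ ψ := by
    obtain ⟨φ, -, h⟩ := h.exists_isThresholdState hn hvm hC hj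
    exact ⟨φ, h⟩
  have hn3 : (3 : ℝ) ≤ n := by exact_mod_cast hn
  have c2 : ((n - 2 : ℕ) : ℝ) = n - 2 := by rw [Nat.cast_sub (by omega)]; norm_num
  have c1 : ((n - 1 : ℕ) : ℝ) = n - 1 := by rw [Nat.cast_sub (by omega)]; norm_num
  have hgrad2 {φ : L2 n} {ψ : Rn n → ℂ} (h : IsThresholdState v φ ψ) : GradientMemLp ψ 2 := by
    refine h.gradientMemLp hn hvm hC hj ?_ (by norm_num)
    norm_cast
    omega
  -- exponents above `a ≥ 1` are admissible for the gradient as soon as `n / (n - 1) ≤ a`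
  have hgrad {ψ : Rn n → ℂ} (h : IsEigenfunction v ψ) {a : ℝ} (ha1 : 1 ≤ a)
      (ha : (n : ℝ) ≤ (n - 1) * a) {q : ℝ≥0∞} (hq : ENNReal.ofReal a < q) :
      GradientMemLp ψ q := by
    obtain ⟨φ, hs⟩ := hstate h
    exact hs.gradientMemLp hn hvm hC hj
      (natCast_lt_mul_of_ofReal_lt (by omega) (by rwa [c1]) hq) (one_le_of_ofReal_lt ha1 hq)
  have hfun {ψ : Rn n → ℂ} (h : IsEigenfunction v ψ) {a : ℝ} (ha1 : 1 ≤ a)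
      (ha : (n : ℝ) ≤ (n - 2) * a) {q : ℝ≥0∞} (hq : ENNReal.ofReal a < q) :
      MemLp ψ q ∧ LaplacianMemLp ψ q := by
    obtain ⟨φ, hs⟩ := hstate h
    exact ⟨hs.memLp hn hvm hC hj
      (natCast_lt_mul_of_ofReal_lt (by omega) (by rwa [c2]) hq) (one_le_of_ofReal_lt ha1 hq),
      hs.laplacianMemLp hn hvm hC hj (one_le_of_ofReal_lt ha1 hq)⟩
  have hres (hn5 : 5 ≤ n) : ¬ IsZeroResonance v := by
    rintro ⟨ψ, h⟩
    obtain ⟨φ, -, hs⟩ := h.exists_isThresholdState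
    refine h.2.2 (hs.memLp hn hvm hC hj ?_ (by norm_num))
    norm_cast
    omega
  refine ⟨fun _ => ⟨?_, ?_, fun ψ h => ?_, fun ψ h => ?_⟩, fun hn5 => ⟨?_, hres hn5, fun ψ h => ?_⟩,
    isRegularPoint_iff hn hvm hC hj⟩
  · by_cases h1 : IsZeroResonance v <;> by_cases h2 : IsZeroEigenvalue v
    · refine ⟨.IV, ⟨h1, h2⟩, fun c hc => ?_⟩
      cases c <;> simp_all [ThresholdCase.Holds, IsRegularPoint]
    · refine ⟨.II, ⟨h1, h2⟩, fun c hc => ?_⟩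
      cases c <;> simp_all [ThresholdCase.Holds, IsRegularPoint]
    · refine ⟨.III, ⟨h2, h1⟩, fun c hc => ?_⟩
      cases c <;> simp_all [ThresholdCase.Holds, IsRegularPoint]
    · refine ⟨.I, ⟨h2, h1⟩, fun c hc => ?_⟩
      cases c <;> simp_all [ThresholdCase.Holds, IsRegularPoint]
  · rintro ⟨⟨ψ₀, h0⟩, he⟩
    exact ⟨ψ₀, h0, fun ψ h => h.exists_eq_const_mul hn hvm hC hj he h0⟩
  · obtain ⟨φ, -, hs⟩ := h.exists_isThresholdState
    refine ⟨?_, ?_, hgrad2 hs, fun q hq => hs.laplacianMemLp hn hvm hC hj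
      (le_trans (by norm_num) hq), h.2.2⟩
    · rintro rfl q hq
      exact hs.memLp hn hvm hC hj (by simpa using hq) (le_trans (by norm_num) hq.le)
    · rintro rfl q hq
      refine hs.memLp hn hvm hC hj (natCast_lt_mul_of_ofReal_lt (a := 2) (by norm_num)
        (by norm_num) (by simpa using hq)) (le_trans (by norm_num) hq.le)
  · obtain ⟨φ, hs⟩ := hstate h
    refine ⟨fun q hq => ⟨?_, hs.laplacianMemLp hn hvm hC hj (le_trans (by norm_num) hq)⟩,
      hgrad2 hs⟩
    refine memLp_of_memLp_two_of_memLp_top h.1.1 (hs.memLp hn hvm hC hj ?_ le_top) hq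
    rw [ENNReal.mul_top (by norm_cast; omega)]
    exact ENNReal.natCast_lt_top n
  · by_cases h2 : IsZeroEigenvalue v
    · exact Or.inr ⟨h2, fun hr => hr.1 h2⟩
    · exact Or.inl ⟨⟨h2, hres hn5⟩, h2⟩
  · refine ⟨fun _ q hq => ?_, fun h8 q hq _ => ?_, ?_, ?_, ?_, fun h8 q hq _ => ?_⟩
    · refine hfun h ?_ ?_ hq
      · rw [one_le_div (by linarith)]
        linarith
      · rw [mul_div_cancel₀ _ (by linarith)]
    · have h8' : (8 : ℝ) ≤ n := by exact_mod_cast h8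
      refine hfun h ?_ ?_ hq
      · rw [one_le_div (by linarith)]
        linarith
      · rw [← mul_div_assoc, le_div_iff₀ (by linarith)]
        nlinarith
    · rintro rfl q hq -
      refine hgrad h (a := 5 / 3) (by norm_num) (by norm_num) ?_
      rwa [ENNReal.ofReal_div_of_pos (by norm_num), ENNReal.ofReal_ofNat, ENNReal.ofReal_ofNat]
    · rintro rfl q hq -
      refine hgrad h (a := 3 / 2) (by norm_num) (by norm_num) ?_
      rwa [ENNReal.ofReal_div_of_pos (by norm_num), ENNReal.ofReal_ofNat, ENNReal.ofReal_ofNat]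
    · rintro rfl q hq -
      refine hgrad h (a := 7 / 5) (by norm_num) (by norm_num) ?_
      rwa [ENNReal.ofReal_div_of_pos (by norm_num), ENNReal.ofReal_ofNat, ENNReal.ofReal_ofNat]
    · have h8' : (8 : ℝ) ≤ n := by exact_mod_cast h8
      refine hgrad h ?_ ?_ hq
      · rw [one_le_div (by linarith)]
        linarith
      · rw [← mul_div_assoc, le_div_iff₀ (by linarith)]
        nlinarith
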